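/- Let $\sigma^2>0$, $\vartheta_2>0$, $\vartheta_1,\vartheta_0\in\mathbb R$, put $\kappa=\vartheta_1/\vartheta_2$, $\Gamma=\frac{\vartheta_1^2}{4\vartheta_2^2}-\frac{\vartheta_0}{\vartheta_2}$ and assume $\Gamma+\pi^2>0$. Consider on $[0,1]$ the linear parabolic SPDE $$dX_t(x)=\Big(\vartheta_2\tfrac{\partial^2}{\partial x^2}X_t(x)+\vartheta_1\tfrac{\partial}{\partial x}X_t(x)+\vartheta_0X_t(x)\Big)dt+\sigma\,dW_t(x),\qquad X_t(0)=X_t(1)=0,$$ driven by a cylindrical Brownian motion $W$, and let $X$ be its stationary solution, given by the spectral representation $$X_t(x)=\sum_{\ell\ge1}u_\ell(t)e_\ell(x),\qquad e_\ell(x)=\sqrt2\sin(\pi\ell x)e^{-\kappa x/2},\qquad du_\ell(t)=-\lambda_\ell u_\ell(t)\,dt+\sigma\,d\beta_\ell(t),\qquad \lambda_\ell=\vartheta_2(\pi^2\ell^2+\Gamma),$$ where the $\beta_\ell$ are standard Brownian motions, $u_\ell(0)\sim\mathcal N(0,\sigma^2/(2\lambda_\ell))$, and the family $\{\beta_\ell,u_\ell(0):\ell\ge1\}$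 is independent (the series for $X_t(x)$ converging in probability for each $t\ge 0$, $x\in[0,1]$). Fix $T>0$ and $b\in(0,1/2)$. For $M,N\in\mathbb N$ let $\delta=\frac{1-2b}{M}$, $\Delta=\frac TN$, $y_k=b+k\delta$, $t_i=i\Delta$, let $$D_{ik}=X_{t_{i+1}}(y_{k+1})-X_{t_{i+1}}(y_k)-X_{t_i}(y_{k+1})+X_{t_i}(y_k)$$ and $$\mathbb V_r=\frac1{MN\sqrt\Delta}\sum_{k=0}^{M-1}\sum_{i=0}^{N-1}\exp\Big(\frac\kappa2(y_k+y_{k+1})\Big)D_{ik}^2 .$$ Let $M,N\to\infty$ along sequences with $\delta/\sqrt\Delta= r$ for all members of the sequence, for a fixed $r\in(0,\infty)$. Then $$\sqrt{MN}\,\big(\mathbb V_r-\psi_{\vartheta_2}(r)\sigma^2\big)\ \overset{\mathcal D}{\longrightarrow}\ \mathcal N\Big(0,\;C\big(r/\sqrt{\vartheta_2}\big)\,\psi_{\vartheta_2}(r)^2\,\sigma^4\Big),$$ where $$\psi_{\vartheta_2}(r)=\frac2{\sqrt{\pi\vartheta_2}}\Big(1-e^{-\frac{r^2}{4\vartheta_2}}+\frac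 r{\sqrt{\vartheta_2}}\int_{\frac r{2\sqrt{\vartheta_2}}}^\infty e^{-z^2}dz\Big)$$ and, for $h>0$, $$C(h)=\frac2{\Lambda_{0,0}(h)^2}\sum_{j,l\in\mathbb Z}\Lambda_{j,l}(h)^2,\qquad \Lambda_{j,l}(h)=(D_x^2D_y^2G_h)(|j|-1,|l|-1),$$ with $D_x^2f(x,y)=f(x+2,y)+f(x,y)-2f(x+1,y)$, $D_y^2f(x,y)=f(x,y+2)+f(x,y)-2f(x,y+1)$, $G_h(x,y)=\sqrt{|x|}\,H\big(h|y|/\sqrt{|x|}\big)$ for $x\ne0$, $G_h(0,y)=0$, and $H(x)=\frac1{2\sqrt\pi}\big(e^{-x^2/4}-x\int_{x/2}^\infty e^{-z^2}dz\big)$. In particular, the double series in $C(r/\sqrt{\vartheta_2})$ converges. -/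

import Mathlib

open MeasureTheory ProbabilityTheory Filter Set
open scoped NNReal Topology

noncomputable section

/-! ### The operator `ϑ₂ ∂² + ϑ₁ ∂ + ϑ₀` on `[0,1]` with Dirichlet boundary conditions -/

/-- `κ = ϑ₁ / ϑ₂`. -/
def spdeKappa (ϑ₂ ϑ₁ : ℝ) : ℝ := ϑ₁ / ϑ₂

/-- `Γ = ϑ₁² / (4 ϑ₂²) - ϑ₀ / ϑ₂`. -/
def spdeGamma (ϑ₂ ϑ₁ ϑ₀ : ℝ) : ℝ := ϑ₁ ^ 2 / (4 * ϑ₂ ^ 2) - ϑ₀ / ϑ₂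

/-- `λ_ℓ = ϑ₂ (π² ℓ² + Γ)`; the eigenvalues of the operator are `-λ_ℓ`, `ℓ ≥ 1`. -/
def spdeEigenvalue (ϑ₂ ϑ₁ ϑ₀ : ℝ) (l : ℕ) : ℝ :=
  ϑ₂ * (Real.pi ^ 2 * (l : ℝ) ^ 2 + spdeGamma ϑ₂ ϑ₁ ϑ₀)

/-- The eigenfunction `e_ℓ(y) = √2 sin(π ℓ y) exp(-κ y / 2)`, `ℓ ≥ 1`. -/
def spdeEigenfunction (ϑ₂ ϑ₁ : ℝ) (l : ℕ) (y : ℝ) : ℝ :=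
  √2 * Real.sin (Real.pi * (l : ℝ) * y) * Real.exp (-(spdeKappa ϑ₂ ϑ₁ * y) / 2)

/-! ### The solution field

The families `β` (driving Brownian motions) and `u` (Fourier modes) are indexed by `ℕ`; the index
`l` stands for the mode with number `l + 1`. -/

/-- `X` is the stationary solution of
`dX = (ϑ₂ ∂²X + ϑ₁ ∂X + ϑ₀ X) dt + σ dW`, `X_t(0) = X_t(1) = 0`, given by its spectral
representation `X_t(x) = ∑_{ℓ ≥ 1} u_ℓ(t) e_ℓ(x)`, where the cylindrical Brownian motion `W` has
the coordinate processes `β_ℓ` and the modes solve `du_ℓ = -λ_ℓ u_ℓ dt + σ dβ_ℓ`. -/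
structure IsStationarySPDESolution {Ω : Type*} [MeasurableSpace Ω] (σ ϑ₂ ϑ₁ ϑ₀ : ℝ)
    (β u : ℕ → ℝ≥0 → Ω → ℝ) (X : ℝ≥0 → ℝ → Ω → ℝ) (μ : Measure Ω) : Prop where
  measurable_noise : ∀ l t, Measurable (β l t)
  measurable_mode : ∀ l t, Measurable (u l t)
  /-- Every `β_ℓ` is a standard Brownian motion. -/
  isBrownian : ∀ l, IsBrownianReal (β l) μ
  /-- The initial values have the stationary law `N(0, σ² / (2 λ_ℓ))`. -/
  initial_law : ∀ l, HasLaw (u l 0)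
    (gaussianReal 0 (Real.toNNReal (σ ^ 2 / (2 * spdeEigenvalue ϑ₂ ϑ₁ ϑ₀ (l + 1))))) μ
  /-- Together with `indep_initial`: the family `{β_ℓ, u_ℓ(0) : ℓ ≥ 1}` is independent. -/
  indep_modes : iIndepFun (fun l ω => ((fun t => β l t ω : ℝ≥0 → ℝ), u l 0 ω)) μ
  indep_initial : ∀ l, IndepFun (fun ω => (fun t => β l t ω : ℝ≥0 → ℝ)) (u l 0) μ
  /-- The modes have almost surely continuous paths. -/
  continuous_mode : ∀ l, ∀ᵐ ω ∂μ, Continuous fun t => u l t ω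
  /-- The Ornstein-Uhlenbeck equation `du_ℓ = -λ_ℓ u_ℓ dt + σ dβ_ℓ`, in integrated form. -/
  ornstein_uhlenbeck : ∀ l, ∀ᵐ ω ∂μ, ∀ t : ℝ≥0,
    u l t ω = u l 0 ω
      - spdeEigenvalue ϑ₂ ϑ₁ ϑ₀ (l + 1) * (∫ s in (0 : ℝ)..(t : ℝ), u l (Real.toNNReal s) ω)
      + σ * β l t ω
  /-- `X_t(x) = ∑_{ℓ ≥ 1} u_ℓ(t) e_ℓ(x)`: the partial sums converge in probability (which is
  implied by convergence in mean square, and by almost sure convergence). -/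
  series : ∀ (t : ℝ≥0), ∀ x ∈ Icc (0 : ℝ) 1,
    TendstoInMeasure μ
      (fun (n : ℕ) ω => ∑ l ∈ Finset.range n, u l t ω * spdeEigenfunction ϑ₂ ϑ₁ (l + 1) x)
      atTop (X t x)

/-! ### Observation grid and realized space-time variation -/

/-- `δ = (1 - 2b) / M`. -/
def spaceStep (b : ℝ) (M : ℕ) : ℝ := (1 - 2 * b) / (M : ℝ)

/-- `Δ = T / N`. -/
def timeStep (T : ℝ≥0) (N : ℕ) : ℝ≥0 := T / (N : ℝ≥0)

/-- `y_k = b + k δ`. -/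
def spacePoint (b : ℝ) (M k : ℕ) : ℝ := b + (k : ℝ) * spaceStep b M

/-- `t_i = i Δ`. -/
def timePoint (T : ℝ≥0) (N i : ℕ) : ℝ≥0 := (i : ℝ≥0) * timeStep T N

/-- The double increment
`D_{ik} = X_{t_{i+1}}(y_{k+1}) - X_{t_{i+1}}(y_k) - X_{t_i}(y_{k+1}) + X_{t_i}(y_k)`. -/
def doubleIncrement {Ω : Type*} (X : ℝ≥0 → ℝ → Ω → ℝ) (b : ℝ) (T : ℝ≥0) (M N i k : ℕ)
    (ω : Ω) : ℝ :=
  X (timePoint T N (i + 1)) (spacePoint b M (k + 1)) ω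
    - X (timePoint T N (i + 1)) (spacePoint b M k) ω
    - X (timePoint T N i) (spacePoint b M (k + 1)) ω
    + X (timePoint T N i) (spacePoint b M k) ω

/-- `𝕍_r = (M N √Δ)⁻¹ ∑_{k < M} ∑_{i < N} exp(κ (y_k + y_{k+1}) / 2) D_{ik}²`. -/
def realizedVariation {Ω : Type*} (X : ℝ≥0 → ℝ → Ω → ℝ) (κ b : ℝ) (T : ℝ≥0) (M N : ℕ)
    (ω : Ω) : ℝ :=
  1 / ((M : ℝ) * (N : ℝ) * √(timeStep T N : ℝ)) *
    ∑ k ∈ Finset.range M, ∑ i ∈ Finset.range N,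
      Real.exp (κ / 2 * (spacePoint b M k + spacePoint b M (k + 1)))
        * doubleIncrement X b T M N i k ω ^ 2

/-! ### The constants in the limit theorem -/

/-- `ψ_{ϑ₂}(r) = 2 / √(π ϑ₂) (1 - exp(-r² / (4 ϑ₂)) + r / √ϑ₂ ∫_{r / (2√ϑ₂)}^∞ exp(-z²) dz)`. -/
def psiFun (ϑ₂ r : ℝ) : ℝ :=
  2 / √(Real.pi * ϑ₂) *
    (1 - Real.exp (-(r ^ 2 / (4 * ϑ₂)))
      + r / √ϑ₂ * ∫ z in Ioi (r / (2 * √ϑ₂)), Real.exp (-z ^ 2))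

/-- `H(x) = (2√π)⁻¹ (exp(-x² / 4) - x ∫_{x/2}^∞ exp(-z²) dz)`. -/
def HFun (x : ℝ) : ℝ :=
  1 / (2 * √Real.pi) * (Real.exp (-(x ^ 2 / 4)) - x * ∫ z in Ioi (x / 2), Real.exp (-z ^ 2))

/-- `G_h(x, y) = √|x| H(h |y| / √|x|)` for `x ≠ 0`, and `G_h(0, y) = 0`. -/
def GFun (h x y : ℝ) : ℝ :=
  if x = 0 then 0 else √|x| * HFun (h * |y| / √|x|)

/-- `(D_x² f)(x, y) = f(x+2, y) + f(x, y) - 2 f(x+1, y)`. -/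
def secondDiffX (f : ℝ → ℝ → ℝ) (x y : ℝ) : ℝ := f (x + 2) y + f x y - 2 * f (x + 1) y

/-- `(D_y² f)(x, y) = f(x, y+2) + f(x, y) - 2 f(x, y+1)`. -/
def secondDiffY (f : ℝ → ℝ → ℝ) (x y : ℝ) : ℝ := f x (y + 2) + f x y - 2 * f x (y + 1)

/-- `Λ_{j,l}(h) = (D_x² D_y² G_h)(|j| - 1, |l| - 1)`, `j, l ∈ ℤ`. -/
def LambdaFun (h : ℝ) (j l : ℤ) : ℝ :=
  secondDiffX (secondDiffY (GFun h)) (|(j : ℝ)| - 1) (|(l : ℝ)| - 1)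

/-- `C(h) = 2 / Λ_{0,0}(h)² ∑_{j,l ∈ ℤ} Λ_{j,l}(h)²`. -/
def CFun (h : ℝ) : ℝ :=
  2 / LambdaFun h 0 0 ^ 2 * ∑' p : ℤ × ℤ, LambdaFun h p.1 p.2 ^ 2

end

/-!
Summing the stationary covariances `σ² e^{-λ_ℓ t} / (2 λ_ℓ)` of the modes against products of
eigenfunctions gives theta-type series, which Poisson summation turns into sums of heat kernels over
the images of a point under the reflections at `0` and `1`. On `[b, 1 - b]` only the unreflected
image matters, and second differencing in time and in space leaves `√Δ` times a multiple of
`Λ_{i-i', k-k'}(r / √ϑ₂)`, up to an error of order `Δ^{3/2}`. After normalization the weighted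
double increments thus form a Gaussian vector whose covariance matrix is `(MN)^{-1/2}` times a
two-level Toeplitz matrix with square summable coefficients `v_z`, up to a negligible perturbation.

For a centred Gaussian vector `Y` with covariance matrix `S`, `∑ Y_i² - tr S` is a sum of
independent centred chi-square variables weighted by the eigenvalues of `S`. It is asymptotically
normal with variance `lim 2 tr S²` as soon as `tr S²` converges and the largest eigenvalue tends to
`0`; for the matrices at hand `tr S² → ∑ v_z²`.
-/

section WeightedCLT

theorem norm_prod_sub_prod_le {ι : Type*} (s : Finset ι) (a b : ι → ℂ)
    (ha : ∀ i ∈ s, ‖a i‖ ≤ 1) (hb : ∀ i ∈ s, ‖b i‖ ≤ 1) :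
    ‖∏ i ∈ s, a i - ∏ i ∈ s, b i‖ ≤ ∑ i ∈ s, ‖a i - b i‖ := by
  classical
  induction s using Finset.induction_on with
  | empty => simp
  | insert i s hi ih =>
    rw [Finset.prod_insert hi, Finset.prod_insert hi, Finset.sum_insert hi]
    simp only [Finset.forall_mem_insert] at ha hb
    have telescope : a i * ∏ j ∈ s, a j - b i * ∏ j ∈ s, b j
        = (a i - b i) * ∏ j ∈ s, a j + b i * (∏ j ∈ s, a j - ∏ j ∈ s, b j) := by ring
    have hprod : ‖∏ j ∈ s, a j‖ ≤ 1 := by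
      rw [norm_prod]
      exact Finset.prod_le_one (fun _ _ => norm_nonneg _) ha.2
    rw [telescope]
    refine (norm_add_le _ _).trans (add_le_add ?_ ?_)
    · rw [norm_mul]
      exact mul_le_of_le_one_right (norm_nonneg _) hprod
    · rw [norm_mul]
      exact (mul_le_of_le_one_left (norm_nonneg _) hb.1).trans (ih ha.2 hb.2)

theorem exp_neg_sq_div_two_sub_isLittleO :
    (fun t : ℝ => Complex.exp (-(t : ℂ) ^ 2 / 2) - (1 - (t : ℂ) ^ 2 / 2))
      =o[𝓝 0] fun t : ℝ => t ^ 2 := by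
  have hexp : (fun z : ℂ => Complex.exp z - (1 + z)) =o[𝓝 0] fun z => z := by
    have h := (Complex.hasDerivAt_exp 0).isLittleO
    simp only [Complex.exp_zero, sub_zero, smul_eq_mul, mul_one] at h
    exact h.congr_left fun z => by ring
  have hsq : Tendsto (fun t : ℝ => -(t : ℂ) ^ 2 / 2) (𝓝 0) (𝓝 0) := by
    have : Continuous fun t : ℝ => -(t : ℂ) ^ 2 / 2 := by fun_prop
    simpa using this.tendsto 0
  have hsqO : (fun t : ℝ => -(t : ℂ) ^ 2 / 2) =O[𝓝 0] fun t : ℝ => t ^ 2 := by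
    refine Asymptotics.isBigO_of_le _ fun t => ?_
    simp only [norm_div, norm_neg, norm_pow, Complex.norm_real, Complex.norm_ofNat]
    linarith [sq_nonneg ‖t‖]
  refine ((hexp.comp_tendsto hsq).trans_isBigO hsqO).congr_left fun t => ?_
  simp only [Function.comp_apply]
  ring

theorem norm_exp_neg_sq_div_two_le_one (t : ℝ) : ‖Complex.exp (-(t : ℂ) ^ 2 / 2)‖ ≤ 1 := by
  have hcast : -(t : ℂ) ^ 2 / 2 = ((-t ^ 2 / 2 : ℝ) : ℂ) := by push_cast; rfl
  rw [hcast, Complex.norm_exp_ofReal, Real.exp_le_one_iff]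
  linarith [sq_nonneg t]

variable {ν : Measure ℝ} [IsProbabilityMeasure ν]

theorem charFun_sub_exp_isLittleO (hmean : ∫ x, x ∂ν = 0) (hvar : ∫ x, x ^ 2 ∂ν = 1) :
    (fun t : ℝ => charFun ν t - Complex.exp (-(t : ℂ) ^ 2 / 2)) =o[𝓝 0] fun t : ℝ => t ^ 2 := by
  have h := taylor_charFun_two (P := ν) (X := id) aemeasurable_id hmean hvar
  rw [Measure.map_id] at h
  exact (h.sub exp_neg_sq_div_two_sub_isLittleO).congr_left fun t => sub_sub_sub_cancel_right _ _ _

theorem exists_norm_prod_charFun_sub_exp_le (hmean : ∫ x, x ∂ν = 0) (hvar : ∫ x, x ^ 2 ∂ν = 1)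
    {ε : ℝ} (hε : 0 < ε) :
    ∃ η > 0, ∀ {ι : Type*} (s : Finset ι) (x : ι → ℝ), (∀ i ∈ s, |x i| ≤ η) →
      ‖∏ i ∈ s, charFun ν (x i) - Complex.exp (-((∑ i ∈ s, x i ^ 2 : ℝ) : ℂ) / 2)‖
        ≤ ε * ∑ i ∈ s, x i ^ 2 := by
  obtain ⟨η, hη, hfactor⟩ :=
    Metric.eventually_nhds_iff.1 ((charFun_sub_exp_isLittleO hmean hvar).bound hε)
  refine ⟨η / 2, by positivity, fun s x hx => ?_⟩
  have hexp : Complex.exp (-((∑ i ∈ s, x i ^ 2 : ℝ) : ℂ) / 2)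
      = ∏ i ∈ s, Complex.exp (-(x i : ℂ) ^ 2 / 2) := by
    rw [← Complex.exp_sum, ← Finset.sum_div, Finset.sum_neg_distrib]
    push_cast
    rfl
  rw [hexp, Finset.mul_sum]
  refine (norm_prod_sub_prod_le s _ _ (fun _ _ => norm_charFun_le_one _)
    fun _ _ => norm_exp_neg_sq_div_two_le_one _).trans (Finset.sum_le_sum fun i hi => ?_)
  have hi' : dist (x i) 0 < η := by
    rw [Real.dist_eq, sub_zero]
    linarith [hx i hi]
  simpa only [norm_pow, Real.norm_eq_abs, sq_abs] using hfactor hi'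

theorem tendsto_prod_charFun (hmean : ∫ x, x ∂ν = 0) (hvar : ∫ x, x ^ 2 ∂ν = 1)
    {α : Type*} {l : Filter α} {ι : α → Type*} [∀ n, Fintype (ι n)] {x : ∀ n, ι n → ℝ} {s : ℝ}
    (hsmall : ∀ η > 0, ∀ᶠ n in l, ∀ i, |x n i| ≤ η)
    (hs : Tendsto (fun n => ∑ i, x n i ^ 2) l (𝓝 s)) :
    Tendsto (fun n => ∏ i, charFun ν (x n i)) l (𝓝 (Complex.exp (-(s : ℂ) / 2))) := by
  have hexp : Tendsto (fun n => Complex.exp (-((∑ i, x n i ^ 2 : ℝ) : ℂ) / 2)) l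
      (𝓝 (Complex.exp (-(s : ℂ) / 2))) := by
    have hcont : Continuous fun y : ℝ => Complex.exp (-(y : ℂ) / 2) := by fun_prop
    exact (hcont.tendsto s).comp hs
  have hdiff : Tendsto (fun n => ∏ i, charFun ν (x n i)
      - Complex.exp (-((∑ i, x n i ^ 2 : ℝ) : ℂ) / 2)) l (𝓝 0) := by
    rw [Metric.tendsto_nhds]
    intro ε hε
    have hD : 0 < |s| + 1 := by positivity
    obtain ⟨η, hη, hbound⟩ := exists_norm_prod_charFun_sub_exp_le hmean hvar (div_pos hε hD)
    have hs' : s < |s| + 1 := (le_abs_self s).trans_lt (lt_add_one _)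
    filter_upwards [hsmall η hη, hs.eventually_lt_const hs'] with n hx hsum
    rw [dist_zero_right]
    calc _ ≤ ε / (|s| + 1) * ∑ i, x n i ^ 2 := hbound _ _ fun i _ => hx i
      _ < ε / (|s| + 1) * (|s| + 1) := mul_lt_mul_of_pos_left hsum (div_pos hε hD)
      _ = ε := div_mul_cancel₀ _ hD.ne'
  simpa only [sub_add_cancel, zero_add] using hdiff.add hexp

end WeightedCLT

section ChiSquare

open scoped Nat

theorem integrable_pow_gaussianReal (m : ℝ) (v : ℝ≥0) (n : ℕ) :
    Integrable (fun x : ℝ => x ^ n) (gaussianReal m v) := by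
  have hnorm :=
    (memLp_id_gaussianReal' (μ := m) (v := v) (n : ENNReal) (by simp)).integrable_norm_pow'
  exact hnorm.mono' (by fun_prop) (ae_of_all _ fun x => by simp)

theorem integral_even_pow_gaussianReal (n : ℕ) :
    ∫ x, x ^ (2 * n) ∂gaussianReal 0 1 = ((2 * n - 1)‼ : ℕ) := by
  have hdensity : ∀ x : ℝ, gaussianPDFReal 0 1 x • x ^ (2 * n) =
      (√(2 * Real.pi))⁻¹ * (|x| ^ ((2 * n : ℕ) : ℝ) * Real.exp (-(1 / 2) * |x| ^ (2 : ℝ))) := by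
    intro x
    rw [Real.rpow_natCast, (even_two_mul n).pow_abs, Real.rpow_two, sq_abs, gaussianPDFReal]
    simp only [NNReal.coe_one, mul_one, sub_zero, smul_eq_mul]
    rw [show -x ^ 2 / 2 = -(1 / 2) * x ^ 2 by ring]
    ring
  have hhalf : ((1 : ℝ) / 2) ^ (-(((2 * n : ℕ) : ℝ) + 1) / 2) = 2 ^ n * √2 := by
    rw [one_div, Real.inv_rpow zero_le_two, ← Real.rpow_neg zero_le_two, Real.sqrt_eq_rpow,
      ← Real.rpow_natCast, ← Real.rpow_add zero_lt_two]
    congr 1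
    push_cast
    ring
  rw [integral_gaussianReal_eq_integral_smul one_ne_zero]
  simp_rw [hdensity]
  rw [integral_const_mul, integral_comp_abs
      (f := fun y => y ^ ((2 * n : ℕ) : ℝ) * Real.exp (-(1 / 2) * y ^ (2 : ℝ))),
    integral_rpow_mul_exp_neg_mul_rpow zero_lt_two (by linarith [Nat.cast_nonneg (α := ℝ) (2 * n)])
      one_half_pos, hhalf,
    show (((2 * n : ℕ) : ℝ) + 1) / 2 = n + 1 / 2 by push_cast; ring, Real.Gamma_nat_add_half,
    Real.sqrt_mul zero_le_two]
  have : 0 < √Real.pi := Real.sqrt_pos.2 Real.pi_pos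
  field_simp

/-- The standardization `(Z² - 1) / √2` of the square of a standard Gaussian variable `Z`; under
`gaussianReal 0 1` it has mean `0` and variance `1`. -/
noncomputable def stdChiSq (x : ℝ) : ℝ := (x ^ 2 - 1) / √2

theorem measurable_stdChiSq : Measurable stdChiSq := by
  unfold stdChiSq
  fun_prop

theorem integral_stdChiSq : ∫ x, stdChiSq x ∂gaussianReal 0 1 = 0 := by
  have hsq : ∫ x, x ^ 2 ∂gaussianReal 0 1 = 1 := by simpa using integral_even_pow_gaussianReal 1
  simp only [stdChiSq]
  rw [integral_div, integral_sub (integrable_pow_gaussianReal 0 1 2) (integrable_const _), hsq]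
  simp

theorem integral_stdChiSq_sq : ∫ x, stdChiSq x ^ 2 ∂gaussianReal 0 1 = 1 := by
  have hsq : ∫ x, x ^ 2 ∂gaussianReal 0 1 = 1 := by simpa using integral_even_pow_gaussianReal 1
  have hfour : ∫ x, x ^ 4 ∂gaussianReal 0 1 = 3 := by
    simpa [Nat.doubleFactorial] using integral_even_pow_gaussianReal 2
  have hexpand : ∀ x, stdChiSq x ^ 2 = (x ^ 4 - 2 * x ^ 2 + 1) / 2 := fun x => by
    rw [stdChiSq, div_pow, Real.sq_sqrt zero_le_two]
    ring
  have hi₂ := (integrable_pow_gaussianReal 0 1 2).const_mul 2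
  have hi₄ := integrable_pow_gaussianReal 0 1 4
  have hi : Integrable (fun x : ℝ => x ^ 4 - 2 * x ^ 2) (gaussianReal 0 1) := hi₄.sub hi₂
  simp_rw [hexpand]
  rw [integral_div, integral_add hi (integrable_const _), integral_sub hi₄ hi₂,
    integral_const_mul, hsq, hfour]
  norm_num

theorem tendsto_prod_charFun_stdChiSq {α : Type*} {l : Filter α} {ι : α → Type*}
    [∀ n, Fintype (ι n)] {x : ∀ n, ι n → ℝ} {s : ℝ}
    (hsmall : ∀ η > 0, ∀ᶠ n in l, ∀ i, |x n i| ≤ η)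
    (hs : Tendsto (fun n => ∑ i, x n i ^ 2) l (𝓝 s)) :
    Tendsto (fun n => ∏ i, charFun ((gaussianReal 0 1).map stdChiSq) (x n i)) l
      (𝓝 (Complex.exp (-(s : ℂ) / 2))) := by
  have := Measure.isProbabilityMeasure_map (μ := gaussianReal 0 1) measurable_stdChiSq.aemeasurable
  refine tendsto_prod_charFun ?_ ?_ hsmall hs
  · rw [integral_map measurable_stdChiSq.aemeasurable (by fun_prop), integral_stdChiSq]
  · rw [integral_map measurable_stdChiSq.aemeasurable (by fun_prop), integral_stdChiSq_sq]

end ChiSquare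

section QuadraticForm

open Matrix

theorem eigenvalues_abs_le_of_row_sum_le {ι : Type*} [Fintype ι] [DecidableEq ι]
    {S : Matrix ι ι ℝ} (hS : S.IsHermitian) {R : ℝ} (hR : ∀ i, ∑ j, |S i j| ≤ R) (k : ι) :
    |hS.eigenvalues k| ≤ R := by
  have hmem : Module.End.HasEigenvalue (toLin' S) (hS.eigenvalues k) := by
    refine Module.End.hasEigenvalue_of_hasEigenvector (x := ⇑(hS.eigenvectorBasis k))
      ⟨Module.End.mem_eigenspace_iff.2 (hS.mulVec_eigenvectorBasis k), fun h => ?_⟩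
    exact hS.eigenvectorBasis.orthonormal.ne_zero k (PiLp.ext fun j => congrFun h j)
  obtain ⟨i, hi⟩ := eigenvalue_mem_ball hmem
  rw [mem_closedBall_iff_norm, Real.norm_eq_abs] at hi
  calc |hS.eigenvalues k| ≤ |S i i| + |hS.eigenvalues k - S i i| := by
        simpa using abs_add_le (S i i) (hS.eigenvalues k - S i i)
    _ ≤ |S i i| + ∑ j ∈ Finset.univ.erase i, ‖S i j‖ := by gcongr
    _ = ∑ j, |S i j| := Finset.add_sum_erase _ (fun j => |S i j|) (Finset.mem_univ i)
    _ ≤ R := hR i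

theorem sum_sq_eigenvalues {ι : Type*} [Fintype ι] [DecidableEq ι] {S : Matrix ι ι ℝ}
    (hS : S.IsHermitian) : ∑ k, hS.eigenvalues k ^ 2 = ∑ i, ∑ j, S i j ^ 2 := by
  have htrace : (S * S).trace = ∑ k, hS.eigenvalues k ^ 2 := by
    have hdiag : S * S = Unitary.conjStarAlgAut ℝ (Matrix ι ι ℝ) hS.eigenvectorUnitary
        (Matrix.diagonal (RCLike.ofReal ∘ hS.eigenvalues) *
          Matrix.diagonal (RCLike.ofReal ∘ hS.eigenvalues)) := by
      rw [map_mul, ← hS.spectral_theorem]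
    rw [hdiag, Unitary.conjStarAlgAut_apply, trace_mul_cycle]
    simp [Matrix.diagonal_mul_diagonal, trace_diagonal, sq]
  rw [← htrace]
  simp only [trace, diag, mul_apply]
  refine Finset.sum_congr rfl fun i _ => Finset.sum_congr rfl fun j _ => ?_
  have hsymm : S j i = S i j := by simpa using hS.apply i j
  rw [hsymm, sq]

variable {ι : Type*} [Fintype ι] [DecidableEq ι] {S : Matrix ι ι ℝ}

open scoped MatrixOrder in
theorem norm_sq_toEuclideanCLM_sqrt_sum_eigenvectorBasis (hS : S.PosSemidef) (x : ι → ℝ) :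
    ‖toEuclideanCLM (𝕜 := ℝ) (CFC.sqrt S) (∑ i, x i • hS.1.eigenvectorBasis i)‖ ^ 2
      = ∑ i, hS.1.eigenvalues i * x i ^ 2 := by
  have hself : IsSelfAdjoint (toEuclideanCLM (𝕜 := ℝ) (CFC.sqrt S)) :=
    (CFC.sqrt_nonneg S).isSelfAdjoint.map _
  have hbasis : ∀ i, toEuclideanCLM (𝕜 := ℝ) S (hS.1.eigenvectorBasis i)
      = hS.1.eigenvalues i • hS.1.eigenvectorBasis i := fun i => by
    ext k
    simpa [ofLp_toEuclideanCLM] using congrFun (hS.1.mulVec_eigenvectorBasis i) k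
  rw [← real_inner_self_eq_norm_sq, ← ContinuousLinearMap.adjoint_inner_right,
    hself.adjoint_eq, ← ContinuousLinearMap.comp_apply, ← ContinuousLinearMap.mul_def, ← map_mul,
    CFC.sqrt_mul_sqrt_self _ hS.nonneg, map_sum]
  simp_rw [map_smul, hbasis, smul_smul]
  rw [hS.1.eigenvectorBasis.orthonormal.inner_sum]
  exact Finset.sum_congr rfl fun i _ => by rw [conj_trivial]; ring

theorem map_norm_sq_multivariateGaussian (hS : S.PosSemidef) :
    (multivariateGaussian 0 S).map (fun y => ‖y‖ ^ 2) =
      (Measure.pi fun _ => gaussianReal 0 1).map fun x => ∑ i, hS.1.eigenvalues i * x i ^ 2 := by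
  rw [multivariateGaussian, stdGaussian_eq_map_pi_orthonormalBasis hS.1.eigenvectorBasis,
    Measure.map_map (by fun_prop) (by fun_prop), Measure.map_map (by fun_prop) (by fun_prop)]
  congr 1
  funext x
  simp only [Function.comp_apply, zero_add]
  exact norm_sq_toEuclideanCLM_sqrt_sum_eigenvectorBasis hS x

theorem charFun_map_norm_sq_sub_trace_multivariateGaussian (hS : S.PosSemidef) (t : ℝ) :
    charFun ((multivariateGaussian 0 S).map fun y => ‖y‖ ^ 2 - S.trace) t
      = ∏ i, charFun ((gaussianReal 0 1).map stdChiSq) (√2 * t * hS.1.eigenvalues i) := by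
  have hlaw : (multivariateGaussian 0 S).map (fun y => ‖y‖ ^ 2 - S.trace)
      = (Measure.pi fun _ => gaussianReal 0 1).map
        fun x => ∑ i, √2 * hS.1.eigenvalues i * stdChiSq (x i) := by
    have hcomp : (fun y : EuclideanSpace ℝ ι => ‖y‖ ^ 2 - S.trace)
        = (fun s : ℝ => s - S.trace) ∘ fun y => ‖y‖ ^ 2 := rfl
    rw [hcomp, ← Measure.map_map (by fun_prop) (by fun_prop),
      map_norm_sq_multivariateGaussian hS, Measure.map_map (by fun_prop) (by fun_prop)]
    congr 1
    funext x
    simp only [Function.comp_apply, hS.1.trace_eq_sum_eigenvalues, stdChiSq,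
      RCLike.ofReal_real_eq_id, id_eq, ← Finset.sum_sub_distrib]
    exact Finset.sum_congr rfl fun i _ => by field_simp
  have hmeas : Measurable fun x : ι → ℝ => ∑ i, √2 * hS.1.eigenvalues i * stdChiSq (x i) := by
    have := measurable_stdChiSq
    fun_prop
  have hfactor : ∀ x : ι → ℝ, Complex.exp
      ((t : ℂ) * ((∑ i, √2 * hS.1.eigenvalues i * stdChiSq (x i) : ℝ) : ℂ) * Complex.I)
      = ∏ i, Complex.exp
        (((√2 * t * hS.1.eigenvalues i : ℝ) : ℂ) * (stdChiSq (x i) : ℂ) * Complex.I) := fun x => by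
    rw [← Complex.exp_sum, ← Finset.sum_mul]
    congr 2
    push_cast
    rw [Finset.mul_sum]
    exact Finset.sum_congr rfl fun i _ => by ring
  rw [hlaw, charFun_apply_real, integral_map hmeas.aemeasurable (by fun_prop)]
  simp_rw [hfactor]
  rw [integral_fintype_prod_eq_prod (f := fun i (y : ℝ) => Complex.exp
    (((√2 * t * hS.1.eigenvalues i : ℝ) : ℂ) * (stdChiSq y : ℂ) * Complex.I))]
  refine Finset.prod_congr rfl fun i _ => ?_
  rw [charFun_apply_real, integral_map measurable_stdChiSq.aemeasurable (by fun_prop)]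

end QuadraticForm

section GaussianVector

open Matrix

variable {Ω ι : Type*} [Fintype ι] [MeasurableSpace Ω] {P : Measure Ω}
  [IsProbabilityMeasure P] {Y : Ω → ι → ℝ} {S : Matrix ι ι ℝ}

theorem posSemidef_of_integral_exp_eq (hS : S.IsHermitian)
    (hchar : ∀ w : ι → ℝ, ∫ ω, Complex.exp (((∑ i, w i * Y ω i : ℝ) : ℂ) * Complex.I) ∂P
      = Complex.exp (-((∑ i, ∑ j, w i * w j * S i j : ℝ) : ℂ) / 2)) : S.PosSemidef := by
  refine PosSemidef.of_dotProduct_mulVec_nonneg hS fun w => ?_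
  have hquad : star w ⬝ᵥ (S *ᵥ w) = ∑ i, ∑ j, w i * w j * S i j := by
    simp only [dotProduct, mulVec, Pi.star_apply, star_trivial, Finset.mul_sum]
    exact Finset.sum_congr rfl fun i _ => Finset.sum_congr rfl fun j _ => by ring
  have hnorm : ‖∫ ω, Complex.exp (((∑ i, w i * Y ω i : ℝ) : ℂ) * Complex.I) ∂P‖ ≤ 1 := by
    refine (norm_integral_le_of_norm_le_const (C := 1) (ae_of_all _ fun ω => ?_)).trans ?_
    · rw [Complex.norm_exp_ofReal_mul_I]
    · simp
  have hcast : -((∑ i, ∑ j, w i * w j * S i j : ℝ) : ℂ) / 2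
      = ((-(∑ i, ∑ j, w i * w j * S i j) / 2 : ℝ) : ℂ) := by
    push_cast
    rfl
  rw [hchar w, hcast, Complex.norm_exp_ofReal, Real.exp_le_one_iff] at hnorm
  rw [hquad]
  linarith

theorem hasLaw_multivariateGaussian_of_integral_exp_eq [DecidableEq ι] (hY : AEMeasurable Y P)
    (hS : S.IsHermitian)
    (hchar : ∀ w : ι → ℝ, ∫ ω, Complex.exp (((∑ i, w i * Y ω i : ℝ) : ℂ) * Complex.I) ∂P
      = Complex.exp (-((∑ i, ∑ j, w i * w j * S i j : ℝ) : ℂ) / 2)) :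
    HasLaw (fun ω => WithLp.toLp 2 (Y ω)) (multivariateGaussian 0 S) P := by
  have hmeas : AEMeasurable (fun ω => WithLp.toLp 2 (Y ω)) P :=
    (WithLp.measurable_toLp 2 (ι → ℝ)).comp_aemeasurable hY
  have := Measure.isProbabilityMeasure_map hmeas
  refine ⟨hmeas, Measure.ext_of_charFun (funext fun w => ?_)⟩
  have hinner : ∀ ω, inner ℝ (WithLp.toLp 2 (Y ω)) w = ∑ i, w i * Y ω i := fun ω => by
    simp [PiLp.inner_apply]
  have hquad : w.ofLp ⬝ᵥ (S *ᵥ w.ofLp) = ∑ i, ∑ j, w i * w j * S i j := by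
    simp only [dotProduct, mulVec, Finset.mul_sum]
    exact Finset.sum_congr rfl fun i _ => Finset.sum_congr rfl fun j _ => by ring
  rw [charFun_multivariateGaussian (posSemidef_of_integral_exp_eq hS hchar), charFun_apply,
    integral_map hmeas (by fun_prop), hquad]
  simp_rw [hinner]
  rw [hchar w.ofLp, inner_zero_right, Complex.ofReal_zero, zero_mul, zero_sub, neg_div]

end GaussianVector

section GaussianNormSq

variable {Ω : Type*} [MeasurableSpace Ω] {P : Measure Ω}

theorem charFun_map_norm_sq_sub_of_hasLaw_multivariateGaussian {ι : Type*} [Fintype ι]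
    [DecidableEq ι] {Y : Ω → EuclideanSpace ℝ ι} {S : Matrix ι ι ℝ}
    (hY : HasLaw Y (multivariateGaussian 0 S) P) (hS : S.PosSemidef) (c t : ℝ) :
    charFun (P.map fun ω => ‖Y ω‖ ^ 2 - c) t
      = (∏ i, charFun ((gaussianReal 0 1).map stdChiSq) (√2 * t * hS.1.eigenvalues i))
        * Complex.exp (((t * (S.trace - c) : ℝ) : ℂ) * Complex.I) := by
  have hsplit : (fun ω => ‖Y ω‖ ^ 2 - c)
      = (fun s : ℝ => s + (S.trace - c)) ∘ (fun y => ‖y‖ ^ 2 - S.trace) ∘ Y := by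
    funext ω
    simp
  rw [hsplit, ← AEMeasurable.map_map_of_aemeasurable (by fun_prop)
      (Measurable.comp_aemeasurable (by fun_prop) hY.aemeasurable),
    ← AEMeasurable.map_map_of_aemeasurable (by fun_prop) hY.aemeasurable, hY.map_eq,
    charFun_map_add_const, charFun_map_norm_sq_sub_trace_multivariateGaussian hS]
  simp

theorem tendstoInDistribution_norm_sq_sub_of_hasLaw_multivariateGaussian
    [IsProbabilityMeasure P] {ι : ℕ → Type*} [∀ n, Fintype (ι n)] [∀ n, DecidableEq (ι n)]
    {Y : ∀ n, Ω → EuclideanSpace ℝ (ι n)} {S : ∀ n, Matrix (ι n) (ι n) ℝ} {c : ℕ → ℝ} {V : ℝ}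
    (hY : ∀ n, HasLaw (Y n) (multivariateGaussian 0 (S n)) P) (hS : ∀ n, (S n).PosSemidef)
    (hrow : ∀ η > 0, ∀ᶠ n in atTop, ∀ p, ∑ q, |S n p q| ≤ η)
    (hsq : Tendsto (fun n => ∑ p, ∑ q, S n p q ^ 2) atTop (𝓝 V))
    (htrace : Tendsto (fun n => (S n).trace - c n) atTop (𝓝 0)) :
    TendstoInDistribution (fun n ω => ‖Y n ω‖ ^ 2 - c n) atTop (id : ℝ → ℝ) (fun _ => P)
      (gaussianReal 0 (Real.toNNReal (2 * V))) := by
  have hV : 0 ≤ V := ge_of_tendsto' hsq fun n =>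
    Finset.sum_nonneg fun p _ => Finset.sum_nonneg fun q _ => sq_nonneg _
  have hmeas : ∀ n, AEMeasurable (fun ω => ‖Y n ω‖ ^ 2 - c n) P := fun n =>
    ((hY n).aemeasurable.norm.pow_const 2).sub_const _
  refine ⟨hmeas, by fun_prop, ProbabilityMeasure.tendsto_iff_tendsto_charFun.2 fun t => ?_⟩
  simp only [ProbabilityMeasure.coe_mk, Measure.map_id, charFun_gaussianReal]
  have hsmall : ∀ η > 0, ∀ᶠ n in atTop, ∀ i, |√2 * t * (hS n).1.eigenvalues i| ≤ η := by
    intro η hη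
    have hb : 0 < |√2 * t| + 1 := by positivity
    filter_upwards [hrow _ (div_pos hη hb)] with n hn i
    have hi := (le_div_iff₀' hb).1 (eigenvalues_abs_le_of_row_sum_le (hS n).1 hn i)
    rw [abs_mul]
    linarith [abs_nonneg ((hS n).1.eigenvalues i)]
  have hsum : Tendsto (fun n => ∑ i, (√2 * t * (hS n).1.eigenvalues i) ^ 2) atTop
      (𝓝 (2 * t ^ 2 * V)) := by
    refine (hsq.const_mul (2 * t ^ 2)).congr fun n => ?_
    simp only [← sum_sq_eigenvalues (hS n).1, mul_pow, Real.sq_sqrt zero_le_two, Finset.mul_sum]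
  have hphase : Tendsto (fun n => Complex.exp (((t * ((S n).trace - c n) : ℝ) : ℂ) * Complex.I))
      atTop (𝓝 1) := by
    have hcont : Continuous fun y : ℝ => Complex.exp (((t * y : ℝ) : ℂ) * Complex.I) := by fun_prop
    simpa [Function.comp_def] using (hcont.tendsto 0).comp htrace
  have hlimit : Complex.exp (-((2 * t ^ 2 * V : ℝ) : ℂ) / 2)
      = Complex.exp (t * (0 : ℝ) * Complex.I - ((2 * V).toNNReal : ℝ) * t ^ 2 / 2) := by
    rw [Real.coe_toNNReal (2 * V) (by positivity)]
    push_cast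
    ring_nf
  have hprod := (tendsto_prod_charFun_stdChiSq hsmall hsum).mul hphase
  rw [mul_one, hlimit] at hprod
  exact hprod.congr fun n =>
    (charFun_map_norm_sq_sub_of_hasLaw_multivariateGaussian (hY n) (hS n) (c n) t).symm

end GaussianNormSq

section GridToeplitz

theorem exists_sum_abs_le_of_summable_sq {α : Type*} {v : α → ℝ}
    (hv : Summable fun z => v z ^ 2) {ε : ℝ} (hε : 0 < ε) :
    ∃ C : ℝ, ∀ s : Finset α, ∑ z ∈ s, |v z| ≤ C + ε * √(s.card : ℝ) := by
  classical
  obtain ⟨F, hF⟩ := (summable_iff_vanishing_norm.1 hv) (ε ^ 2) (by positivity)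
  refine ⟨∑ z ∈ F, |v z|, fun s => ?_⟩
  rw [← Finset.sum_inter_add_sum_sdiff s F]
  refine add_le_add (Finset.sum_le_sum_of_subset_of_nonneg Finset.inter_subset_right
    fun _ _ _ => abs_nonneg _) ?_
  have htail : ∑ z ∈ s \ F, |v z| ^ 2 ≤ ε ^ 2 := by
    have h := (hF (s \ F) Finset.sdiff_disjoint).le
    rw [Real.norm_of_nonneg (Finset.sum_nonneg fun _ _ => sq_nonneg _)] at h
    simpa only [sq_abs] using h
  have hcard : ((s \ F).card : ℝ) ≤ s.card := by
    exact_mod_cast Finset.card_le_card Finset.sdiff_subset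
  refine le_of_abs_le (abs_le_of_sq_le_sq ?_ (by positivity))
  calc (∑ z ∈ s \ F, |v z|) ^ 2
      ≤ (s \ F).card * ∑ z ∈ s \ F, |v z| ^ 2 := sq_sum_le_card_mul_sum_sq
    _ ≤ s.card * ε ^ 2 := by gcongr
    _ = (ε * √s.card) ^ 2 := by rw [mul_pow, Real.sq_sqrt (Nat.cast_nonneg _), mul_comm]

theorem tendsto_sum_sq_of_tendsto_sum_sq_sub {α : Type*} {l : Filter α} {κ : α → Type*}
    [∀ n, Fintype (κ n)] {x y : ∀ n, κ n → ℝ} {s : ℝ}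
    (hy : Tendsto (fun n => ∑ i, y n i ^ 2) l (𝓝 s))
    (hxy : Tendsto (fun n => ∑ i, (x n i - y n i) ^ 2) l (𝓝 0)) :
    Tendsto (fun n => ∑ i, x n i ^ 2) l (𝓝 s) := by
  have hnorm : ∀ n (z : κ n → ℝ), ∑ i, z i ^ 2 = ‖WithLp.toLp 2 z‖ ^ 2 := fun n z => by
    rw [EuclideanSpace.real_norm_sq_eq]
  have hdiff : Tendsto (fun n => ‖WithLp.toLp 2 (x n) - WithLp.toLp 2 (y n)‖) l (𝓝 0) := by
    have h : Tendsto (fun n => √(∑ i, (x n i - y n i) ^ 2)) l (𝓝 0) := by simpa using hxy.sqrt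
    refine h.congr fun n => ?_
    rw [← WithLp.toLp_sub, ← Real.sqrt_sq (norm_nonneg (WithLp.toLp 2 (x n - y n))), ← hnorm]
    rfl
  have hynorm : Tendsto (fun n => ‖WithLp.toLp 2 (y n)‖) l (𝓝 √s) :=
    hy.sqrt.congr fun n => by rw [hnorm, Real.sqrt_sq (norm_nonneg _)]
  have hnorm_sub : Tendsto (fun n => ‖WithLp.toLp 2 (x n)‖ - ‖WithLp.toLp 2 (y n)‖) l (𝓝 0) :=
    squeeze_zero_norm (fun n => (Real.norm_eq_abs _).trans_le (abs_norm_sub_norm_le _ _)) hdiff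
  have hlim := ((hnorm_sub.pow 2).add ((hnorm_sub.mul hynorm).const_mul 2)).add hy
  simp only [zero_pow two_ne_zero, zero_mul, mul_zero, zero_add] at hlim
  refine hlim.congr fun n => ?_
  rw [hnorm, hnorm]
  ring

/-- The difference of two points of the rectangular grid `Fin N × Fin M`, as a vector of `ℤ × ℤ`. -/
def gridSub {N M : ℕ} (p q : Fin N × Fin M) : ℤ × ℤ :=
  ((p.1 : ℤ) - (q.1 : ℤ), (p.2 : ℤ) - (q.2 : ℤ))

theorem gridSub_self {N M : ℕ} (p : Fin N × Fin M) : gridSub p p = 0 := by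
  simp only [gridSub, sub_self, Prod.mk_zero_zero]

theorem gridSub_injective {N M : ℕ} (p : Fin N × Fin M) : Function.Injective (gridSub p) := by
  rintro ⟨a, b⟩ ⟨c, d⟩ h
  simp only [gridSub, Prod.mk.injEq, sub_right_inj, Nat.cast_inj, Fin.val_inj] at h
  exact Prod.ext h.1 h.2

theorem sum_gridSub_eq_sum_image {N M : ℕ} (p : Fin N × Fin M) (f : ℤ × ℤ → ℝ) :
    ∑ q, f (gridSub p q) = ∑ z ∈ Finset.univ.image (gridSub p), f z := by
  rw [Finset.sum_image fun _ _ _ _ h => gridSub_injective p h]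

/-- The number of points of `{0, …, N - 1} ∩ (a + {0, …, N - 1})`, which is the length of the
`a`-th diagonal of an `N × N` matrix. -/
def diagonalLength (N : ℕ) (a : ℤ) : ℕ :=
  (Finset.univ.filter fun i : Fin N => ∃ j : Fin N, (i : ℤ) - j = a).card

theorem diagonalLength_le (N : ℕ) (a : ℤ) : diagonalLength N a ≤ N :=
  (Finset.card_le_univ _).trans_eq (Fintype.card_fin _)

theorem le_diagonalLength_add_natAbs (N : ℕ) (a : ℤ) : N ≤ diagonalLength N a + a.natAbs := by
  have h := Finset.card_le_card_of_injOn (s := (Finset.univ : Finset (Fin (N - a.natAbs))))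
    (t := Finset.univ.filter fun i : Fin N => ∃ j : Fin N, (i : ℤ) - j = a)
    (fun i => ⟨i + a.toNat, by omega⟩)
    (fun i _ => Finset.mem_coe.2 <| Finset.mem_filter.2
      ⟨Finset.mem_univ _, ⟨i + (-a).toNat, by omega⟩, by push_cast; omega⟩)
    (fun i _ j _ hij => Fin.ext (Nat.add_right_cancel (Fin.mk.inj hij)))
  rw [Finset.card_univ, Fintype.card_fin] at h
  exact Nat.sub_le_iff_le_add.1 h

theorem diagonalLength_div_le_one (N : ℕ) (a : ℤ) : (diagonalLength N a : ℝ) / N ≤ 1 :=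
  div_le_one_of_le₀ (Nat.cast_le.2 (diagonalLength_le N a)) (Nat.cast_nonneg _)

theorem tendsto_diagonalLength_div (a : ℤ) :
    Tendsto (fun N : ℕ => (diagonalLength N a : ℝ) / N) atTop (𝓝 1) := by
  have hlower : Tendsto (fun N : ℕ => 1 - (a.natAbs : ℝ) / N) atTop (𝓝 1) := by
    simpa using tendsto_const_nhds.sub (tendsto_const_div_atTop_nhds_zero_nat (a.natAbs : ℝ))
  refine tendsto_of_tendsto_of_tendsto_of_le_of_le' hlower tendsto_const_nhds ?_
    (Eventually.of_forall fun N => diagonalLength_div_le_one N a)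
  filter_upwards [eventually_gt_atTop 0] with N hN
  have hN' : (0 : ℝ) < N := Nat.cast_pos.2 hN
  have h : (N : ℝ) ≤ diagonalLength N a + a.natAbs := by
    exact_mod_cast le_diagonalLength_add_natAbs N a
  rw [le_div_iff₀ hN', sub_mul, one_mul, div_mul_cancel₀ _ hN'.ne']
  linarith

theorem card_filter_mem_image_gridSub {N M : ℕ} (z : ℤ × ℤ) :
    (Finset.univ.filter fun p : Fin N × Fin M => z ∈ Finset.univ.image (gridSub p)).card
      = diagonalLength N z.1 * diagonalLength M z.2 := by
  rw [diagonalLength, diagonalLength, ← Finset.card_product]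
  congr 1
  ext p
  simp only [gridSub, Finset.mem_image, Finset.mem_filter, Finset.mem_univ, true_and,
    Finset.mem_product, Prod.exists, Prod.ext_iff, exists_and_left, exists_and_right]

theorem sum_sum_gridSub_eq_tsum {N M : ℕ} (f : ℤ × ℤ → ℝ) :
    ∑ p : Fin N × Fin M, ∑ q, f (gridSub p q)
      = ∑' z : ℤ × ℤ, (diagonalLength N z.1 : ℝ) * diagonalLength M z.2 * f z := by
  classical
  have hrow : ∀ p : Fin N × Fin M, HasSum
      (fun z => if z ∈ Finset.univ.image (gridSub p) then f z else 0) (∑ q, f (gridSub p q)) := by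
    intro p
    rw [sum_gridSub_eq_sum_image, ← Finset.sum_congr rfl fun z hz => if_pos hz]
    exact hasSum_sum_of_ne_finset_zero fun z hz => if_neg hz
  have h := hasSum_sum fun p (_ : p ∈ Finset.univ) => hrow p
  rw [← h.tsum_eq]
  refine tsum_congr fun z => ?_
  rw [← Finset.sum_filter, Finset.sum_const, card_filter_mem_image_gridSub, nsmul_eq_mul,
    Nat.cast_mul]

theorem tendsto_average_gridSub {M N : ℕ → ℕ} (hM : Tendsto M atTop atTop)
    (hN : Tendsto N atTop atTop) {f : ℤ × ℤ → ℝ} (hf : Summable f) :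
    Tendsto (fun n => (∑ p : Fin (N n) × Fin (M n), ∑ q, f (gridSub p q)) / ((M n : ℝ) * N n))
      atTop (𝓝 (∑' z, f z)) := by
  have hsum : ∀ n, (∑ p : Fin (N n) × Fin (M n), ∑ q, f (gridSub p q)) / ((M n : ℝ) * N n)
      = ∑' z : ℤ × ℤ,
        (diagonalLength (N n) z.1 : ℝ) / N n * (diagonalLength (M n) z.2 / M n) * f z := by
    intro n
    rw [sum_sum_gridSub_eq_tsum, ← tsum_div_const]
    exact tsum_congr fun z => by ring
  simp_rw [hsum]
  refine tendsto_tsum_of_dominated_convergence hf.norm (fun z => ?_)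
    (Eventually.of_forall fun n z => ?_)
  · simpa using (((tendsto_diagonalLength_div z.1).comp hN).mul
      ((tendsto_diagonalLength_div z.2).comp hM)).mul_const (f z)
  · rw [norm_mul, Real.norm_of_nonneg (by positivity)]
    exact mul_le_of_le_one_left (norm_nonneg _) (mul_le_one₀ (diagonalLength_div_le_one _ _)
      (by positivity) (diagonalLength_div_le_one _ _))

theorem abs_sub_div_le_div {c s v ε : ℝ} (hc : 0 < c) (h : |c * s - v| ≤ ε) :
    |s - v / c| ≤ ε / c := by
  rw [le_div_iff₀ hc, ← abs_of_pos hc, ← abs_mul, abs_of_pos hc, sub_mul, div_mul_cancel₀ _ hc.ne',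
    mul_comm s]
  exact h

theorem card_fin_prod_fin_eq_sq_sqrt (N M : ℕ) :
    (Fintype.card (Fin N × Fin M) : ℝ) = √((M : ℝ) * N) ^ 2 := by
  rw [Real.sq_sqrt (by positivity), Fintype.card_prod, Fintype.card_fin, Fintype.card_fin,
    Nat.cast_mul, mul_comm]

theorem tendsto_sqrt_natCast_mul_natCast {α : Type*} {l : Filter α} {M N : α → ℕ}
    (hM : Tendsto M l atTop) (hN : Tendsto N l atTop) :
    Tendsto (fun n => √((M n : ℝ) * N n)) l atTop :=
  Real.tendsto_sqrt_atTop.comp <|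
    (tendsto_natCast_atTop_atTop.comp hM).atTop_mul_atTop₀ (tendsto_natCast_atTop_atTop.comp hN)

variable {M N : ℕ → ℕ} {v : ℤ × ℤ → ℝ} {ε : ℕ → ℝ}
  {S : ∀ n, Matrix (Fin (N n) × Fin (M n)) (Fin (N n) × Fin (M n)) ℝ}

theorem tendsto_sum_sq_of_toeplitz (hM : Tendsto M atTop atTop) (hN : Tendsto N atTop atTop)
    (hv : Summable fun z => v z ^ 2)
    (hε : Tendsto (fun n => ε n * √((M n : ℝ) * N n)) atTop (𝓝 0))
    (hS : ∀ n p q, |√((M n : ℝ) * N n) * S n p q - v (gridSub p q)| ≤ ε n) :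
    Tendsto (fun n => ∑ p, ∑ q, S n p q ^ 2) atTop (𝓝 (∑' z, v z ^ 2)) := by
  have hmodel : Tendsto (fun n => ∑ x : (Fin (N n) × Fin (M n)) × (Fin (N n) × Fin (M n)),
      (v (gridSub x.1 x.2) / √((M n : ℝ) * N n)) ^ 2) atTop (𝓝 (∑' z, v z ^ 2)) := by
    refine (tendsto_average_gridSub hM hN hv).congr fun n => ?_
    simp only [Fintype.sum_prod_type, div_pow, Real.sq_sqrt (by positivity : 0 ≤ (M n : ℝ) * N n),
      Finset.sum_div]
  have hε_sq : Tendsto (fun n => (ε n * √((M n : ℝ) * N n)) ^ 2) atTop (𝓝 0) := by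
    have h := hε.pow 2
    rwa [zero_pow two_ne_zero] at h
  have herror : Tendsto (fun n => ∑ x : (Fin (N n) × Fin (M n)) × (Fin (N n) × Fin (M n)),
      (S n x.1 x.2 - v (gridSub x.1 x.2) / √((M n : ℝ) * N n)) ^ 2) atTop (𝓝 0) := by
    refine squeeze_zero' (Eventually.of_forall fun n => Finset.sum_nonneg fun _ _ => sq_nonneg _)
      ?_ hε_sq
    filter_upwards [(tendsto_sqrt_natCast_mul_natCast hM hN).eventually_gt_atTop 0] with n hn
    have hentry : ∀ x ∈ (Finset.univ : Finset ((Fin (N n) × Fin (M n)) × (Fin (N n) × Fin (M n)))),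
        (S n x.1 x.2 - v (gridSub x.1 x.2) / √((M n : ℝ) * N n)) ^ 2
          ≤ (ε n / √((M n : ℝ) * N n)) ^ 2 :=
      fun x _ => sq_le_sq.2 ((abs_sub_div_le_div hn (hS n x.1 x.2)).trans (le_abs_self _))
    refine (Finset.sum_le_card_nsmul _ _ _ hentry).trans_eq ?_
    rw [Finset.card_univ, Fintype.card_prod, nsmul_eq_mul, Nat.cast_mul,
      card_fin_prod_fin_eq_sq_sqrt]
    set c := √((M n : ℝ) * N n)
    field_simp
  simpa only [Fintype.sum_prod_type] using tendsto_sum_sq_of_tendsto_sum_sq_sub hmodel herror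

theorem eventually_row_sum_le_of_toeplitz (hM : Tendsto M atTop atTop)
    (hN : Tendsto N atTop atTop) (hv : Summable fun z => v z ^ 2)
    (hε : Tendsto (fun n => ε n * √((M n : ℝ) * N n)) atTop (𝓝 0))
    (hS : ∀ n p q, |√((M n : ℝ) * N n) * S n p q - v (gridSub p q)| ≤ ε n) {η : ℝ} (hη : 0 < η) :
    ∀ᶠ n in atTop, ∀ p, ∑ q, |S n p q| ≤ η := by
  have hsqrt := tendsto_sqrt_natCast_mul_natCast hM hN
  obtain ⟨C, hC⟩ := exists_sum_abs_le_of_summable_sq hv (half_pos hη)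
  have hlim : Tendsto (fun n => C / √((M n : ℝ) * N n) + ε n * √((M n : ℝ) * N n))
      atTop (𝓝 0) := by simpa using (hsqrt.const_div_atTop C).add hε
  filter_upwards [hsqrt.eventually_gt_atTop 0, hlim.eventually_le_const (half_pos hη)]
    with n hn hle p
  have hcard := card_fin_prod_fin_eq_sq_sqrt (N n) (M n)
  have hv_row : ∑ q, |v (gridSub p q)| ≤ C + η / 2 * √((M n : ℝ) * N n) := by
    have h := hC (Finset.univ.image (gridSub p))
    rwa [Finset.card_image_of_injective _ (gridSub_injective p), Finset.card_univ, hcard,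
      Real.sqrt_sq hn.le, ← sum_gridSub_eq_sum_image p fun z => |v z|] at h
  set c := √((M n : ℝ) * N n)
  calc ∑ q, |S n p q|
      ≤ ∑ q, (|v (gridSub p q)| / c + ε n / c) := Finset.sum_le_sum fun q _ => by
        have h := abs_add_le (S n p q - v (gridSub p q) / c) (v (gridSub p q) / c)
        rw [sub_add_cancel, abs_div _ c, abs_of_pos hn] at h
        linarith [abs_sub_div_le_div hn (hS n p q)]
    _ = (∑ q, |v (gridSub p q)|) / c + ε n * c := by
        rw [Finset.sum_add_distrib, ← Finset.sum_div, Finset.sum_const, Finset.card_univ,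
          nsmul_eq_mul, hcard]
        field_simp
    _ ≤ (C + η / 2 * c) / c + ε n * c := by gcongr
    _ = η / 2 + (C / c + ε n * c) := by
        field_simp
        ring
    _ ≤ η := by linarith

theorem tendsto_trace_sub_of_toeplitz (hM : Tendsto M atTop atTop) (hN : Tendsto N atTop atTop)
    (hε : Tendsto (fun n => ε n * √((M n : ℝ) * N n)) atTop (𝓝 0))
    (hS : ∀ n p q, |√((M n : ℝ) * N n) * S n p q - v (gridSub p q)| ≤ ε n) :
    Tendsto (fun n => (S n).trace - √((M n : ℝ) * N n) * v 0) atTop (𝓝 0) := by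
  refine squeeze_zero_norm' ?_ hε
  filter_upwards [(tendsto_sqrt_natCast_mul_natCast hM hN).eventually_gt_atTop 0] with n hn
  have hcard := card_fin_prod_fin_eq_sq_sqrt (N n) (M n)
  set c := √((M n : ℝ) * N n)
  calc |(S n).trace - c * v 0| = |∑ p, (S n p p - v (gridSub p p) / c)| := by
        simp only [gridSub_self, Finset.sum_sub_distrib, Finset.sum_const, Finset.card_univ,
          nsmul_eq_mul, hcard, Matrix.trace, Matrix.diag]
        congr 2
        field_simp
    _ ≤ ∑ p, |S n p p - v (gridSub p p) / c| := Finset.abs_sum_le_sum_abs _ _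
    _ ≤ ∑ _p : Fin (N n) × Fin (M n), ε n / c :=
        Finset.sum_le_sum fun p _ => abs_sub_div_le_div hn (hS n p p)
    _ = ε n * c := by
        rw [Finset.sum_const, Finset.card_univ, nsmul_eq_mul, hcard]
        field_simp

theorem tendstoInDistribution_sum_sq_of_toeplitz {Ω : Type*} [MeasurableSpace Ω]
    {P : Measure Ω} [IsProbabilityMeasure P] (hM : Tendsto M atTop atTop)
    (hN : Tendsto N atTop atTop) (hv : Summable fun z => v z ^ 2)
    {Y : ∀ n, Ω → Fin (N n) × Fin (M n) → ℝ} (hY : ∀ n, AEMeasurable (Y n) P)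
    (hSymm : ∀ n, (S n).IsHermitian)
    (hchar : ∀ n (w : Fin (N n) × Fin (M n) → ℝ),
      ∫ ω, Complex.exp (((∑ i, w i * Y n ω i : ℝ) : ℂ) * Complex.I) ∂P
        = Complex.exp (-((∑ i, ∑ j, w i * w j * S n i j : ℝ) : ℂ) / 2))
    (hε : Tendsto (fun n => ε n * √((M n : ℝ) * N n)) atTop (𝓝 0))
    (hS : ∀ n p q, |√((M n : ℝ) * N n) * S n p q - v (gridSub p q)| ≤ ε n) :
    TendstoInDistribution (fun n ω => ∑ p, Y n ω p ^ 2 - √((M n : ℝ) * N n) * v 0) atTop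
      (id : ℝ → ℝ) (fun _ => P) (gaussianReal 0 (Real.toNNReal (2 * ∑' z, v z ^ 2))) := by
  have h := tendstoInDistribution_norm_sq_sub_of_hasLaw_multivariateGaussian
    (fun n => hasLaw_multivariateGaussian_of_integral_exp_eq (hY n) (hSymm n) (hchar n))
    (fun n => posSemidef_of_integral_exp_eq (hSymm n) (hchar n))
    (fun η hη => eventually_row_sum_le_of_toeplitz hM hN hv hε hS hη)
    (tendsto_sum_sq_of_toeplitz hM hN hv hε hS) (tendsto_trace_sub_of_toeplitz hM hN hε hS)
  simpa only [EuclideanSpace.real_norm_sq_eq] using h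

end GridToeplitz

section HeatKernel

/-- The heat kernel `(4πs)^(-1/2) exp(-w² / (4s))` at time `s` and distance `w`; with the junk
values of `√` and division it vanishes for `s ≤ 0`. -/
noncomputable def heatKernel (s w : ℝ) : ℝ :=
  (√(4 * Real.pi * s))⁻¹ * Real.exp (-w ^ 2 / (4 * s))

theorem heatKernel_zero (w : ℝ) : heatKernel 0 w = 0 := by simp [heatKernel]

theorem heatKernel_nonneg (s w : ℝ) : 0 ≤ heatKernel s w := by unfold heatKernel; positivity

theorem heatKernel_abs (s w : ℝ) : heatKernel s |w| = heatKernel s w := by simp [heatKernel]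

theorem inv_sqrt_four_pi_mul_le {s : ℝ} (hs : 0 < s) : (√(4 * Real.pi * s))⁻¹ ≤ (√s)⁻¹ := by
  refine inv_anti₀ (Real.sqrt_pos.2 hs) (Real.sqrt_le_sqrt ?_)
  nlinarith [Real.pi_gt_three]

theorem heatKernel_le {s : ℝ} (hs : 0 < s) (w : ℝ) :
    heatKernel s w ≤ (√s)⁻¹ * Real.exp (-w ^ 2 / (4 * s)) :=
  mul_le_mul_of_nonneg_right (inv_sqrt_four_pi_mul_le hs) (Real.exp_pos _).le

theorem heatKernel_le_inv_sqrt {s : ℝ} (hs : 0 < s) (w : ℝ) : heatKernel s w ≤ (√s)⁻¹ := by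
  refine (heatKernel_le hs w).trans (mul_le_of_le_one_right (by positivity) ?_)
  rw [Real.exp_le_one_iff, neg_div]
  exact neg_nonpos.2 (by positivity)

theorem cube_mul_add_one_le_exp (a : ℝ) :
    a ^ 3 * (a ^ 2 / 4 + 1) ≤ 48 * Real.exp (a ^ 2 / 4) := by
  obtain ⟨q, hq⟩ : ∃ q, q = a ^ 2 / 4 := ⟨_, rfl⟩
  have hq0 : 0 ≤ q := by rw [hq]; positivity
  have hcube : a ^ 3 ≤ 2 * q + 8 * q ^ 2 := by
    rw [hq]; nlinarith [sq_nonneg (a - 1), mul_nonneg (sq_nonneg a) (sq_nonneg (a - 1))]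
  have hexp : 1 + q + q ^ 2 / 2 + q ^ 3 / 6 ≤ Real.exp q := by
    simpa [Finset.sum_range_succ, Nat.factorial] using Real.sum_le_exp_of_nonneg hq0 4
  rw [← hq]
  calc a ^ 3 * (q + 1) ≤ (2 * q + 8 * q ^ 2) * (q + 1) := by gcongr
    _ ≤ 48 * (1 + q + q ^ 2 / 2 + q ^ 3 / 6) := by nlinarith [pow_nonneg hq0 3, sq_nonneg q]
    _ ≤ 48 * Real.exp q := by gcongr

theorem inv_sqrt_mul_exp_mul_add_one_mul_cube_le {s : ℝ} (hs : 0 < s) (w : ℝ) :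
    (√s)⁻¹ * Real.exp (-w ^ 2 / (4 * s)) * (w ^ 2 / (4 * s) + 1) * |w| ^ 3 ≤ 48 * s := by
  have hmul : √s * √s = s := Real.mul_self_sqrt hs.le
  obtain ⟨a, ha⟩ : ∃ a, a = |w| / √s := ⟨_, rfl⟩
  have hw : |w| = a * √s := by rw [ha]; field_simp
  have hquot : w ^ 2 / (4 * s) = a ^ 2 / 4 := by
    rw [← sq_abs, hw, mul_pow, sq (√s), hmul]; field_simp
  have hbound := cube_mul_add_one_le_exp a
  rw [neg_div, hquot, hw, Real.exp_neg]
  calc (√s)⁻¹ * (Real.exp (a ^ 2 / 4))⁻¹ * (a ^ 2 / 4 + 1) * (a * √s) ^ 3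
      = a ^ 3 * (a ^ 2 / 4 + 1) / Real.exp (a ^ 2 / 4) * (√s * √s) := by field_simp
    _ ≤ 48 * s := by
        rw [hmul]
        exact mul_le_mul_of_nonneg_right ((div_le_iff₀ (Real.exp_pos _)).2 hbound) hs.le

theorem heatKernel_le_cube {s w : ℝ} (hs : 0 ≤ s) (hw : w ≠ 0) :
    heatKernel s w ≤ 48 / |w| ^ 3 * s := by
  rcases hs.eq_or_lt with rfl | hs
  · simp [heatKernel_zero]
  have hcube : 0 < |w| ^ 3 := by positivity
  rw [div_mul_eq_mul_div, le_div_iff₀ hcube]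
  refine le_trans ?_ (inv_sqrt_mul_exp_mul_add_one_mul_cube_le hs w)
  refine mul_le_mul_of_nonneg_right ((heatKernel_le hs w).trans ?_) hcube.le
  exact le_mul_of_one_le_right (by positivity) (le_add_of_nonneg_left (by positivity))

theorem hasDerivAt_heatKernel {s : ℝ} (hs : 0 < s) (w : ℝ) :
    HasDerivAt (fun s => heatKernel s w)
      (heatKernel s w * (w ^ 2 / (4 * s ^ 2) - 1 / (2 * s))) s := by
  have hpos : 0 < 4 * Real.pi * s := by positivity
  have hsqrt := Real.sqrt_pos.2 hpos
  have hlin : HasDerivAt (fun s : ℝ => 4 * Real.pi * s) (4 * Real.pi) s := by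
    simpa using (hasDerivAt_id s).const_mul (4 * Real.pi)
  have hexponent : HasDerivAt (fun s : ℝ => -w ^ 2 / (4 * s)) (w ^ 2 / (4 * s ^ 2)) s := by
    refine ((hasDerivAt_inv hs.ne').const_mul (-w ^ 2 / 4)).congr_deriv (by field_simp)
      |>.congr_of_eventuallyEq (.of_forall fun y => ?_)
    simp only [div_eq_mul_inv, mul_inv]
    ring
  refine (((hlin.sqrt hpos.ne').inv hsqrt.ne').mul hexponent.exp).congr_deriv ?_
  simp only [Pi.inv_apply, heatKernel, Real.sq_sqrt hpos.le]
  field_simp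
  ring

theorem abs_deriv_heatKernel_le {s : ℝ} (hs : 0 < s) (w : ℝ) :
    |heatKernel s w * (w ^ 2 / (4 * s ^ 2) - 1 / (2 * s))| ≤
      (√s)⁻¹ * Real.exp (-w ^ 2 / (4 * s)) * (w ^ 2 / (4 * s) + 1) * s⁻¹ := by
  have hq : 0 ≤ w ^ 2 / (4 * s) := by positivity
  have hfactor : w ^ 2 / (4 * s ^ 2) - 1 / (2 * s) = (w ^ 2 / (4 * s) - 1 / 2) * s⁻¹ := by
    field_simp
  rw [abs_mul, abs_of_nonneg (heatKernel_nonneg _ _), mul_assoc, hfactor, abs_mul,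
    abs_of_pos (inv_pos.2 hs)]
  refine mul_le_mul (heatKernel_le hs w) (mul_le_mul_of_nonneg_right ?_ (by positivity))
    (by positivity) (by positivity)
  rw [abs_le]
  constructor <;> linarith

theorem abs_heatKernel_sub_le {s s' w C : ℝ} (hs : 0 < s) (hss : s ≤ s')
    (hC : ∀ u, s ≤ u →
      (√u)⁻¹ * Real.exp (-w ^ 2 / (4 * u)) * (w ^ 2 / (4 * u) + 1) * u⁻¹ ≤ C) :
    |heatKernel s' w - heatKernel s w| ≤ C * (s' - s) := by
  have h := Convex.norm_image_sub_le_of_norm_hasDerivWithin_le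
    (f := fun s => heatKernel s w) (s := Icc s s') (C := C)
    (fun u hu => (hasDerivAt_heatKernel (hs.trans_le hu.1) w).hasDerivWithinAt)
    (fun u hu => (abs_deriv_heatKernel_le (hs.trans_le hu.1) w).trans (hC u hu.1))
    (convex_Icc _ _) (left_mem_Icc.2 hss) (right_mem_Icc.2 hss)
  rwa [Real.norm_eq_abs, Real.norm_eq_abs, abs_of_nonneg (sub_nonneg.2 hss)] at h

theorem abs_heatKernel_sub_le_inv {s s' : ℝ} (w : ℝ) (hs : 0 < s) (hss : s ≤ s') :
    |heatKernel s' w - heatKernel s w| ≤ (√s * s)⁻¹ * (s' - s) := by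
  refine abs_heatKernel_sub_le hs hss fun u hu => ?_
  have hu0 := hs.trans_le hu
  have hexp : Real.exp (-w ^ 2 / (4 * u)) * (w ^ 2 / (4 * u) + 1) ≤ 1 := by
    rw [neg_div, Real.exp_neg, inv_mul_le_iff₀ (Real.exp_pos _), mul_one]
    exact Real.add_one_le_exp _
  calc (√u)⁻¹ * Real.exp (-w ^ 2 / (4 * u)) * (w ^ 2 / (4 * u) + 1) * u⁻¹
      = (√u)⁻¹ * u⁻¹ * (Real.exp (-w ^ 2 / (4 * u)) * (w ^ 2 / (4 * u) + 1)) := by ring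
    _ ≤ (√u)⁻¹ * u⁻¹ := mul_le_of_le_one_right (by positivity) hexp
    _ ≤ (√s)⁻¹ * s⁻¹ := by gcongr
    _ = (√s * s)⁻¹ := (mul_inv _ _).symm

theorem abs_heatKernel_sub_le_cube {s s' w : ℝ} (hs : 0 ≤ s) (hs' : 0 ≤ s') (hw : w ≠ 0) :
    |heatKernel s' w - heatKernel s w| ≤ 48 / |w| ^ 3 * |s' - s| := by
  wlog hss : s ≤ s' generalizing s s'
  · rw [abs_sub_comm, abs_sub_comm s']
    exact this hs' hs (not_le.1 hss).le
  rw [abs_of_nonneg (sub_nonneg.2 hss)]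
  rcases hs.eq_or_lt with rfl | hs
  · rw [heatKernel_zero, sub_zero, sub_zero, abs_of_nonneg (heatKernel_nonneg _ _)]
    exact heatKernel_le_cube hs' hw
  refine abs_heatKernel_sub_le hs hss fun u hu => ?_
  rw [le_div_iff₀ (by positivity), mul_right_comm, mul_inv_le_iff₀ (hs.trans_le hu)]
  exact inv_sqrt_mul_exp_mul_add_one_mul_cube_le (hs.trans_le hu) w

theorem measurable_heatKernel (w : ℝ) : Measurable fun s => heatKernel s w := by
  unfold heatKernel
  fun_prop

theorem intervalIntegrable_inv_sqrt {c d : ℝ} (hc : 0 ≤ c) (hd : 0 ≤ d) :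
    IntervalIntegrable (fun s : ℝ => (√s)⁻¹) volume c d := by
  have h := intervalIntegral.intervalIntegrable_rpow' (a := c) (b := d) (r := -(1 / 2 : ℝ))
    (by norm_num)
  refine h.mono_fun' (by fun_prop) ?_
  refine (ae_restrict_iff' measurableSet_uIoc).2 (ae_of_all _ fun s hs => ?_)
  have hs0 : 0 < s := (le_min hc hd).trans_lt hs.1
  dsimp only
  rw [Real.norm_of_nonneg (by positivity), Real.rpow_neg hs0.le, Real.sqrt_eq_rpow]

theorem intervalIntegrable_heatKernel {a : ℝ} (ha : 0 ≤ a) (w : ℝ) {c d : ℝ} (hc : 0 ≤ c)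
    (hd : 0 ≤ d) : IntervalIntegrable (fun s => heatKernel (a * s) w) volume c d := by
  refine ((intervalIntegrable_inv_sqrt hc hd).const_mul (√a)⁻¹).mono_fun'
    ((measurable_heatKernel w).comp (measurable_const_mul a)).aestronglyMeasurable ?_
  refine (ae_restrict_iff' measurableSet_uIoc).2 (ae_of_all _ fun s hs => ?_)
  have hs0 : 0 < s := (le_min hc hd).trans_lt hs.1
  dsimp only
  rw [Real.norm_of_nonneg (heatKernel_nonneg _ _)]
  rcases ha.eq_or_lt with rfl | ha
  · simp [heatKernel_zero]
  · rw [← mul_inv, ← Real.sqrt_mul ha.le]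
    exact heatKernel_le_inv_sqrt (by positivity) w

end HeatKernel

section IntegralSecondDiff

/-- The second difference with step `Δ`, at the point `nΔ`, of the even extension of the primitive
`t ↦ ∫₀ᵗ f`. Covariances of the time increments of a stationary process are of this form. -/
noncomputable def integralSecondDiff (f : ℝ → ℝ) (Δ : ℝ) (n : ℕ) : ℝ :=
  (∫ s in (0 : ℝ)..((n : ℝ) + 1) * Δ, f s) + (∫ s in (0 : ℝ)..|(n : ℝ) - 1| * Δ, f s)
    - 2 * ∫ s in (0 : ℝ)..(n : ℝ) * Δ, f s

theorem integralSecondDiff_zero (f : ℝ → ℝ) (Δ : ℝ) :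
    integralSecondDiff f Δ 0 = 2 * ∫ s in (0 : ℝ)..Δ, f s := by
  simp only [integralSecondDiff, Nat.cast_zero, zero_add, one_mul, zero_sub, abs_neg, abs_one,
    zero_mul, intervalIntegral.integral_same]
  ring

theorem intervalIntegrable_zero_of_le {f : ℝ → ℝ} {t t' : ℝ}
    (hf : IntervalIntegrable f volume 0 t') (ht : 0 ≤ t) (htt' : t ≤ t') :
    IntervalIntegrable f volume 0 t :=
  hf.mono_set (uIcc_subset_uIcc_left (by rw [uIcc_of_le (ht.trans htt')]; exact ⟨ht, htt'⟩))

theorem abs_natCast_sub_one_le (n : ℕ) : |(n : ℝ) - 1| ≤ n + 1 := by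
  rw [abs_le]
  constructor <;> linarith [n.cast_nonneg (α := ℝ)]

theorem integralSecondDiff_succ {f : ℝ → ℝ} {Δ : ℝ} (hΔ : 0 ≤ Δ) (n : ℕ)
    (hf : IntervalIntegrable f volume 0 (((n : ℝ) + 2) * Δ)) :
    integralSecondDiff f Δ (n + 1)
      = ∫ s in ((n : ℝ) * Δ)..(((n : ℝ) + 1) * Δ), (f (s + Δ) - f s) := by
  have hf₀ : IntervalIntegrable f volume 0 (n * Δ) :=
    intervalIntegrable_zero_of_le hf (by positivity) (by nlinarith)
  have hf₁ : IntervalIntegrable f volume 0 ((n + 1) * Δ) :=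
    intervalIntegrable_zero_of_le hf (by positivity) (by nlinarith)
  have hshift := (hf₁.symm.trans hf).comp_add_right Δ
  rw [show ((n : ℝ) + 1) * Δ - Δ = n * Δ by ring,
    show ((n : ℝ) + 2) * Δ - Δ = (n + 1) * Δ by ring] at hshift
  rw [intervalIntegral.integral_sub hshift (hf₀.symm.trans hf₁),
    intervalIntegral.integral_comp_add_right (fun s => f s) Δ,
    ← intervalIntegral.integral_interval_sub_left hf₁ hf₀,
    show (n : ℝ) * Δ + Δ = (n + 1) * Δ by ring, show ((n : ℝ) + 1) * Δ + Δ = (n + 2) * Δ by ring,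
    ← intervalIntegral.integral_interval_sub_left hf hf₁]
  unfold integralSecondDiff
  push_cast
  rw [add_sub_cancel_right, abs_of_nonneg n.cast_nonneg, show (n : ℝ) + 1 + 1 = n + 2 by ring]
  ring

theorem abs_integralSecondDiff_le {f : ℝ → ℝ} {Δ A : ℝ} (hΔ : 0 ≤ Δ) (hA : 0 ≤ A) (n : ℕ)
    (hf : IntervalIntegrable f volume 0 (((n : ℝ) + 1) * Δ))
    (hbound : ∀ s, 0 < s → s ≤ Δ → |f s| ≤ A)
    (hdiff : ∀ s, 0 < s → s ≤ n * Δ → |f (s + Δ) - f s| ≤ A) :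
    |integralSecondDiff f Δ n| ≤ 2 * A * Δ := by
  rcases n with _ | n
  · rw [integralSecondDiff_zero, abs_mul, abs_two, mul_assoc]
    refine mul_le_mul_of_nonneg_left ?_ zero_le_two
    have h := intervalIntegral.norm_integral_le_of_norm_le_const (a := 0) (b := Δ) (f := f) (C := A)
      fun s hs => by rw [uIoc_of_le hΔ] at hs; exact hbound s hs.1 hs.2
    rwa [sub_zero, abs_of_nonneg hΔ] at h
  · push_cast at hf hdiff
    rw [show (n : ℝ) + 1 + 1 = n + 2 by ring] at hf
    rw [integralSecondDiff_succ hΔ n hf]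
    have h := intervalIntegral.norm_integral_le_of_norm_le_const (a := (n : ℝ) * Δ)
      (b := ((n : ℝ) + 1) * Δ) (f := fun s => f (s + Δ) - f s) (C := A)
      fun s hs => by
        rw [uIoc_of_le (by nlinarith)] at hs
        exact hdiff s (lt_of_le_of_lt (by positivity) hs.1) hs.2
    rw [show ((n : ℝ) + 1) * Δ - n * Δ = Δ by ring, abs_of_nonneg hΔ] at h
    exact h.trans (by nlinarith)

theorem integralSecondDiff_add {f g : ℝ → ℝ} {Δ : ℝ} (hΔ : 0 ≤ Δ) (n : ℕ)
    (hf : IntervalIntegrable f volume 0 (((n : ℝ) + 1) * Δ))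
    (hg : IntervalIntegrable g volume 0 (((n : ℝ) + 1) * Δ)) :
    integralSecondDiff (fun s => f s + g s) Δ n
      = integralSecondDiff f Δ n + integralSecondDiff g Δ n := by
  have hadd : ∀ t, 0 ≤ t → t ≤ ((n : ℝ) + 1) * Δ →
      ∫ s in (0 : ℝ)..t, f s + g s = (∫ s in (0 : ℝ)..t, f s) + ∫ s in (0 : ℝ)..t, g s :=
    fun t ht htn => intervalIntegral.integral_add (intervalIntegrable_zero_of_le hf ht htn)
      (intervalIntegrable_zero_of_le hg ht htn)
  unfold integralSecondDiff
  rw [hadd _ (by positivity) le_rfl,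
    hadd _ (by positivity) (mul_le_mul_of_nonneg_right (abs_natCast_sub_one_le n) hΔ),
    hadd _ (by positivity) (by nlinarith)]
  ring

end IntegralSecondDiff

section Lambda

theorem integrable_exp_neg_sq : Integrable fun z : ℝ => Real.exp (-z ^ 2) := by
  simpa using integrable_exp_neg_mul_sq (b := 1) one_pos

theorem hasDerivAt_integral_Ioi_exp_neg_sq (x : ℝ) :
    HasDerivAt (fun x => ∫ z in Ioi x, Real.exp (-z ^ 2)) (-Real.exp (-x ^ 2)) x := by
  have hint := integrable_exp_neg_sq
  have hsplit : ∀ y, ∫ z in Ioi y, Real.exp (-z ^ 2)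
      = (∫ z in Ioi x, Real.exp (-z ^ 2)) - ∫ z in x..y, Real.exp (-z ^ 2) := fun y => by
    rw [← intervalIntegral.integral_interval_add_Ioi (a := x) (b := y) hint.integrableOn
      hint.integrableOn, add_sub_cancel_left]
  have hcont : Continuous fun z : ℝ => Real.exp (-z ^ 2) := by fun_prop
  exact ((hcont.integral_hasStrictDerivAt x x).hasDerivAt.const_sub _).congr_of_eventuallyEq
    (.of_forall hsplit)

theorem hasDerivAt_HFun (x : ℝ) :
    HasDerivAt HFun (-(1 / (2 * √Real.pi) * ∫ z in Ioi (x / 2), Real.exp (-z ^ 2))) x := by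
  have htail : HasDerivAt (fun x : ℝ => ∫ z in Ioi (x / 2), Real.exp (-z ^ 2))
      (-Real.exp (-(x / 2) ^ 2) * (1 / 2)) x :=
    HasDerivAt.comp (h := fun x : ℝ => x / 2) (h₂ := fun x => ∫ z in Ioi x, Real.exp (-z ^ 2)) x
      (hasDerivAt_integral_Ioi_exp_neg_sq (x / 2)) ((hasDerivAt_id x).div_const 2)
  have hexp : HasDerivAt (fun x : ℝ => Real.exp (-(x ^ 2 / 4)))
      (Real.exp (-(x ^ 2 / 4)) * (-(2 * x / 4))) x := by
    simpa using (((hasDerivAt_pow 2 x).div_const 4).neg).exp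
  refine ((hexp.sub ((hasDerivAt_id x).mul htail)).const_mul (1 / (2 * √Real.pi))).congr_deriv ?_
  rw [show -(x / 2) ^ 2 = -(x ^ 2 / 4) by ring]
  simp only [id]
  ring

theorem integral_Ioi_two_mul_mul_exp_neg_sq (a : ℝ) :
    IntegrableOn (fun z : ℝ => 2 * z * Real.exp (-z ^ 2)) (Ioi a) ∧
      ∫ z in Ioi a, 2 * z * Real.exp (-z ^ 2) = Real.exp (-a ^ 2) := by
  have hderiv : ∀ z : ℝ, HasDerivAt (fun z : ℝ => -Real.exp (-z ^ 2))
      (2 * z * Real.exp (-z ^ 2)) z := fun z =>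
    ((hasDerivAt_pow 2 z).neg.exp.neg).congr_deriv (by simp; ring)
  have hint : Integrable fun z : ℝ => 2 * z * Real.exp (-z ^ 2) := by
    simpa [mul_assoc] using (integrable_mul_exp_neg_mul_sq (b := 1) one_pos).const_mul 2
  have hlim : Tendsto (fun z : ℝ => -Real.exp (-z ^ 2)) atTop (𝓝 0) := by
    have hsq : Tendsto (fun z : ℝ => z ^ 2) atTop atTop := tendsto_pow_atTop two_ne_zero
    simpa using (Real.tendsto_exp_neg_atTop_nhds_zero.comp hsq).neg
  refine ⟨hint.integrableOn, ?_⟩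
  rw [integral_Ioi_of_hasDerivAt_of_tendsto' (fun z _ => hderiv z) hint.integrableOn hlim, zero_sub,
    neg_neg]

theorem HFun_nonneg (x : ℝ) : 0 ≤ HFun x := by
  have htail : x * ∫ z in Ioi (x / 2), Real.exp (-z ^ 2) ≤ Real.exp (-(x ^ 2 / 4)) := by
    obtain ⟨hint, hval⟩ := integral_Ioi_two_mul_mul_exp_neg_sq (x / 2)
    rw [show -(x ^ 2 / 4) = -(x / 2) ^ 2 by ring, ← hval, ← integral_const_mul]
    refine setIntegral_mono_on (integrable_exp_neg_sq.const_mul x).integrableOn hint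
      measurableSet_Ioi fun z hz => ?_
    have hz' : x ≤ 2 * z := by linarith [mem_Ioi.1 hz]
    gcongr
  exact mul_nonneg (by positivity) (sub_nonneg.2 htail)

theorem HFun_le_one {x : ℝ} (hx : 0 ≤ x) : HFun x ≤ 1 := by
  have htail : 0 ≤ ∫ z in Ioi (x / 2), Real.exp (-z ^ 2) :=
    setIntegral_nonneg measurableSet_Ioi fun z _ => (Real.exp_pos _).le
  have hexp : Real.exp (-(x ^ 2 / 4)) ≤ 1 :=
    Real.exp_le_one_iff.2 (neg_nonpos.2 (by positivity))
  have hpi : 1 / (2 * √Real.pi) ≤ 1 := by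
    rw [div_le_one (by positivity)]
    linarith [Real.one_le_sqrt.2 (by linarith [Real.pi_gt_three] : (1 : ℝ) ≤ Real.pi)]
  calc HFun x ≤ 1 / (2 * √Real.pi) * 1 :=
        mul_le_mul_of_nonneg_left (by linarith [mul_nonneg hx htail]) (by positivity)
    _ ≤ 1 := by rwa [mul_one]

theorem hasDerivAt_sqrt_mul_HFun {t : ℝ} (ht : 0 < t) (a : ℝ) :
    HasDerivAt (fun t => √t * HFun (a / √t)) (1 / 2 * heatKernel t a) t := by
  have hsqrt := Real.sqrt_pos.2 ht
  have hsqrt_deriv : HasDerivAt (fun t => √t) (1 / (2 * √t)) t := Real.hasDerivAt_sqrt ht.ne'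
  have hdiv : HasDerivAt (fun t => a / √t) (-(a * (1 / (2 * √t))) / √t ^ 2) t :=
    ((hasDerivAt_const t a).div hsqrt_deriv hsqrt.ne').congr_deriv (by simp)
  refine (hsqrt_deriv.mul ((hasDerivAt_HFun (a / √t)).comp t hdiv)).congr_deriv ?_
  have hfour : √(4 * Real.pi * t) = 2 * √Real.pi * √t := by
    rw [Real.sqrt_mul (by positivity), Real.sqrt_mul (by positivity),
      show (4 : ℝ) = 2 ^ 2 by norm_num, Real.sqrt_sq (by norm_num)]
  have hexponent : -((a / √t) ^ 2 / 4) = -a ^ 2 / (4 * t) := by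
    rw [div_pow, Real.sq_sqrt ht.le]; field_simp
  simp only [Function.comp_apply, HFun, heatKernel, hfour, hexponent]
  field_simp
  ring

theorem continuous_sqrt_mul_HFun {a : ℝ} (ha : 0 ≤ a) :
    ContinuousOn (fun t => √t * HFun (a / √t)) (Ici 0) := by
  intro s hs
  rcases (mem_Ici.1 hs).eq_or_lt with rfl | hs0
  · have hsqrt : Tendsto (fun t : ℝ => √t) (𝓝 0) (𝓝 0) := by
      simpa using Real.continuous_sqrt.tendsto 0
    have hlim : Tendsto (fun t => √t * HFun (a / √t)) (𝓝 0) (𝓝 0) :=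
      squeeze_zero (fun t => mul_nonneg (Real.sqrt_nonneg _) (HFun_nonneg _))
        (fun t => mul_le_of_le_one_right (Real.sqrt_nonneg _) (HFun_le_one (by positivity))) hsqrt
    exact ContinuousAt.continuousWithinAt (by simpa [ContinuousAt] using hlim)
  · exact (hasDerivAt_sqrt_mul_HFun hs0 a).continuousAt.continuousWithinAt

theorem integral_heatKernel {t : ℝ} (ht : 0 ≤ t) {a : ℝ} (ha : 0 ≤ a) :
    ∫ s in (0 : ℝ)..t, heatKernel s a = 2 * (√t * HFun (a / √t)) := by
  have hint : IntervalIntegrable (fun s => heatKernel s a) volume 0 t := by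
    simpa using intervalIntegrable_heatKernel zero_le_one a le_rfl ht
  have h := intervalIntegral.integral_eq_sub_of_hasDerivAt_of_le ht
    (((continuous_sqrt_mul_HFun ha).mono Icc_subset_Ici_self).const_mul 2)
    (fun s hs => ((hasDerivAt_sqrt_mul_HFun hs.1 a).const_mul 2).congr_deriv (by ring)) hint
  simpa using h

theorem integral_heatKernel_eq_GFun {t h : ℝ} (ht : 0 ≤ t) (hh : 0 ≤ h) (y : ℝ) :
    ∫ s in (0 : ℝ)..t, heatKernel s (h * y) = 2 * GFun h t y := by
  have habs : ∀ s, heatKernel s (h * y) = heatKernel s (h * |y|) := fun s => by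
    rw [← heatKernel_abs, abs_mul, abs_of_nonneg hh]
  simp_rw [habs]
  rw [integral_heatKernel ht (by positivity)]
  unfold GFun
  split_ifs with h0
  · simp [h0]
  · rw [abs_of_nonneg ht]

theorem GFun_abs_left (h x y : ℝ) : GFun h |x| y = GFun h x y := by simp [GFun]

theorem two_mul_secondDiffX_GFun {h : ℝ} (hh : 0 ≤ h) (n : ℕ) (y : ℝ) :
    2 * secondDiffX (GFun h) ((n : ℝ) - 1) y
      = integralSecondDiff (fun s => heatKernel s (h * y)) 1 n := by
  unfold secondDiffX integralSecondDiff
  rw [mul_one, mul_one, mul_one, integral_heatKernel_eq_GFun (by positivity) hh,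
    integral_heatKernel_eq_GFun (by positivity) hh, integral_heatKernel_eq_GFun (by positivity) hh,
    GFun_abs_left, show (n : ℝ) - 1 + 2 = n + 1 by ring, sub_add_cancel]
  ring

theorem two_mul_secondDiffX_secondDiffY_GFun {h : ℝ} (hh : 0 ≤ h) (n : ℕ) (y : ℝ) :
    2 * secondDiffX (secondDiffY (GFun h)) ((n : ℝ) - 1) (y - 1)
      = integralSecondDiff (fun s => heatKernel s (h * (y + 1))) 1 n
        + integralSecondDiff (fun s => heatKernel s (h * (y - 1))) 1 n
        - 2 * integralSecondDiff (fun s => heatKernel s (h * y)) 1 n := by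
  rw [← two_mul_secondDiffX_GFun hh, ← two_mul_secondDiffX_GFun hh, ← two_mul_secondDiffX_GFun hh]
  simp only [secondDiffX, secondDiffY]
  rw [show y - 1 + 2 = y + 1 by ring, sub_add_cancel]
  ring

theorem two_mul_LambdaFun {h : ℝ} (hh : 0 ≤ h) (j l : ℤ) :
    2 * LambdaFun h j l = integralSecondDiff (fun s => heatKernel s (h * (l + 1))) 1 j.natAbs
      + integralSecondDiff (fun s => heatKernel s (h * (l - 1))) 1 j.natAbs
      - 2 * integralSecondDiff (fun s => heatKernel s (h * l)) 1 j.natAbs := by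
  have hj : |(j : ℝ)| = (j.natAbs : ℝ) := by rw [Nat.cast_natAbs, Int.cast_abs]
  unfold LambdaFun
  rw [hj, two_mul_secondDiffX_secondDiffY_GFun hh]
  rcases abs_choice (l : ℝ) with hl | hl
  · rw [hl]
  · have hneg : ∀ y, (fun s => heatKernel s (h * -y)) = fun s => heatKernel s (h * y) := fun y => by
      ext s; rw [← heatKernel_abs, mul_neg, abs_neg, heatKernel_abs]
    rw [hl, neg_add_eq_sub, ← neg_sub (l : ℝ), hneg, ← neg_add', hneg, hneg]
    ring

theorem LambdaFun_zero_zero (h : ℝ) :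
    LambdaFun h 0 0 = 4 * (HFun h - 1 / (2 * √Real.pi)) := by
  have hzero : HFun 0 = 1 / (2 * √Real.pi) := by simp [HFun]
  rw [← hzero]
  simp only [LambdaFun, secondDiffX, secondDiffY, GFun, Int.cast_zero, abs_zero]
  norm_num
  ring

theorem psiFun_eq {ϑ₂ r : ℝ} (hϑ : 0 < ϑ₂) :
    psiFun ϑ₂ r = -(LambdaFun (r / √ϑ₂) 0 0 / √ϑ₂) := by
  have hsq : (r / √ϑ₂) ^ 2 / 4 = r ^ 2 / (4 * ϑ₂) := by
    rw [div_pow, Real.sq_sqrt hϑ.le]; field_simp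
  rw [LambdaFun_zero_zero]
  unfold psiFun HFun
  rw [Real.sqrt_mul Real.pi_pos.le, show r / √ϑ₂ / 2 = r / (2 * √ϑ₂) by field_simp, hsq]
  field_simp
  ring

theorem abs_integral_heatKernel_le {t : ℝ} (ht : 0 ≤ t) (w : ℝ) :
    |∫ s in (0 : ℝ)..t, heatKernel s w| ≤ 2 * √t := by
  simp_rw [← heatKernel_abs _ w]
  have hH : 0 ≤ HFun (|w| / √t) := HFun_nonneg _
  rw [integral_heatKernel ht (abs_nonneg w), abs_of_nonneg (by positivity)]
  gcongr
  exact mul_le_of_le_one_right (Real.sqrt_nonneg _) (HFun_le_one (by positivity))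

theorem abs_integralSecondDiff_heatKernel_le_sqrt (n : ℕ) (w : ℝ) :
    |integralSecondDiff (fun s => heatKernel s w) 1 n| ≤ 8 * √(1 + n) := by
  have hle : ∀ t : ℝ, 0 ≤ t → t ≤ 1 + n →
      |∫ s in (0 : ℝ)..t, heatKernel s w| ≤ 2 * √(1 + n) := fun t ht htn =>
    (abs_integral_heatKernel_le ht w).trans (by gcongr)
  have h₁ := abs_le.1 (hle (n + 1) (by positivity) (by linarith))
  have h₂ := abs_le.1 (hle |(n : ℝ) - 1| (abs_nonneg _) (by linarith [abs_natCast_sub_one_le n]))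
  have h₃ := abs_le.1 (hle n (by positivity) (by linarith))
  simp only [integralSecondDiff, mul_one]
  rw [abs_le]
  constructor <;> linarith [h₁.1, h₁.2, h₂.1, h₂.2, h₃.1, h₃.2]

theorem abs_integralSecondDiff_heatKernel_succ_le {n : ℕ} (hn : 0 < n) (w : ℝ) :
    |integralSecondDiff (fun s => heatKernel s w) 1 (n + 1)| ≤ (√(n : ℝ) * n)⁻¹ := by
  have hn' : (0 : ℝ) < n := Nat.cast_pos.2 hn
  rw [integralSecondDiff_succ zero_le_one _
    (by simpa using intervalIntegrable_heatKernel zero_le_one w le_rfl (by positivity)),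
    mul_one, mul_one]
  have h := intervalIntegral.norm_integral_le_of_norm_le_const (a := (n : ℝ)) (b := (n : ℝ) + 1)
    (f := fun s => heatKernel (s + 1) w - heatKernel s w) (C := (√(n : ℝ) * n)⁻¹) fun s hs => by
      rw [uIoc_of_le (by linarith)] at hs
      refine (abs_heatKernel_sub_le_inv w (hn'.trans hs.1) (by linarith)).trans ?_
      rw [add_sub_cancel_left, mul_one]
      gcongr
      exacts [hs.1.le, hs.1.le]
  simpa using h

theorem abs_integralSecondDiff_heatKernel_le_three_halves (n : ℕ) (w : ℝ) :
    |integralSecondDiff (fun s => heatKernel s w) 1 n| ≤ 32 / ((1 + n) * √(1 + n)) := by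
  rcases le_or_gt n 1 with hn | hn
  · refine (abs_integralSecondDiff_heatKernel_le_sqrt n w).trans ?_
    have hn' : (n : ℝ) ≤ 1 := by exact_mod_cast hn
    rw [le_div_iff₀ (by positivity)]
    calc 8 * √(1 + n) * ((1 + n) * √(1 + n)) = 8 * (1 + n) * (√(1 + n) * √(1 + n)) := by ring
      _ = 8 * (1 + (n : ℝ)) * (1 + n) := by rw [Real.mul_self_sqrt (by positivity)]
      _ ≤ 8 * (1 + 1) * (1 + 1) := by gcongr
      _ = 32 := by norm_num
  · obtain ⟨m, rfl⟩ : ∃ m, n = m + 1 := ⟨n - 1, by omega⟩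
    have hm : (1 : ℝ) ≤ m := by exact_mod_cast Nat.lt_succ_iff.1 hn
    refine (abs_integralSecondDiff_heatKernel_succ_le (by omega) w).trans ?_
    rw [le_div_iff₀ (by positivity), inv_mul_le_iff₀ (by positivity)]
    have hlin : (1 : ℝ) + (m + 1 : ℕ) ≤ 3 * m := by push_cast; linarith
    have hsqrt : √(1 + (m + 1 : ℕ)) ≤ 2 * √(m : ℝ) := by
      rw [Real.sqrt_le_left (by positivity), mul_pow, Real.sq_sqrt (by positivity)]
      linarith
    calc (1 + ((m + 1 : ℕ) : ℝ)) * √(1 + (m + 1 : ℕ)) ≤ 3 * m * (2 * √(m : ℝ)) := by gcongr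
      _ ≤ √(m : ℝ) * m * 32 := by nlinarith [mul_nonneg (Real.sqrt_nonneg (m : ℝ)) m.cast_nonneg]

theorem abs_integralSecondDiff_heatKernel_le_cube (n : ℕ) (w : ℝ) :
    |integralSecondDiff (fun s => heatKernel s w) 1 n| ≤ 768 / (1 + |w|) ^ 3 := by
  rw [le_div_iff₀ (by positivity)]
  rcases le_or_gt |w| 1 with hw | hw
  · have hle : |integralSecondDiff (fun s => heatKernel s w) 1 n| ≤ 32 := by
      refine (abs_integralSecondDiff_heatKernel_le_three_halves n w).trans
        (div_le_self (by norm_num) ?_)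
      have hn : (1 : ℝ) ≤ 1 + n := le_add_of_nonneg_right n.cast_nonneg
      exact one_le_mul_of_one_le_of_one_le hn (Real.one_le_sqrt.2 hn)
    calc |integralSecondDiff (fun s => heatKernel s w) 1 n| * (1 + |w|) ^ 3
        ≤ 32 * (1 + 1) ^ 3 := by gcongr
      _ ≤ 768 := by norm_num
  · have hw0 : w ≠ 0 := abs_pos.1 (one_pos.trans hw)
    have hle := abs_integralSecondDiff_le (f := fun s => heatKernel s w) (Δ := 1)
      (A := 48 / |w| ^ 3) zero_le_one (by positivity) n
      (by simpa using intervalIntegrable_heatKernel zero_le_one w le_rfl (by positivity))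
      (fun s hs hs1 => by
        rw [abs_of_nonneg (heatKernel_nonneg _ _)]
        exact (heatKernel_le_cube hs.le hw0).trans (mul_le_of_le_one_right (by positivity) hs1))
      (fun s hs _ => by
        simpa using abs_heatKernel_sub_le_cube (s := s) (s' := s + 1) hs.le (by linarith) hw0)
    calc |integralSecondDiff (fun s => heatKernel s w) 1 n| * (1 + |w|) ^ 3
        ≤ 2 * (48 / |w| ^ 3) * 1 * (|w| + |w|) ^ 3 := by gcongr
      _ = 768 := by field_simp; norm_num

theorem sq_integralSecondDiff_heatKernel_le (n : ℕ) (w : ℝ) :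
    integralSecondDiff (fun s => heatKernel s w) 1 n ^ 2
      ≤ 32 * 768 * (1 / ((1 + n) * √(1 + n)) * (1 / (1 + |w|) ^ 3)) := by
  rw [← sq_abs, sq]
  calc _ ≤ 32 / ((1 + n) * √(1 + n)) * (768 / (1 + |w|) ^ 3) :=
        mul_le_mul (abs_integralSecondDiff_heatKernel_le_three_halves n w)
          (abs_integralSecondDiff_heatKernel_le_cube n w) (abs_nonneg _) (by positivity)
    _ = _ := by ring

theorem abs_intCast_add_half_pos (l : ℤ) : 0 < |(l : ℝ) + 1 / 2| := by
  rw [abs_pos]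
  intro h
  have hodd : (2 * l + 1 : ℤ) = 0 := by
    have : (2 * l + 1 : ℝ) = 0 := by linarith
    exact_mod_cast this
  omega

theorem abs_add_half_le (x : ℝ) : |x + 1 / 2| ≤ 1 + |x| := by
  refine (abs_add_le _ _).trans ?_
  rw [abs_of_pos (one_half_pos : (0 : ℝ) < 1 / 2)]
  linarith

theorem summable_one_div_one_add_natAbs_mul_sqrt :
    Summable fun j : ℤ => 1 / ((1 + (j.natAbs : ℝ)) * √(1 + (j.natAbs : ℝ))) := by
  refine Summable.of_nonneg_of_le (fun _ => by positivity) (fun j => ?_)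
    ((Real.summable_one_div_int_add_rpow (1 / 2) (3 / 2)).2 (by norm_num))
  have hpos := abs_intCast_add_half_pos j
  rw [show (j.natAbs : ℝ) = |(j : ℝ)| by rw [Nat.cast_natAbs, Int.cast_abs],
    show (3 : ℝ) / 2 = 1 + 1 / 2 by norm_num, Real.rpow_add hpos, Real.rpow_one,
    ← Real.sqrt_eq_rpow]
  refine one_div_le_one_div_of_le (by positivity) ?_
  gcongr <;> exact abs_add_half_le _

theorem summable_one_div_abs_intCast_add_cube (a : ℝ) :
    Summable fun j : ℤ => 1 / |(j : ℝ) + a| ^ 3 := by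
  refine ((Real.summable_one_div_int_add_rpow a 3).2 (by norm_num)).congr fun j => ?_
  rw [show (3 : ℝ) = (3 : ℕ) by norm_num, Real.rpow_natCast]

theorem summable_one_div_one_add_abs_mul_cube {h : ℝ} (hh : 0 < h) :
    Summable fun l : ℤ => 1 / (1 + |h * (l : ℝ)|) ^ 3 := by
  refine Summable.of_nonneg_of_le (fun _ => by positivity) (fun l => ?_)
    ((summable_one_div_abs_intCast_add_cube (1 / 2)).mul_left (1 / min 1 h ^ 3))
  have hpos := abs_intCast_add_half_pos l
  rw [div_mul_div_comm, one_mul, ← mul_pow]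
  refine one_div_le_one_div_of_le (by positivity) (pow_le_pow_left₀ (by positivity) ?_ 3)
  rw [abs_mul, abs_of_pos hh]
  calc min 1 h * |(l : ℝ) + 1 / 2| ≤ min 1 h * (1 + |(l : ℝ)|) := by gcongr; exact abs_add_half_le _
    _ = min 1 h * 1 + min 1 h * |(l : ℝ)| := by ring
    _ ≤ 1 * 1 + h * |(l : ℝ)| := by
        gcongr
        exacts [min_le_left _ _, min_le_right _ _]
    _ = 1 + h * |(l : ℝ)| := by rw [one_mul]

theorem summable_sq_integralSecondDiff_heatKernel {h : ℝ} (hh : 0 < h) (e : ℤ) :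
    Summable fun p : ℤ × ℤ =>
      integralSecondDiff (fun s => heatKernel s (h * ((p.2 + e : ℤ) : ℝ))) 1 p.1.natAbs ^ 2 := by
  refine Summable.of_nonneg_of_le (fun _ => sq_nonneg _)
    (fun p => sq_integralSecondDiff_heatKernel_le _ _) (Summable.mul_left _ ?_)
  refine Summable.mul_of_nonneg summable_one_div_one_add_natAbs_mul_sqrt
    (g := fun l : ℤ => 1 / (1 + |h * ((l + e : ℤ) : ℝ)|) ^ 3)
    ((summable_one_div_one_add_abs_mul_cube hh).comp_injective (add_left_injective e))
    (fun _ => ?_) (fun _ => ?_) <;>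
  · simp only [Pi.zero_apply]
    positivity

theorem summable_sq_LambdaFun {h : ℝ} (hh : 0 < h) :
    Summable fun p : ℤ × ℤ => LambdaFun h p.1 p.2 ^ 2 := by
  have hs := summable_sq_integralSecondDiff_heatKernel hh
  refine Summable.of_nonneg_of_le (fun _ => sq_nonneg _) (fun p => ?_)
    (((hs 1).add (hs (-1))).add ((hs 0).mul_left 2))
  have hΛ := two_mul_LambdaFun hh.le p.1 p.2
  push_cast
  rw [add_zero, ← sub_eq_add_neg]
  set x := integralSecondDiff (fun s => heatKernel s (h * ((p.2 : ℝ) + 1))) 1 p.1.natAbs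
  set y := integralSecondDiff (fun s => heatKernel s (h * ((p.2 : ℝ) - 1))) 1 p.1.natAbs
  set z := integralSecondDiff (fun s => heatKernel s (h * (p.2 : ℝ))) 1 p.1.natAbs
  rw [show LambdaFun h p.1 p.2 = (x + y - 2 * z) / 2 by linarith]
  nlinarith [sq_nonneg (x - y), sq_nonneg (x + z), sq_nonneg (y + z)]

end Lambda

section PoissonSummation

theorem summable_cexp_quadratic {τ : ℝ} (hτ : 0 < τ) (z : ℝ) :
    Summable fun n : ℤ => Complex.exp (-Real.pi * ((Real.pi * τ : ℝ) : ℂ) * n ^ 2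
      + 2 * Real.pi * (Complex.I * ((z / 2 : ℝ) : ℂ)) * n) := by
  have him : 0 < (Complex.I * ((Real.pi * τ : ℝ) : ℂ)).im := by
    rw [Complex.I_mul_im, Complex.ofReal_re]
    positivity
  refine ((summable_jacobiTheta₂_term_iff ((z / 2 : ℝ) : ℂ) _).2 him).congr fun n => ?_
  unfold jacobiTheta₂_term
  congr 1
  linear_combination (Real.pi * (Real.pi * τ : ℝ) * n ^ 2 : ℂ) * Complex.I_sq

theorem re_cexp_quadratic (τ z : ℝ) (n : ℤ) :
    (Complex.exp (-Real.pi * ((Real.pi * τ : ℝ) : ℂ) * n ^ 2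
      + 2 * Real.pi * (Complex.I * ((z / 2 : ℝ) : ℂ)) * n)).re
      = Real.exp (-τ * (Real.pi * n) ^ 2) * Real.cos (Real.pi * n * z) := by
  have hexponent : -Real.pi * ((Real.pi * τ : ℝ) : ℂ) * n ^ 2
      + 2 * Real.pi * (Complex.I * ((z / 2 : ℝ) : ℂ)) * n
      = ((-τ * (Real.pi * n) ^ 2 : ℝ) : ℂ) + ((Real.pi * n * z : ℝ) : ℂ) * Complex.I := by
    push_cast
    ring
  rw [hexponent, Complex.exp_add, Complex.exp_mul_I, ← Complex.ofReal_exp, ← Complex.ofReal_cos,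
    ← Complex.ofReal_sin, Complex.re_ofReal_mul, Complex.add_re, Complex.ofReal_re,
    Complex.re_ofReal_mul, Complex.I_re, mul_zero, add_zero]

theorem one_div_cpow_half_mul_cexp_eq_heatKernel {τ : ℝ} (hτ : 0 < τ) (z : ℝ) (n : ℤ) :
    1 / ((Real.pi * τ : ℝ) : ℂ) ^ (1 / 2 : ℂ) * Complex.exp (-Real.pi / ((Real.pi * τ : ℝ) : ℂ)
      * (n + Complex.I * (Complex.I * ((z / 2 : ℝ) : ℂ))) ^ 2)
      = ((2 * heatKernel τ (z - 2 * n) : ℝ) : ℂ) := by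
  have hexponent : -Real.pi / ((Real.pi * τ : ℝ) : ℂ)
      * (n + Complex.I * (Complex.I * ((z / 2 : ℝ) : ℂ))) ^ 2
      = ((-(z - 2 * n) ^ 2 / (4 * τ) : ℝ) : ℂ) := by
    have hτ' : (τ : ℂ) ≠ 0 := Complex.ofReal_ne_zero.2 hτ.ne'
    have hπ : (Real.pi : ℂ) ≠ 0 := Complex.ofReal_ne_zero.2 Real.pi_ne_zero
    rw [← mul_assoc, Complex.I_mul_I]
    push_cast
    field_simp
    ring
  have hroot : ((Real.pi * τ : ℝ) : ℂ) ^ (1 / 2 : ℂ) = ((√(Real.pi * τ) : ℝ) : ℂ) := by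
    rw [Real.sqrt_eq_rpow, Complex.ofReal_cpow (by positivity)]
    norm_num
  have hfour : √(4 * Real.pi * τ) = 2 * √(Real.pi * τ) := by
    rw [mul_assoc, Real.sqrt_mul (by norm_num), show (4 : ℝ) = 2 ^ 2 by norm_num,
      Real.sqrt_sq (by norm_num)]
  rw [hexponent, hroot, heatKernel, hfour, mul_inv, ← mul_assoc, ← mul_assoc,
    mul_inv_cancel₀ two_ne_zero, one_mul]
  push_cast
  rw [one_div]

theorem hasSum_int_exp_mul_cos {τ : ℝ} (hτ : 0 < τ) (z : ℝ) :
    HasSum (fun n : ℤ => Real.exp (-τ * (Real.pi * n) ^ 2) * Real.cos (Real.pi * n * z))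
      (2 * ∑' m : ℤ, heatKernel τ (z + 2 * m)) := by
  have hre : 0 < ((Real.pi * τ : ℝ) : ℂ).re := by
    rw [Complex.ofReal_re]
    positivity
  have hpoisson := Complex.tsum_exp_neg_quadratic hre (Complex.I * ((z / 2 : ℝ) : ℂ))
  rw [← tsum_mul_left] at hpoisson
  simp_rw [one_div_cpow_half_mul_cexp_eq_heatKernel hτ z] at hpoisson
  have hsum := Complex.hasSum_re (summable_cexp_quadratic hτ z).hasSum
  rw [hpoisson, ← Complex.ofReal_tsum, Complex.ofReal_re, tsum_mul_left] at hsum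
  simp_rw [re_cexp_quadratic] at hsum
  convert hsum using 2
  rw [← (Equiv.neg ℤ).tsum_eq]
  refine tsum_congr fun m => ?_
  rw [Equiv.neg_apply, Int.cast_neg, mul_neg, ← sub_eq_add_neg]

theorem hasSum_exp_mul_cos {τ : ℝ} (hτ : 0 < τ) (z : ℝ) :
    HasSum (fun l : ℕ => Real.exp (-τ * (Real.pi * (l + 1)) ^ 2)
      * Real.cos (Real.pi * (l + 1) * z)) ((∑' m : ℤ, heatKernel τ (z + 2 * m)) - 1 / 2) := by
  have hfold := ((hasSum_nat_add_iff' 1).2 (hasSum_int_exp_mul_cos hτ z).nat_add_neg).div_const 2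
  simp only [Finset.range_one, Finset.sum_singleton, Nat.cast_zero, Int.cast_zero,
    mul_zero, zero_mul, Real.cos_zero, mul_one, zero_pow two_ne_zero, Real.exp_zero, Int.cast_neg,
    Int.cast_natCast, mul_neg, neg_sq, neg_mul (Real.pi * _), Real.cos_neg, Nat.cast_add,
    Int.cast_add, Int.cast_one, Nat.cast_one, ← two_mul,
    mul_div_cancel_left₀ _ (two_ne_zero' ℝ)] at hfold
  rwa [show (2 * ∑' m : ℤ, heatKernel τ (z + 2 * m) + 1 - 2) / 2
    = (∑' m : ℤ, heatKernel τ (z + 2 * m)) - 1 / 2 by ring] at hfold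

end PoissonSummation

section ImageSum

/-- The sum of the heat kernels with diffusivity `ϑ` over the image points `z + 2m`, `m ∈ I`. -/
noncomputable def imageSum (ϑ z : ℝ) (I : Set ℤ) (s : ℝ) : ℝ :=
  ∑' m : I, heatKernel (ϑ * s) (z + 2 * (m : ℤ))

/-- The Lipschitz constant in time of `imageSum ϑ z I`, valid for points `z` whose images `z + 2m`,
`m ∈ I`, keep the distance `b |m + 1/2|` from the origin. -/
noncomputable def imageConst (ϑ b : ℝ) : ℝ :=
  ∑' m : ℤ, 48 * ϑ / b ^ 3 * (1 / |(m : ℝ) + 1 / 2| ^ 3)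

variable {ϑ b z : ℝ} {I : Set ℤ}

theorem imageConst_nonneg (hϑ : 0 < ϑ) (hb : 0 < b) : 0 ≤ imageConst ϑ b :=
  tsum_nonneg fun _ => by positivity

theorem summable_imageConst (ϑ b : ℝ) :
    Summable fun m : ℤ => 48 * ϑ / b ^ 3 * (1 / |(m : ℝ) + 1 / 2| ^ 3) :=
  (summable_one_div_abs_intCast_add_cube (1 / 2)).mul_left _

theorem abs_heatKernel_image_sub_le (hϑ : 0 < ϑ) (hb : 0 < b) {m : ℤ}
    (hm : b * |(m : ℝ) + 1 / 2| ≤ |z + 2 * m|) {s s' : ℝ} (hs : 0 ≤ s) (hs' : 0 ≤ s') :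
    |heatKernel (ϑ * s') (z + 2 * m) - heatKernel (ϑ * s) (z + 2 * m)|
      ≤ 48 * ϑ / b ^ 3 * (1 / |(m : ℝ) + 1 / 2| ^ 3) * |s' - s| := by
  have hhalf := abs_intCast_add_half_pos m
  have hz : 0 < |z + 2 * m| := lt_of_lt_of_le (by positivity) hm
  refine (abs_heatKernel_sub_le_cube (by positivity) (by positivity) (abs_pos.1 hz)).trans ?_
  calc 48 / |z + 2 * m| ^ 3 * |ϑ * s' - ϑ * s|
      ≤ 48 / (b * |(m : ℝ) + 1 / 2|) ^ 3 * |ϑ * s' - ϑ * s| := by gcongr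
    _ = 48 * ϑ / b ^ 3 * (1 / |(m : ℝ) + 1 / 2| ^ 3) * |s' - s| := by
        rw [← mul_sub, abs_mul, abs_of_pos hϑ, mul_pow]
        field_simp

theorem summable_heatKernel_image (hϑ : 0 < ϑ) (hb : 0 < b)
    (hI : ∀ m ∈ I, b * |(m : ℝ) + 1 / 2| ≤ |z + 2 * m|) {s : ℝ} (hs : 0 ≤ s) :
    Summable fun m : I => heatKernel (ϑ * s) (z + 2 * (m : ℤ)) := by
  refine Summable.of_norm_bounded (((summable_imageConst ϑ b).mul_right s).subtype I) fun m => ?_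
  simpa [heatKernel_zero, abs_of_nonneg hs] using
    abs_heatKernel_image_sub_le hϑ hb (hI m m.2) le_rfl hs

theorem abs_imageSum_sub_le (hϑ : 0 < ϑ) (hb : 0 < b)
    (hI : ∀ m ∈ I, b * |(m : ℝ) + 1 / 2| ≤ |z + 2 * m|) {s s' : ℝ} (hs : 0 ≤ s) (hs' : 0 ≤ s') :
    |imageSum ϑ z I s' - imageSum ϑ z I s| ≤ imageConst ϑ b * |s' - s| := by
  have hsum := (summable_imageConst ϑ b).mul_right |s' - s|
  unfold imageSum imageConst
  rw [← (summable_heatKernel_image hϑ hb hI hs').tsum_sub (summable_heatKernel_image hϑ hb hI hs),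
    ← tsum_mul_right]
  exact (tsum_of_norm_bounded (f := fun m : I => heatKernel (ϑ * s') (z + 2 * (m : ℤ))
      - heatKernel (ϑ * s) (z + 2 * (m : ℤ))) (hsum.subtype I).hasSum
    fun m => abs_heatKernel_image_sub_le hϑ hb (hI m m.2) hs hs').trans
    (hsum.tsum_subtype_le _ I fun _ => by positivity)

theorem imageSum_zero (ϑ z : ℝ) (I : Set ℤ) : imageSum ϑ z I 0 = 0 := by
  simp [imageSum, heatKernel_zero]

theorem exp_neg_mul_le {γ T s : ℝ} (hs : 0 ≤ s) (hsT : s ≤ T) :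
    Real.exp (-γ * s) ≤ Real.exp (|γ| * T) :=
  Real.exp_le_exp.2 (mul_le_mul (neg_le_abs γ) hsT hs (abs_nonneg _))

theorem abs_exp_neg_mul_sub_le {γ T s s' : ℝ} (hs : s ∈ Icc 0 T) (hs' : s' ∈ Icc 0 T) :
    |Real.exp (-γ * s') - Real.exp (-γ * s)| ≤ |γ| * Real.exp (|γ| * T) * |s' - s| := by
  have h := Convex.norm_image_sub_le_of_norm_hasDerivWithin_le
    (f := fun s => Real.exp (-γ * s)) (f' := fun s => Real.exp (-γ * s) * (-γ)) (s := Icc 0 T)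
    (C := |γ| * Real.exp (|γ| * T))
    (fun u _ => by simpa using ((hasDerivAt_id u).const_mul (-γ)).exp.hasDerivWithinAt)
    (fun u hu => by
      rw [norm_mul, norm_neg, Real.norm_eq_abs γ, mul_comm, Real.norm_of_nonneg (Real.exp_pos _).le]
      exact mul_le_mul_of_nonneg_left (exp_neg_mul_le hu.1 hu.2) (abs_nonneg _))
    (convex_Icc _ _) hs hs'
  rwa [Real.norm_eq_abs, Real.norm_eq_abs] at h

theorem abs_exp_mul_imageSum_sub_le {γ T : ℝ} (hϑ : 0 < ϑ) (hb : 0 < b)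
    (hI : ∀ m ∈ I, b * |(m : ℝ) + 1 / 2| ≤ |z + 2 * m|) {s s' : ℝ} (hs : s ∈ Icc 0 T)
    (hs' : s' ∈ Icc 0 T) :
    |Real.exp (-γ * s') * imageSum ϑ z I s' - Real.exp (-γ * s) * imageSum ϑ z I s|
      ≤ Real.exp (|γ| * T) * imageConst ϑ b * (1 + |γ| * T) * |s' - s| := by
  have hL := imageConst_nonneg hϑ hb
  have hlip := abs_imageSum_sub_le hϑ hb hI hs.1 hs'.1
  have hsize : |imageSum ϑ z I s'| ≤ imageConst ϑ b * T := by
    have h := abs_imageSum_sub_le hϑ hb hI le_rfl hs'.1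
    rw [imageSum_zero, sub_zero, sub_zero, abs_of_nonneg hs'.1] at h
    exact h.trans (mul_le_mul_of_nonneg_left hs'.2 hL)
  calc |Real.exp (-γ * s') * imageSum ϑ z I s' - Real.exp (-γ * s) * imageSum ϑ z I s|
      = |(Real.exp (-γ * s') - Real.exp (-γ * s)) * imageSum ϑ z I s'
          + Real.exp (-γ * s) * (imageSum ϑ z I s' - imageSum ϑ z I s)| := by congr 1; ring
    _ ≤ |γ| * Real.exp (|γ| * T) * |s' - s| * (imageConst ϑ b * T)
          + Real.exp (|γ| * T) * (imageConst ϑ b * |s' - s|) := by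
        refine (abs_add_le _ _).trans (add_le_add ?_ ?_)
        · rw [abs_mul]
          exact mul_le_mul (abs_exp_neg_mul_sub_le hs hs') hsize (abs_nonneg _) (by positivity)
        · rw [abs_mul, abs_of_pos (Real.exp_pos _)]
          exact mul_le_mul (exp_neg_mul_le hs.1 hs.2) hlip (abs_nonneg _) (Real.exp_pos _).le
    _ = Real.exp (|γ| * T) * imageConst ϑ b * (1 + |γ| * T) * |s' - s| := by ring

theorem intervalIntegrable_exp_mul_imageSum (γ : ℝ) (hϑ : 0 < ϑ) (hb : 0 < b)
    (hI : ∀ m ∈ I, b * |(m : ℝ) + 1 / 2| ≤ |z + 2 * m|) {t : ℝ} (ht : 0 ≤ t) :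
    IntervalIntegrable (fun s => Real.exp (-γ * s) * imageSum ϑ z I s) volume 0 t := by
  refine ContinuousOn.intervalIntegrable ?_
  rw [uIcc_of_le ht]
  refine (LipschitzOnWith.of_dist_le_mul (K := (Real.exp (|γ| * t) * imageConst ϑ b
    * (1 + |γ| * t)).toNNReal) fun x hx y hy => ?_).continuousOn
  have hL := imageConst_nonneg hϑ hb
  rw [Real.coe_toNNReal _ (by positivity), Real.dist_eq, Real.dist_eq]
  exact abs_exp_mul_imageSum_sub_le hϑ hb hI hy hx

theorem abs_integralSecondDiff_exp_mul_imageSum_le {γ T Δ : ℝ} (hϑ : 0 < ϑ) (hb : 0 < b)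
    (hI : ∀ m ∈ I, b * |(m : ℝ) + 1 / 2| ≤ |z + 2 * m|) (hΔ : 0 < Δ) (n : ℕ)
    (hn : ((n : ℝ) + 1) * Δ ≤ T) :
    |integralSecondDiff (fun s => Real.exp (-γ * s) * imageSum ϑ z I s) Δ n|
      ≤ 2 * (Real.exp (|γ| * T) * imageConst ϑ b * (1 + |γ| * T)) * Δ ^ 2 := by
  have hT : 0 ≤ T := le_trans (by positivity) hn
  have hL := imageConst_nonneg hϑ hb
  have hnΔ : 0 ≤ (n : ℝ) * Δ := by positivity
  have h := abs_integralSecondDiff_le (A := Real.exp (|γ| * T) * imageConst ϑ b * (1 + |γ| * T) * Δ)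
    hΔ.le (by positivity) n
    (intervalIntegrable_exp_mul_imageSum γ hϑ hb hI (by positivity))
    (fun s hs hsΔ => by
      have hlip := abs_exp_mul_imageSum_sub_le (γ := γ) (T := T) (s := 0) (s' := s) hϑ hb hI
        ⟨le_rfl, hT⟩ ⟨hs.le, by linarith⟩
      rw [imageSum_zero, mul_zero, sub_zero, sub_zero, abs_of_pos hs] at hlip
      exact hlip.trans (mul_le_mul_of_nonneg_left hsΔ (by positivity)))
    (fun s hs hsn => by
      have hlip := abs_exp_mul_imageSum_sub_le (γ := γ) (T := T) (s := s) (s' := s + Δ) hϑ hb hI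
        ⟨hs.le, by linarith⟩ ⟨by linarith, by linarith⟩
      rwa [add_sub_cancel_left, abs_of_pos hΔ] at hlip)
  exact h.trans_eq (by ring)

end ImageSum

section DampedHeatKernel

variable {ϑ γ T : ℝ}

theorem heatKernel_mul {c : ℝ} (hc : 0 < c) (u z : ℝ) :
    heatKernel (c * u) z = (√c)⁻¹ * heatKernel u (z / √c) := by
  unfold heatKernel
  rw [show 4 * Real.pi * (c * u) = c * (4 * Real.pi * u) by ring, Real.sqrt_mul hc.le, mul_inv,
    neg_div, neg_div, div_pow, Real.sq_sqrt hc.le, div_div, mul_assoc,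
    show 4 * (c * u) = c * (4 * u) by ring]

theorem integralSecondDiff_heatKernel_scale (hϑ : 0 < ϑ) {Δ : ℝ} (hΔ : 0 < Δ) (z : ℝ) (n : ℕ) :
    integralSecondDiff (fun s => heatKernel (ϑ * s) z) Δ n
      = √Δ / √ϑ * integralSecondDiff (fun s => heatKernel s (z / √(ϑ * Δ))) 1 n := by
  have hscale : ∀ x : ℝ, ∫ s in (0 : ℝ)..x * Δ, heatKernel (ϑ * s) z
      = √Δ / √ϑ * ∫ s in (0 : ℝ)..x * 1, heatKernel s (z / √(ϑ * Δ)) := by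
    intro x
    have hsubst := intervalIntegral.mul_integral_comp_mul_left (a := 0) (b := x) (c := Δ)
      (f := fun s => heatKernel (ϑ * s) z)
    simp_rw [← mul_assoc ϑ, heatKernel_mul (mul_pos hϑ hΔ)] at hsubst
    rw [intervalIntegral.integral_const_mul, mul_zero, ← mul_assoc] at hsubst
    have hcoeff : Δ * (√(ϑ * Δ))⁻¹ = √Δ / √ϑ := by
      rw [Real.sqrt_mul hϑ.le, ← div_eq_mul_inv, mul_comm, ← div_div, Real.div_sqrt]
    rw [mul_comm x Δ, mul_one, ← hsubst, hcoeff]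
  unfold integralSecondDiff
  rw [hscale, hscale, hscale]
  ring

theorem heatKernel_mul_le_inv_sqrt (hϑ : 0 < ϑ) {s : ℝ} (hs : 0 < s) (z : ℝ) :
    heatKernel (ϑ * s) z ≤ (√ϑ)⁻¹ * (√s)⁻¹ := by
  rw [← mul_inv, ← Real.sqrt_mul hϑ.le]
  exact heatKernel_le_inv_sqrt (by positivity) z

theorem mul_abs_heatKernel_sub_le (hϑ : 0 < ϑ) {s Δ : ℝ} (hs : 0 < s) (hΔ : 0 < Δ) (z : ℝ) :
    s * |heatKernel (ϑ * (s + Δ)) z - heatKernel (ϑ * s) z| ≤ √Δ / √ϑ := by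
  rcases le_total s Δ with hsΔ | hsΔ
  · have hle : |heatKernel (ϑ * (s + Δ)) z - heatKernel (ϑ * s) z| ≤ (√ϑ)⁻¹ * (√s)⁻¹ := by
      have hmono : (√ϑ)⁻¹ * (√(s + Δ))⁻¹ ≤ (√ϑ)⁻¹ * (√s)⁻¹ := by gcongr; linarith
      refine abs_sub_le_of_nonneg_of_le (heatKernel_nonneg _ _) ?_ (heatKernel_nonneg _ _)
        (heatKernel_mul_le_inv_sqrt hϑ hs z)
      exact (heatKernel_mul_le_inv_sqrt hϑ (by linarith) z).trans hmono
    calc _ ≤ s * ((√ϑ)⁻¹ * (√s)⁻¹) := by gcongr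
      _ = s / √s / √ϑ := by ring
      _ ≤ √Δ / √ϑ := by rw [Real.div_sqrt]; gcongr
  · have hle := abs_heatKernel_sub_le_inv (s := ϑ * s) (s' := ϑ * (s + Δ)) z (by positivity)
      (by gcongr; linarith)
    calc _ ≤ s * ((√(ϑ * s) * (ϑ * s))⁻¹ * (ϑ * (s + Δ) - ϑ * s)) := by gcongr
      _ = Δ / √s / √ϑ := by rw [Real.sqrt_mul hϑ.le]; field_simp; ring
      _ ≤ Δ / √Δ / √ϑ := by gcongr
      _ = √Δ / √ϑ := by rw [Real.div_sqrt]

theorem abs_exp_neg_mul_sub_one_le {s : ℝ} (hs : s ∈ Icc 0 T) :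
    |Real.exp (-γ * s) - 1| ≤ |γ| * Real.exp (|γ| * T) * s := by
  simpa [abs_of_nonneg hs.1] using
    abs_exp_neg_mul_sub_le (γ := γ) (s := 0) ⟨le_rfl, hs.1.trans hs.2⟩ hs

theorem abs_damping_mul_heatKernel_le (hϑ : 0 < ϑ) {s : ℝ} (hs : 0 < s) (hsT : s ≤ T) (z : ℝ) :
    |(Real.exp (-γ * s) - 1) * heatKernel (ϑ * s) z|
      ≤ |γ| * Real.exp (|γ| * T) / √ϑ * √s := by
  rw [abs_mul, abs_of_nonneg (heatKernel_nonneg _ _)]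
  calc _ ≤ |γ| * Real.exp (|γ| * T) * s * ((√ϑ)⁻¹ * (√s)⁻¹) :=
        mul_le_mul (abs_exp_neg_mul_sub_one_le ⟨hs.le, hsT⟩) (heatKernel_mul_le_inv_sqrt hϑ hs z)
          (heatKernel_nonneg _ _) (by positivity)
    _ = |γ| * Real.exp (|γ| * T) / √ϑ * (s / √s) := by ring
    _ = _ := by rw [Real.div_sqrt]

theorem abs_damping_mul_heatKernel_sub_le (hϑ : 0 < ϑ) {s Δ : ℝ} (hs : 0 < s) (hΔ : 0 < Δ)
    (hsT : s + Δ ≤ T) (z : ℝ) :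
    |(Real.exp (-γ * (s + Δ)) - 1) * heatKernel (ϑ * (s + Δ)) z
      - (Real.exp (-γ * s) - 1) * heatKernel (ϑ * s) z|
      ≤ 2 * (|γ| * Real.exp (|γ| * T) / √ϑ) * √Δ := by
  set c := |γ| * Real.exp (|γ| * T)
  have hexp : |Real.exp (-γ * (s + Δ)) - Real.exp (-γ * s)| ≤ c * Δ := by
    have h := abs_exp_neg_mul_sub_le (γ := γ) (T := T) (s := s) (s' := s + Δ)
      ⟨hs.le, by linarith⟩ ⟨by linarith, hsT⟩
    rwa [add_sub_cancel_left, abs_of_pos hΔ] at h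
  have hfirst : |(Real.exp (-γ * (s + Δ)) - Real.exp (-γ * s)) * heatKernel (ϑ * (s + Δ)) z|
      ≤ c / √ϑ * √Δ := by
    rw [abs_mul, abs_of_nonneg (heatKernel_nonneg _ _)]
    calc _ ≤ c * Δ * ((√ϑ)⁻¹ * (√(s + Δ))⁻¹) :=
          mul_le_mul hexp (heatKernel_mul_le_inv_sqrt hϑ (by linarith) z) (heatKernel_nonneg _ _)
            (by positivity)
      _ ≤ c * Δ * ((√ϑ)⁻¹ * (√Δ)⁻¹) := by gcongr; linarith
      _ = c / √ϑ * (Δ / √Δ) := by ring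
      _ = c / √ϑ * √Δ := by rw [Real.div_sqrt]
  have hsecond : |(Real.exp (-γ * s) - 1) * (heatKernel (ϑ * (s + Δ)) z - heatKernel (ϑ * s) z)|
      ≤ c / √ϑ * √Δ := by
    rw [abs_mul]
    calc _ ≤ c * s * |heatKernel (ϑ * (s + Δ)) z - heatKernel (ϑ * s) z| := by
          gcongr
          exact abs_exp_neg_mul_sub_one_le ⟨hs.le, by linarith⟩
      _ = c * (s * |heatKernel (ϑ * (s + Δ)) z - heatKernel (ϑ * s) z|) := mul_assoc _ _ _
      _ ≤ c * (√Δ / √ϑ) := by gcongr; exact mul_abs_heatKernel_sub_le hϑ hs hΔ z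
      _ = c / √ϑ * √Δ := by ring
  calc _ = |(Real.exp (-γ * (s + Δ)) - Real.exp (-γ * s)) * heatKernel (ϑ * (s + Δ)) z
        + (Real.exp (-γ * s) - 1) * (heatKernel (ϑ * (s + Δ)) z - heatKernel (ϑ * s) z)| := by
        congr 1; ring
    _ ≤ _ := (abs_add_le _ _).trans (by linarith)

theorem intervalIntegrable_damping_mul_heatKernel (γ : ℝ) (hϑ : 0 ≤ ϑ) (z : ℝ) {t : ℝ}
    (ht : 0 ≤ t) :
    IntervalIntegrable (fun s => (Real.exp (-γ * s) - 1) * heatKernel (ϑ * s) z) volume 0 t :=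
  (intervalIntegrable_heatKernel hϑ z le_rfl ht).continuousOn_mul (by fun_prop)

theorem abs_integralSecondDiff_damping_mul_heatKernel_le (hϑ : 0 < ϑ) {Δ : ℝ} (hΔ : 0 < Δ) (n : ℕ)
    (hn : ((n : ℝ) + 1) * Δ ≤ T) (z : ℝ) :
    |integralSecondDiff (fun s => (Real.exp (-γ * s) - 1) * heatKernel (ϑ * s) z) Δ n|
      ≤ 4 * (|γ| * Real.exp (|γ| * T) / √ϑ) * (Δ * √Δ) := by
  have hnΔ : 0 ≤ (n : ℝ) * Δ := by positivity
  have h := abs_integralSecondDiff_le (A := 2 * (|γ| * Real.exp (|γ| * T) / √ϑ) * √Δ) hΔ.le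
    (by positivity) n (intervalIntegrable_damping_mul_heatKernel γ hϑ.le z (by positivity))
    (fun s hs hsΔ => by
      have hdamping := abs_damping_mul_heatKernel_le (γ := γ) (T := T) hϑ hs (by linarith) z
      exact hdamping.trans (mul_le_mul (le_mul_of_one_le_left (by positivity) one_le_two)
        (Real.sqrt_le_sqrt hsΔ) (Real.sqrt_nonneg s) (by positivity)))
    (fun s hs hsn => abs_damping_mul_heatKernel_sub_le hϑ hs hΔ (by linarith) z)
  exact h.trans_eq (by ring)

end DampedHeatKernel

section PeriodicHeat

/-- The heat kernel with diffusivity `ϑ` and damping rate `γ`, summed over all image points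
`z + 2m`; differences of two such sums give the Dirichlet heat kernel on `[0, 1]`. -/
noncomputable def periodicHeat (ϑ γ z s : ℝ) : ℝ :=
  Real.exp (-γ * s) * imageSum ϑ z univ s

variable {ϑ b z : ℝ}

theorem mul_abs_add_half_le_of_mem_Icc (hb : 0 < b) (hb' : b < 1 / 2)
    (hz : z ∈ Icc (2 * b) (2 - 2 * b)) (m : ℤ) : b * |(m : ℝ) + 1 / 2| ≤ |z + 2 * m| := by
  obtain ⟨hz, hz'⟩ := hz
  rcases le_or_gt 0 m with hm | hm
  · have hm' : (0 : ℝ) ≤ m := by exact_mod_cast hm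
    rw [abs_of_nonneg (by linarith), abs_of_nonneg (by linarith)]
    nlinarith
  · have hm' : (m : ℝ) ≤ -1 := by exact_mod_cast (by omega : m ≤ -1)
    rw [abs_of_nonpos (by linarith), abs_of_nonpos (by linarith)]
    nlinarith

theorem mul_abs_add_half_le_of_ne_zero (hb : 0 < b) (hb' : b < 1 / 2) (hz : |z| ≤ 1) {m : ℤ}
    (hm : m ≠ 0) : b * |(m : ℝ) + 1 / 2| ≤ |z + 2 * m| := by
  rw [abs_le] at hz
  rcases lt_or_gt_of_ne hm with hm | hm
  · have hm' : (m : ℝ) ≤ -1 := by exact_mod_cast (by omega : m ≤ -1)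
    rw [abs_of_nonpos (by linarith), abs_of_nonpos (by linarith)]
    nlinarith
  · have hm' : (1 : ℝ) ≤ m := by exact_mod_cast (by omega : 1 ≤ m)
    rw [abs_of_nonneg (by linarith), abs_of_nonneg (by linarith)]
    nlinarith

theorem heatKernel_of_nonpos {s : ℝ} (hs : s ≤ 0) (w : ℝ) : heatKernel s w = 0 := by
  rw [heatKernel, Real.sqrt_eq_zero_of_nonpos (by nlinarith [Real.pi_pos]), inv_zero, zero_mul]

theorem imageSum_univ_eq (hϑ : 0 < ϑ) (hb : 0 < b) (hb' : b < 1 / 2) (hz : |z| ≤ 1) (s : ℝ) :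
    imageSum ϑ z univ s = heatKernel (ϑ * s) z + imageSum ϑ z ({0}ᶜ : Set ℤ) s := by
  rcases lt_or_ge s 0 with hs | hs
  · simp [imageSum, heatKernel_of_nonpos (mul_neg_of_pos_of_neg hϑ hs).le]
  have hcompl := (summable_heatKernel_image (I := ({0}ᶜ : Set ℤ)) hϑ hb
    (fun m hm => mul_abs_add_half_le_of_ne_zero hb hb' hz hm) hs).hasSum
  have hsingle := hasSum_unique fun m : ({0} : Set ℤ) => heatKernel (ϑ * s) (z + 2 * (m : ℤ))
  have hsum := hsingle.add_compl (f := fun m : ℤ => heatKernel (ϑ * s) (z + 2 * m)) hcompl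
  unfold imageSum
  rw [tsum_univ fun m : ℤ => heatKernel (ϑ * s) (z + 2 * m), hsum.tsum_eq]
  simp

theorem periodicHeat_eq (γ : ℝ) (hϑ : 0 < ϑ) (hb : 0 < b) (hb' : b < 1 / 2) (hz : |z| ≤ 1) (s : ℝ) :
    periodicHeat ϑ γ z s = (heatKernel (ϑ * s) z
      + (Real.exp (-γ * s) - 1) * heatKernel (ϑ * s) z)
      + Real.exp (-γ * s) * imageSum ϑ z ({0}ᶜ : Set ℤ) s := by
  rw [periodicHeat, imageSum_univ_eq hϑ hb hb' hz]
  ring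

theorem intervalIntegrable_periodicHeat (γ : ℝ) (hϑ : 0 < ϑ) (hb : 0 < b) (hb' : b < 1 / 2)
    (hz : |z| ≤ 1 ∨ z ∈ Icc (2 * b) (2 - 2 * b)) {t : ℝ} (ht : 0 ≤ t) :
    IntervalIntegrable (periodicHeat ϑ γ z) volume 0 t := by
  rcases hz with hz | hz
  · rw [funext (periodicHeat_eq γ hϑ hb hb' hz)]
    exact ((intervalIntegrable_heatKernel hϑ.le z le_rfl ht).add
      (intervalIntegrable_damping_mul_heatKernel γ hϑ.le z ht)).add
      (intervalIntegrable_exp_mul_imageSum γ hϑ hb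
        (fun _ => mul_abs_add_half_le_of_ne_zero hb hb' hz) ht)
  · exact intervalIntegrable_exp_mul_imageSum γ hϑ hb
      (fun m _ => mul_abs_add_half_le_of_mem_Icc hb hb' hz m) ht

theorem integralSecondDiff_periodicHeat_eq (γ : ℝ) (hϑ : 0 < ϑ) (hb : 0 < b) (hb' : b < 1 / 2)
    (hz : |z| ≤ 1) {Δ : ℝ} (hΔ : 0 < Δ) (n : ℕ) :
    integralSecondDiff (periodicHeat ϑ γ z) Δ n
      = √Δ / √ϑ * integralSecondDiff (fun s => heatKernel s (z / √(ϑ * Δ))) 1 n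
        + (integralSecondDiff (fun s => (Real.exp (-γ * s) - 1) * heatKernel (ϑ * s) z) Δ n
          + integralSecondDiff (fun s => Real.exp (-γ * s) * imageSum ϑ z ({0}ᶜ : Set ℤ) s)
            Δ n) := by
  have ht : 0 ≤ ((n : ℝ) + 1) * Δ := by positivity
  have hkernel := intervalIntegrable_heatKernel hϑ.le z le_rfl ht
  have hdamping := intervalIntegrable_damping_mul_heatKernel γ hϑ.le z ht
  rw [funext (periodicHeat_eq γ hϑ hb hb' hz),
    integralSecondDiff_add hΔ.le n (hkernel.add hdamping)
      (intervalIntegrable_exp_mul_imageSum (I := ({0}ᶜ : Set ℤ)) γ hϑ hb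
        (fun _ => mul_abs_add_half_le_of_ne_zero hb hb' hz) ht),
    integralSecondDiff_add hΔ.le n hkernel hdamping, integralSecondDiff_heatKernel_scale hϑ hΔ,
    add_assoc]

theorem exists_abs_integralSecondDiff_periodicHeat_le {T : ℝ} (γ : ℝ) (hϑ : 0 < ϑ) (hb : 0 < b)
    (hb' : b < 1 / 2) (hT : 0 < T) :
    ∃ C : ℝ, 0 ≤ C ∧ ∀ (Δ : ℝ) (n : ℕ), 0 < Δ → ((n : ℝ) + 1) * Δ ≤ T → ∀ z,
      (z ∈ Icc (2 * b) (2 - 2 * b) →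
        |integralSecondDiff (periodicHeat ϑ γ z) Δ n| ≤ C * (Δ * √Δ)) ∧
      (|z| ≤ 1 → |integralSecondDiff (periodicHeat ϑ γ z) Δ n
        - √Δ / √ϑ * integralSecondDiff (fun s => heatKernel s (z / √(ϑ * Δ))) 1 n|
          ≤ C * (Δ * √Δ)) := by
  set A := 2 * (Real.exp (|γ| * T) * imageConst ϑ b * (1 + |γ| * T))
  set B := 4 * (|γ| * Real.exp (|γ| * T) / √ϑ)
  have hL := imageConst_nonneg hϑ hb
  have hB : 0 ≤ B := by positivity
  refine ⟨A * √T + B, by positivity, fun Δ n hΔ hn z => ?_⟩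
  have hΔT : Δ ≤ T := le_trans (by nlinarith [n.cast_nonneg (α := ℝ)]) hn
  have hAΔ : A * Δ ^ 2 ≤ A * √T * (Δ * √Δ) := by
    calc A * Δ ^ 2 = A * (Δ * (√Δ * √Δ)) := by rw [Real.mul_self_sqrt hΔ.le, sq]
      _ ≤ A * (Δ * (√T * √Δ)) := by gcongr
      _ = A * √T * (Δ * √Δ) := by ring
  refine ⟨fun hz => ?_, fun hz => ?_⟩
  · have himages := abs_integralSecondDiff_exp_mul_imageSum_le (γ := γ) (I := univ) hϑ hb
      (fun m _ => mul_abs_add_half_le_of_mem_Icc hb hb' hz m) hΔ n hn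
    exact himages.trans (by nlinarith [mul_nonneg hB (mul_nonneg hΔ.le (Real.sqrt_nonneg Δ))])
  · rw [integralSecondDiff_periodicHeat_eq γ hϑ hb hb' hz hΔ, add_sub_cancel_left]
    refine (abs_add_le _ _).trans ?_
    have hdamping := abs_integralSecondDiff_damping_mul_heatKernel_le (γ := γ) hϑ hΔ n hn z
    have himages := abs_integralSecondDiff_exp_mul_imageSum_le (γ := γ) (I := ({0}ᶜ : Set ℤ)) hϑ
      hb (fun _ => mul_abs_add_half_le_of_ne_zero hb hb' hz) hΔ n hn
    linarith

end PeriodicHeat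

section Spectrum

variable {ϑ₂ ϑ₁ ϑ₀ : ℝ}

theorem spdeEigenvalue_succ (ϑ₂ ϑ₁ ϑ₀ : ℝ) (l : ℕ) : spdeEigenvalue ϑ₂ ϑ₁ ϑ₀ (l + 1)
    = ϑ₂ * (Real.pi ^ 2 * ((l : ℝ) + 1) ^ 2 + spdeGamma ϑ₂ ϑ₁ ϑ₀) := by
  rw [spdeEigenvalue, Nat.cast_add_one]

theorem exists_mul_sq_le_spdeEigenvalue (hϑ : 0 < ϑ₂)
    (hΓ : 0 < spdeGamma ϑ₂ ϑ₁ ϑ₀ + Real.pi ^ 2) :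
    ∃ c > 0, ∀ l : ℕ, c * ((l : ℝ) + 1) ^ 2 ≤ spdeEigenvalue ϑ₂ ϑ₁ ϑ₀ (l + 1) := by
  refine ⟨ϑ₂ * min (Real.pi ^ 2) (spdeGamma ϑ₂ ϑ₁ ϑ₀ + Real.pi ^ 2),
    mul_pos hϑ (lt_min (by positivity) hΓ), fun l => ?_⟩
  rw [spdeEigenvalue_succ, mul_assoc]
  refine mul_le_mul_of_nonneg_left ?_ hϑ.le
  have hl : (1 : ℝ) ≤ ((l : ℝ) + 1) ^ 2 := by nlinarith [l.cast_nonneg (α := ℝ)]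
  rcases le_total 0 (spdeGamma ϑ₂ ϑ₁ ϑ₀) with h | h
  · rw [min_eq_left (by linarith)]
    nlinarith
  · rw [min_eq_right (by linarith)]
    nlinarith

theorem spdeEigenvalue_succ_pos (hϑ : 0 < ϑ₂) (hΓ : 0 < spdeGamma ϑ₂ ϑ₁ ϑ₀ + Real.pi ^ 2) (l : ℕ) :
    0 < spdeEigenvalue ϑ₂ ϑ₁ ϑ₀ (l + 1) := by
  obtain ⟨c, hc, hle⟩ := exists_mul_sq_le_spdeEigenvalue hϑ hΓ
  exact lt_of_lt_of_le (by positivity) (hle l)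

theorem summable_one_div_spdeEigenvalue (hϑ : 0 < ϑ₂)
    (hΓ : 0 < spdeGamma ϑ₂ ϑ₁ ϑ₀ + Real.pi ^ 2) :
    Summable fun l : ℕ => 1 / spdeEigenvalue ϑ₂ ϑ₁ ϑ₀ (l + 1) := by
  obtain ⟨c, hc, hle⟩ := exists_mul_sq_le_spdeEigenvalue hϑ hΓ
  have hsq : Summable fun l : ℕ => 1 / ((l : ℝ) + 1) ^ 2 := by
    simpa using (summable_nat_add_iff 1).2 (Real.summable_one_div_nat_pow.2 (le_refl 2))
  refine Summable.of_nonneg_of_le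
    (fun l => one_div_nonneg.2 (spdeEigenvalue_succ_pos hϑ hΓ l).le) (fun l => ?_)
    (hsq.mul_left (1 / c))
  rw [div_mul_div_comm, one_mul]
  exact one_div_le_one_div_of_le (by positivity) (hle l)

theorem hasSum_exp_spdeEigenvalue {s : ℝ} (hϑ : 0 < ϑ₂) (hs : 0 < s) (x y : ℝ) :
    HasSum (fun l : ℕ => Real.exp (-spdeEigenvalue ϑ₂ ϑ₁ ϑ₀ (l + 1) * s)
      * (2 * Real.sin (Real.pi * (l + 1) * x) * Real.sin (Real.pi * (l + 1) * y)))
      (periodicHeat ϑ₂ (ϑ₂ * spdeGamma ϑ₂ ϑ₁ ϑ₀) (x - y) s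
        - periodicHeat ϑ₂ (ϑ₂ * spdeGamma ϑ₂ ϑ₁ ϑ₀) (x + y) s) := by
  have hτ : 0 < ϑ₂ * s := mul_pos hϑ hs
  have hcos := ((hasSum_exp_mul_cos hτ (x - y)).sub (hasSum_exp_mul_cos hτ (x + y))).mul_left
    (Real.exp (-(ϑ₂ * spdeGamma ϑ₂ ϑ₁ ϑ₀) * s))
  have himages : ∀ z, imageSum ϑ₂ z univ s = ∑' m : ℤ, heatKernel (ϑ₂ * s) (z + 2 * m) :=
    fun z => tsum_univ fun m : ℤ => heatKernel (ϑ₂ * s) (z + 2 * m)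
  rw [periodicHeat, periodicHeat, ← mul_sub, himages, himages]
  rw [sub_sub_sub_cancel_right] at hcos
  refine Eq.mp (congrArg (fun f => HasSum f _) (funext fun l => ?_)) hcos
  rw [spdeEigenvalue_succ, show -(ϑ₂ * (Real.pi ^ 2 * ((l : ℝ) + 1) ^ 2 + spdeGamma ϑ₂ ϑ₁ ϑ₀)) * s
      = -(ϑ₂ * spdeGamma ϑ₂ ϑ₁ ϑ₀) * s + -(ϑ₂ * s) * (Real.pi * ((l : ℝ) + 1)) ^ 2 by ring,
    Real.exp_add, mul_sub (Real.pi * ((l : ℝ) + 1)), mul_add (Real.pi * ((l : ℝ) + 1)) x,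
    Real.cos_sub, Real.cos_add]
  ring

theorem integral_exp_neg_mul {c : ℝ} (hc : c ≠ 0) (t : ℝ) :
    ∫ s in (0 : ℝ)..t, Real.exp (-c * s) = (1 - Real.exp (-c * t)) / c := by
  rw [intervalIntegral.integral_comp_mul_left Real.exp (neg_ne_zero.2 hc), integral_exp, mul_zero,
    Real.exp_zero, smul_eq_mul]
  field_simp
  ring

theorem hasSum_integral_exp_neg_mul {lam w : ℕ → ℝ} {K t : ℝ} (hlam : ∀ l, 0 < lam l)
    (hsum : Summable fun l => 1 / lam l) (hw : ∀ l, |w l| ≤ K) (ht : 0 ≤ t) :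
    HasSum (fun l => (∫ s in (0 : ℝ)..t, Real.exp (-lam l * s)) * w l)
      (∫ s in (0 : ℝ)..t, ∑' l, Real.exp (-lam l * s) * w l) := by
  have hint : ∀ l, Integrable (fun s => Real.exp (-lam l * s) * w l) (volume.restrict (Ioc 0 t)) :=
    fun l => by
      have hcont : Continuous fun s => Real.exp (-lam l * s) * w l := by fun_prop
      exact (hcont.intervalIntegrable 0 t).1
  have hle : ∀ l, ∫ s in Ioc 0 t, Real.exp (-lam l * s) ≤ 1 / lam l := fun l => by
    rw [← intervalIntegral.integral_of_le ht, integral_exp_neg_mul (hlam l).ne']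
    have := hlam l
    gcongr
    linarith [Real.exp_pos (-lam l * t)]
  have hnorm : Summable fun l => ∫ s in Ioc 0 t, ‖Real.exp (-lam l * s) * w l‖ := by
    refine Summable.of_nonneg_of_le (fun l => integral_nonneg fun _ => norm_nonneg _) (fun l => ?_)
      (hsum.mul_right K)
    simp_rw [norm_mul, Real.norm_of_nonneg (Real.exp_pos _).le, Real.norm_eq_abs]
    rw [integral_mul_const]
    exact mul_le_mul (hle l) (hw l) (abs_nonneg _) (one_div_nonneg.2 (hlam l).le)
  have h := hasSum_integral_of_summable_integral_norm hint hnorm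
  simp_rw [integral_mul_const, ← intervalIntegral.integral_of_le ht] at h
  exact h

theorem abs_two_mul_sin_mul_sin_le (x y : ℝ) : |2 * Real.sin x * Real.sin y| ≤ 2 := by
  rw [abs_mul, abs_mul, abs_two]
  exact (mul_le_of_le_one_right (by positivity) (Real.abs_sin_le_one y)).trans
    (mul_le_of_le_one_right zero_le_two (Real.abs_sin_le_one x))

variable {b x y : ℝ}

theorem hasSum_integral_exp_spdeEigenvalue {t : ℝ} (hϑ : 0 < ϑ₂)
    (hΓ : 0 < spdeGamma ϑ₂ ϑ₁ ϑ₀ + Real.pi ^ 2) (hb : 0 < b) (hb' : b < 1 / 2)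
    (hx : x ∈ Icc b (1 - b)) (hy : y ∈ Icc b (1 - b)) (ht : 0 ≤ t) :
    HasSum (fun l : ℕ => (∫ s in (0 : ℝ)..t, Real.exp (-spdeEigenvalue ϑ₂ ϑ₁ ϑ₀ (l + 1) * s))
      * (2 * Real.sin (Real.pi * (l + 1) * x) * Real.sin (Real.pi * (l + 1) * y)))
      ((∫ s in (0 : ℝ)..t, periodicHeat ϑ₂ (ϑ₂ * spdeGamma ϑ₂ ϑ₁ ϑ₀) (x - y) s)
        - ∫ s in (0 : ℝ)..t, periodicHeat ϑ₂ (ϑ₂ * spdeGamma ϑ₂ ϑ₁ ϑ₀) (x + y) s) := by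
  obtain ⟨hx, hx'⟩ := hx
  obtain ⟨hy, hy'⟩ := hy
  have hdiff : |x - y| ≤ 1 := by rw [abs_le]; constructor <;> linarith
  have hsum : x + y ∈ Icc (2 * b) (2 - 2 * b) := by constructor <;> linarith
  have h := hasSum_integral_exp_neg_mul (spdeEigenvalue_succ_pos hϑ hΓ)
    (summable_one_div_spdeEigenvalue hϑ hΓ)
    (fun l => abs_two_mul_sin_mul_sin_le (Real.pi * (l + 1) * x) (Real.pi * (l + 1) * y)) ht
  rw [← intervalIntegral.integral_sub
    (intervalIntegrable_periodicHeat _ hϑ hb hb' (Or.inl hdiff) ht)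
    (intervalIntegrable_periodicHeat _ hϑ hb hb' (Or.inr hsum) ht)]
  convert h using 1
  rw [intervalIntegral.integral_of_le ht, intervalIntegral.integral_of_le ht]
  exact setIntegral_congr_fun measurableSet_Ioc fun s hs =>
    (hasSum_exp_spdeEigenvalue hϑ hs.1 x y).tsum_eq.symm

theorem hasSum_integralSecondDiff_exp_spdeEigenvalue {Δ : ℝ} (hϑ : 0 < ϑ₂)
    (hΓ : 0 < spdeGamma ϑ₂ ϑ₁ ϑ₀ + Real.pi ^ 2) (hb : 0 < b) (hb' : b < 1 / 2) (hΔ : 0 ≤ Δ) (n : ℕ)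
    (hx : x ∈ Icc b (1 - b)) (hy : y ∈ Icc b (1 - b)) :
    HasSum (fun l : ℕ =>
      integralSecondDiff (fun s => Real.exp (-spdeEigenvalue ϑ₂ ϑ₁ ϑ₀ (l + 1) * s)) Δ n
        * (2 * Real.sin (Real.pi * (l + 1) * x) * Real.sin (Real.pi * (l + 1) * y)))
      (integralSecondDiff (periodicHeat ϑ₂ (ϑ₂ * spdeGamma ϑ₂ ϑ₁ ϑ₀) (x - y)) Δ n
        - integralSecondDiff (periodicHeat ϑ₂ (ϑ₂ * spdeGamma ϑ₂ ϑ₁ ϑ₀) (x + y)) Δ n) := by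
  have h := fun t (ht : 0 ≤ t) => hasSum_integral_exp_spdeEigenvalue hϑ hΓ hb hb' hx hy ht
  have hcomb := ((h (((n : ℝ) + 1) * Δ) (by positivity)).add
    (h (|(n : ℝ) - 1| * Δ) (by positivity))).sub ((h ((n : ℝ) * Δ) (by positivity)).mul_left 2)
  unfold integralSecondDiff
  refine Eq.mp (congrArg₂ (fun f v => HasSum f v) (funext fun l => ?_) ?_) hcomb <;> ring

theorem integralSecondDiff_exp_neg_mul {c : ℝ} (hc : c ≠ 0) (Δ : ℝ) (n : ℕ) :
    integralSecondDiff (fun s => Real.exp (-c * s)) Δ n = (2 * Real.exp (-c * (n * Δ))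
      - Real.exp (-c * ((n + 1) * Δ)) - Real.exp (-c * (|(n : ℝ) - 1| * Δ))) / c := by
  unfold integralSecondDiff
  rw [integral_exp_neg_mul hc, integral_exp_neg_mul hc, integral_exp_neg_mul hc]
  ring

end Spectrum

section IncrementCovariance

variable {ϑ γ a b δ Δ x y : ℝ} {n : ℕ}

/-- The covariance, divided by `σ² / 2`, of two double increments in time and space: over
`[x, x + δ]` and `[y, y + δ]`, with weights `a` at the right and `a⁻¹` at the left end points, and
at time lag `n Δ`. The summands at `x + y`, `x + y + δ` and `x + y + 2 * δ` are the reflections at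
the boundary. -/
noncomputable def incrementCov (ϑ γ a δ Δ x y : ℝ) (n : ℕ) : ℝ :=
  let B z := integralSecondDiff (periodicHeat ϑ γ z) Δ n
  a ^ 2 * (B (x - y) - B (x + y + 2 * δ)) - (B (x - y + δ) - B (x + y + δ))
    - (B (x - y - δ) - B (x + y + δ)) + a⁻¹ ^ 2 * (B (x - y) - B (x + y))

theorem hasSum_incrementCov {ϑ₂ ϑ₁ ϑ₀ : ℝ} (hϑ : 0 < ϑ₂)
    (hΓ : 0 < spdeGamma ϑ₂ ϑ₁ ϑ₀ + Real.pi ^ 2) (hb : 0 < b) (hb' : b < 1 / 2) (ha : a ≠ 0)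
    (hδ : 0 ≤ δ) (hx : b ≤ x) (hx' : x + δ ≤ 1 - b) (hy : b ≤ y) (hy' : y + δ ≤ 1 - b)
    (hΔ : 0 ≤ Δ) (n : ℕ) :
    HasSum (fun l : ℕ =>
      integralSecondDiff (fun s => Real.exp (-spdeEigenvalue ϑ₂ ϑ₁ ϑ₀ (l + 1) * s)) Δ n
        * ((√2 * (a * Real.sin (Real.pi * (l + 1) * (x + δ))
            - a⁻¹ * Real.sin (Real.pi * (l + 1) * x)))
          * (√2 * (a * Real.sin (Real.pi * (l + 1) * (y + δ))
            - a⁻¹ * Real.sin (Real.pi * (l + 1) * y)))))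
      (incrementCov ϑ₂ (ϑ₂ * spdeGamma ϑ₂ ϑ₁ ϑ₀) a δ Δ x y n) := by
  have hmem : x ∈ Icc b (1 - b) := ⟨hx, by linarith⟩
  have hmem' : x + δ ∈ Icc b (1 - b) := ⟨by linarith, hx'⟩
  have hmemy : y ∈ Icc b (1 - b) := ⟨hy, by linarith⟩
  have hmemy' : y + δ ∈ Icc b (1 - b) := ⟨by linarith, hy'⟩
  have h := fun p q (hp : p ∈ Icc b (1 - b)) (hq : q ∈ Icc b (1 - b)) =>
    hasSum_integralSecondDiff_exp_spdeEigenvalue hϑ hΓ hb hb' hΔ n hp hq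
  have hcomb := ((((h _ _ hmem' hmemy').mul_left (a ^ 2)).sub (h _ _ hmem' hmemy)).sub
    (h _ _ hmem hmemy')).add ((h _ _ hmem hmemy).mul_left (a⁻¹ ^ 2))
  rw [show x + δ - (y + δ) = x - y by ring, show x + δ + (y + δ) = x + y + 2 * δ by ring,
    show x + δ - y = x - y + δ by ring, show x + δ + y = x + y + δ by ring,
    show x - (y + δ) = x - y - δ by ring, show x + (y + δ) = x + y + δ by ring] at hcomb
  have hexpand (A B C D : ℝ) : (√2 * (a * A - a⁻¹ * B)) * (√2 * (a * C - a⁻¹ * D))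
      = a ^ 2 * (2 * A * C) - 2 * A * D - 2 * B * C + a⁻¹ ^ 2 * (2 * B * D) := by
    linear_combination (a * A - a⁻¹ * B) * (a * C - a⁻¹ * D) * Real.mul_self_sqrt zero_le_two
      - 2 * (A * D + B * C) * mul_inv_cancel₀ ha
  simp_rw [hexpand]
  refine Eq.mp (congrArg (fun f => HasSum f _) (funext fun l => ?_)) hcomb
  ring

theorem abs_incrementCov_sub_le {G₀ G₁ G₂ E K : ℝ} (ha : a ≠ 0) (hle : a ^ 2 ≤ K)
    (hle' : a⁻¹ ^ 2 ≤ K)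
    (h₀ : |integralSecondDiff (periodicHeat ϑ γ (x - y)) Δ n - G₀| ≤ E)
    (h₁ : |integralSecondDiff (periodicHeat ϑ γ (x - y + δ)) Δ n - G₁| ≤ E)
    (h₂ : |integralSecondDiff (periodicHeat ϑ γ (x - y - δ)) Δ n - G₂| ≤ E)
    (hsum : ∀ z ∈ Icc (x + y) (x + y + 2 * δ),
      |integralSecondDiff (periodicHeat ϑ γ z) Δ n| ≤ E) (hδ : 0 ≤ δ) :
    |incrementCov ϑ γ a δ Δ x y n - (2 * G₀ - G₁ - G₂)| ≤ (6 + 2 * K) * E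
      + (a - a⁻¹) ^ 2 * |integralSecondDiff (periodicHeat ϑ γ (x - y)) Δ n| := by
  set B : ℝ → ℝ := fun z => integralSecondDiff (periodicHeat ϑ γ z) Δ n
  change |B (x - y) - G₀| ≤ E at h₀
  change |B (x - y + δ) - G₁| ≤ E at h₁
  change |B (x - y - δ) - G₂| ≤ E at h₂
  change ∀ z ∈ _, |B z| ≤ E at hsum
  have hs₀ := hsum (x + y) ⟨le_rfl, by linarith⟩
  have hs₁ := hsum (x + y + δ) ⟨by linarith, by linarith⟩
  have hs₂ := hsum (x + y + 2 * δ) ⟨by linarith, le_rfl⟩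
  have hsplit : incrementCov ϑ γ a δ Δ x y n - (2 * G₀ - G₁ - G₂)
      = 2 * (B (x - y) - G₀) - (B (x - y + δ) - G₁) - (B (x - y - δ) - G₂)
        + (a - a⁻¹) ^ 2 * B (x - y)
        - a ^ 2 * B (x + y + 2 * δ) - a⁻¹ ^ 2 * B (x + y) + 2 * B (x + y + δ) := by
    unfold incrementCov
    linear_combination 2 * B (x - y) * mul_inv_cancel₀ ha
  have hright : |a ^ 2 * B (x + y + 2 * δ)| ≤ K * E := by
    rw [abs_mul, abs_of_nonneg (sq_nonneg a)]
    exact mul_le_mul hle hs₂ (abs_nonneg _) ((sq_nonneg a).trans hle)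
  have hleft : |a⁻¹ ^ 2 * B (x + y)| ≤ K * E := by
    rw [abs_mul, abs_of_nonneg (sq_nonneg a⁻¹)]
    exact mul_le_mul hle' hs₀ (abs_nonneg _) ((sq_nonneg a).trans hle)
  have hweight : |(a - a⁻¹) ^ 2 * B (x - y)| = (a - a⁻¹) ^ 2 * |B (x - y)| := by
    rw [abs_mul, abs_of_nonneg (sq_nonneg _)]
  rw [hsplit, ← hweight]
  rw [abs_le] at h₀ h₁ h₂ hs₁ hright hleft ⊢
  have hub := le_abs_self ((a - a⁻¹) ^ 2 * B (x - y))
  have hlb := neg_abs_le ((a - a⁻¹) ^ 2 * B (x - y))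
  constructor <;> linarith

theorem abs_exp_neg_sub_inv_le (u : ℝ) :
    |Real.exp (-u) - (Real.exp (-u))⁻¹| ≤ 2 * |u| * Real.exp (3 * |u|) := by
  have h := abs_exp_neg_mul_sub_le (γ := 2 * u) (left_mem_Icc.2 zero_le_one)
    (right_mem_Icc.2 zero_le_one)
  have hfactor : Real.exp (-u) - (Real.exp (-u))⁻¹
      = Real.exp u * (Real.exp (-(2 * u) * 1) - Real.exp (-(2 * u) * 0)) := by
    rw [mul_sub, ← Real.exp_add, ← Real.exp_add, ← Real.exp_neg]
    ring_nf
  rw [sub_zero, abs_one, abs_mul, abs_two] at h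
  rw [hfactor, abs_mul, Real.abs_exp]
  calc Real.exp u * |Real.exp (-(2 * u) * 1) - Real.exp (-(2 * u) * 0)|
      ≤ Real.exp |u| * (2 * |u| * Real.exp (2 * |u| * 1) * 1) :=
        mul_le_mul (Real.exp_le_exp.2 (le_abs_self u)) h (abs_nonneg _) (Real.exp_pos _).le
    _ = 2 * |u| * Real.exp (3 * |u|) := by
        rw [show 3 * |u| = |u| + 2 * |u| * 1 by ring, Real.exp_add]
        ring

theorem abs_exp_neg_mul_div_four_sub_inv_le (κ : ℝ) (hδ : 0 ≤ δ) (hδ' : δ ≤ 1) :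
    |Real.exp (-(κ * δ / 4)) - (Real.exp (-(κ * δ / 4)))⁻¹| ≤ |κ| * Real.exp |κ| * δ := by
  have hδκ : |κ| * δ ≤ |κ| := mul_le_of_le_one_right (abs_nonneg κ) hδ'
  have hκ := abs_nonneg κ
  refine (abs_exp_neg_sub_inv_le (κ * δ / 4)).trans ?_
  rw [abs_div, abs_mul, abs_of_nonneg hδ, abs_of_pos (zero_lt_four' ℝ), mul_right_comm |κ|]
  refine mul_le_mul ?_ (Real.exp_le_exp.2 (by linarith)) (Real.exp_pos _).le (by positivity)
  linarith [mul_nonneg hκ hδ]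

theorem sq_exp_mul_div_four_le (κ : ℝ) (hδ : 0 ≤ δ) (hδ' : δ ≤ 1) :
    Real.exp (κ * δ / 4) ^ 2 ≤ Real.exp |κ| := by
  have hδκ : |κ * δ| ≤ |κ| := by
    rw [abs_mul, abs_of_nonneg hδ]
    exact mul_le_of_le_one_right (abs_nonneg κ) hδ'
  rw [← Real.exp_nat_mul, Nat.cast_two]
  exact Real.exp_le_exp.2 (by linarith [le_abs_self (κ * δ), abs_nonneg κ])

theorem exists_abs_integralSecondDiff_periodicHeat_mul_le {T : ℝ} (γ : ℝ) (hϑ : 0 < ϑ)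
    (hb : 0 < b) (hb' : b < 1 / 2) (hT : 0 < T) :
    ∃ C, 0 ≤ C ∧ ∀ r Δ δ n, 0 < Δ → ((n : ℕ) + 1 : ℝ) * Δ ≤ T → δ = r * √Δ →
      (∀ z ∈ Icc (2 * b) (2 - 2 * b),
        |integralSecondDiff (periodicHeat ϑ γ z) Δ n| ≤ C * (Δ * √Δ)) ∧
      ∀ m : ℝ, |m * δ| ≤ 1 →
        |integralSecondDiff (periodicHeat ϑ γ (m * δ)) Δ n
          - √Δ / √ϑ * integralSecondDiff (fun s => heatKernel s (r / √ϑ * m)) 1 n|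
            ≤ C * (Δ * √Δ) ∧
        |integralSecondDiff (periodicHeat ϑ γ (m * δ)) Δ n| ≤ (C * T + 32 / √ϑ) * √Δ := by
  obtain ⟨C, hC0, hC⟩ := exists_abs_integralSecondDiff_periodicHeat_le γ hϑ hb hb' hT
  refine ⟨C, hC0, fun r Δ δ n hΔ hn hδ => ⟨fun z => (hC Δ n hΔ hn z).1, fun m hm => ?_⟩⟩
  have hnear := (hC Δ n hΔ hn (m * δ)).2 hm
  rw [show m * δ / √(ϑ * Δ) = r / √ϑ * m by rw [Real.sqrt_mul hϑ.le, hδ]; field_simp] at hnear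
  refine ⟨hnear, ?_⟩
  set F := integralSecondDiff (fun s => heatKernel s (r / √ϑ * m)) 1 n
  have hF : |F| ≤ 32 := by
    refine (abs_integralSecondDiff_heatKernel_le_three_halves n _).trans
      (div_le_self (by norm_num) ?_)
    have hn1 : (1 : ℝ) ≤ 1 + n := by simp
    exact one_le_mul_of_one_le_of_one_le hn1 (Real.one_le_sqrt.2 hn1)
  have hmain : |√Δ / √ϑ * F| ≤ √Δ / √ϑ * 32 := by
    rw [abs_mul, abs_of_nonneg (by positivity : 0 ≤ √Δ / √ϑ)]
    gcongr
  have hΔT : Δ ≤ T := le_trans (le_mul_of_one_le_left hΔ.le (by simp)) hn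
  calc |integralSecondDiff (periodicHeat ϑ γ (m * δ)) Δ n|
      ≤ C * (Δ * √Δ) + √Δ / √ϑ * 32 := by
        have h := abs_sub_abs_le_abs_sub
          (integralSecondDiff (periodicHeat ϑ γ (m * δ)) Δ n) (√Δ / √ϑ * F)
        linarith
    _ ≤ C * (T * √Δ) + √Δ / √ϑ * 32 := by gcongr
    _ = (C * T + 32 / √ϑ) * √Δ := by ring

theorem exists_abs_incrementCov_sub_LambdaFun_le {T r : ℝ} (γ κ : ℝ) (hϑ : 0 < ϑ) (hb : 0 < b)
    (hb' : b < 1 / 2) (hT : 0 < T) (hr : 0 ≤ r) :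
    ∃ C : ℝ, ∀ (Δ δ x y : ℝ) (i j : ℤ), 0 < Δ → ((i.natAbs : ℝ) + 1) * Δ ≤ T → δ = r * √Δ →
      b ≤ x → x + δ ≤ 1 - b → b ≤ y → y + δ ≤ 1 - b → x - y = j * δ →
      |incrementCov ϑ γ (Real.exp (-(κ * δ / 4))) δ Δ x y i.natAbs
        - √Δ * (-(2 / √ϑ) * LambdaFun (r / √ϑ) i j)| ≤ C * (Δ * √Δ) := by
  obtain ⟨C, -, hC⟩ := exists_abs_integralSecondDiff_periodicHeat_mul_le γ hϑ hb hb' hT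
  refine ⟨(6 + 2 * Real.exp |κ|) * C + (|κ| * Real.exp |κ| * r) ^ 2 * (C * T + 32 / √ϑ), ?_⟩
  intro Δ δ x y i j hΔ hi hδ hx hx' hy hy' hxy
  have hδ0 : 0 ≤ δ := hδ ▸ by positivity
  have hδ1 : δ ≤ 1 := by linarith
  obtain ⟨hfar, hnear⟩ := hC r Δ δ i.natAbs hΔ hi hδ
  have hright : (j + 1 : ℝ) * δ = x - y + δ := by rw [add_mul, one_mul, hxy]
  have hleft : (j - 1 : ℝ) * δ = x - y - δ := by rw [sub_mul, one_mul, hxy]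
  have h₀ := hnear j (by rw [← hxy, abs_le]; constructor <;> linarith)
  have h₁ := (hnear (j + 1) (by rw [hright, abs_le]; constructor <;> linarith)).1
  have h₂ := (hnear (j - 1) (by rw [hleft, abs_le]; constructor <;> linarith)).1
  rw [← hxy] at h₀
  rw [hright] at h₁
  rw [hleft] at h₂
  set a := Real.exp (-(κ * δ / 4))
  have hmain := abs_incrementCov_sub_le (Real.exp_pos _).ne'
    (by simpa only [neg_mul, neg_div, abs_neg] using sq_exp_mul_div_four_le (-κ) hδ0 hδ1)
    (by simpa only [← Real.exp_neg, neg_neg] using sq_exp_mul_div_four_le κ hδ0 hδ1) h₀.1 h₁ h₂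
    (fun z hz => hfar z ⟨by linarith [hz.1], by linarith [hz.2]⟩) hδ0
  have hweight : (a - a⁻¹) ^ 2 ≤ (|κ| * Real.exp |κ| * r) ^ 2 * Δ := by
    calc (a - a⁻¹) ^ 2 = |a - a⁻¹| ^ 2 := (sq_abs _).symm
      _ ≤ (|κ| * Real.exp |κ| * δ) ^ 2 :=
        pow_le_pow_left₀ (abs_nonneg _) (abs_exp_neg_mul_div_four_sub_inv_le κ hδ0 hδ1) 2
      _ = (|κ| * Real.exp |κ| * r) ^ 2 * Δ := by
        rw [hδ, ← mul_assoc _ r, mul_pow _ √Δ, Real.sq_sqrt hΔ.le]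
  have hlimit : √Δ * (-(2 / √ϑ) * LambdaFun (r / √ϑ) i j)
      = -(√Δ / √ϑ) * (2 * LambdaFun (r / √ϑ) i j) := by ring
  have hE := hmain.trans
    (add_le_add_right (mul_le_mul hweight h₀.2 (abs_nonneg _) (by positivity)) _)
  rw [hlimit, two_mul_LambdaFun (by positivity)]
  refine le_trans (le_of_eq ?_) (hE.trans (le_of_eq ?_))
  · refine congrArg abs ?_
    ring
  · ring

end IncrementCovariance

section OrnsteinUhlenbeck

variable {c σ η Δ : ℝ} {V B : ℝ → ℝ}

/-- The Riemann sum with mesh `η` of the mild solution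
`exp (-c t) * v + σ ∫₀ᵗ exp (-c (t - s)) dB_s` of the Ornstein-Uhlenbeck equation with initial value
`v`, at time `t = K * η`. -/
noncomputable def mildRiemannSum (c σ η v : ℝ) (B : ℝ → ℝ) (K : ℕ) : ℝ :=
  Real.exp (-c * (K * η)) * v
    + ∑ k ∈ Finset.range K, σ * Real.exp (-c * (K * η - k * η)) * (B ((k + 1) * η) - B (k * η))

theorem ornsteinUhlenbeck_sub_mildRiemannSum (hη : 0 ≤ η) (hV : Continuous V)
    (hVB : ∀ t, 0 ≤ t → V t = V 0 - c * (∫ s in (0 : ℝ)..t, V s) + σ * B t) (K : ℕ) :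
    V (K * η) - mildRiemannSum c σ η (V 0) B K
      = ∑ k ∈ Finset.range K, Real.exp (-c * (K * η - k * η))
        * ((Real.exp (c * η) - 1 - c * η) * V ((k + 1) * η)
          - c * ∫ s in (k * η)..((k + 1) * η), (V s - V ((k + 1) * η))) := by
  have htelescope :=
    Finset.sum_range_sub (fun k : ℕ => Real.exp (-c * (K * η - k * η)) * V (k * η)) K
  simp only [sub_self, mul_zero, Real.exp_zero, one_mul, Nat.cast_zero, zero_mul, sub_zero,
    Nat.cast_add, Nat.cast_one] at htelescope
  rw [mildRiemannSum, ← sub_sub, ← htelescope, ← Finset.sum_sub_distrib]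
  refine Finset.sum_congr rfl fun k _ => ?_
  have hint (x y : ℝ) : IntervalIntegrable V volume x y := hV.intervalIntegrable x y
  have hleft := hVB (k * η) (by positivity)
  have hright := hVB ((k + 1) * η) (by positivity)
  have hexp : Real.exp (-c * (K * η - (k + 1) * η))
      = Real.exp (-c * (K * η - k * η)) * Real.exp (c * η) := by
    rw [← Real.exp_add]
    ring_nf
  rw [intervalIntegral.integral_sub (hint _ _) intervalIntegrable_const,
    intervalIntegral.integral_const, smul_eq_mul, hexp,
    ← intervalIntegral.integral_interval_sub_left (hint 0 ((k + 1) * η)) (hint 0 (k * η))]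
  linear_combination Real.exp (-c * (K * η - k * η)) * (hright - hleft)

theorem abs_mul_sub_mul_integral_le {S ω t : ℝ} (hc : 0 ≤ c) (hη : 0 ≤ η) (hcη : c * η ≤ 1)
    (hS : |V (t + η)| ≤ S) (hω : ∀ s ∈ Icc t (t + η), |V s - V (t + η)| ≤ ω) :
    |(Real.exp (c * η) - 1 - c * η) * V (t + η) - c * ∫ s in t..(t + η), (V s - V (t + η))|
      ≤ η * (c ^ 2 * η * S + c * ω) := by
  have hexp : |(Real.exp (c * η) - 1 - c * η) * V (t + η)| ≤ (c * η) ^ 2 * S := by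
    rw [abs_mul]
    exact mul_le_mul (Real.abs_exp_sub_one_sub_id_le (by rwa [abs_of_nonneg (by positivity)])) hS
      (abs_nonneg _) (sq_nonneg _)
  have hint : |∫ s in t..(t + η), (V s - V (t + η))| ≤ ω * η := by
    have h := intervalIntegral.norm_integral_le_of_norm_le_const (a := t) (b := t + η)
      (f := fun s => V s - V (t + η)) fun s hs =>
        hω s (Ioc_subset_Icc_self (uIoc_of_le (le_add_of_nonneg_right hη) ▸ hs))
    rwa [add_sub_cancel_left, abs_of_nonneg hη] at h
  calc |(Real.exp (c * η) - 1 - c * η) * V (t + η) - c * ∫ s in t..(t + η), (V s - V (t + η))|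
      ≤ (c * η) ^ 2 * S + c * (ω * η) := by
        refine (abs_sub _ _).trans (add_le_add hexp ?_)
        rw [abs_mul, abs_of_nonneg hc]
        exact mul_le_mul_of_nonneg_left hint hc
    _ = η * (c ^ 2 * η * S + c * ω) := by ring

theorem abs_ornsteinUhlenbeck_sub_mildRiemannSum_le {S ω : ℝ} {K : ℕ} (hc : 0 ≤ c) (hη : 0 ≤ η)
    (hcη : c * η ≤ 1) (hV : Continuous V)
    (hVB : ∀ t, 0 ≤ t → V t = V 0 - c * (∫ s in (0 : ℝ)..t, V s) + σ * B t)
    (hS : ∀ s ∈ Icc 0 (K * η), |V s| ≤ S)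
    (hω : ∀ s ∈ Icc 0 (K * η), ∀ s' ∈ Icc 0 (K * η), |s - s'| ≤ η → |V s - V s'| ≤ ω) :
    |V (K * η) - mildRiemannSum c σ η (V 0) B K| ≤ K * η * (c ^ 2 * η * S + c * ω) := by
  rw [ornsteinUhlenbeck_sub_mildRiemannSum hη hV hVB]
  refine (Finset.abs_sum_le_sum_abs _ _).trans ((Finset.sum_le_sum (g := fun _ =>
    η * (c ^ 2 * η * S + c * ω)) fun k hk => ?_).trans_eq ?_)
  · have hkK : ((k : ℝ) + 1) * η ≤ K * η :=
      mul_le_mul_of_nonneg_right (by exact_mod_cast Finset.mem_range.1 hk) hη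
    have hk0 : 0 ≤ (k : ℝ) * η := by positivity
    rw [add_mul, one_mul] at hkK ⊢
    have hend : (k : ℝ) * η + η ∈ Icc 0 (K * η) := ⟨by positivity, hkK⟩
    rw [abs_mul, Real.abs_exp]
    refine (mul_le_of_le_one_left (abs_nonneg _) (Real.exp_le_one_iff.2 ?_)).trans
      (abs_mul_sub_mul_integral_le hc hη hcη (hS _ hend) fun s hs =>
        hω s ⟨hk0.trans hs.1, hs.2.trans hkK⟩ _ hend ?_)
    · rw [neg_mul]
      exact neg_nonpos.2 (mul_nonneg hc (by linarith))
    · rw [abs_le]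
      constructor <;> linarith [hs.1, hs.2]
  · rw [Finset.sum_const, Finset.card_range, nsmul_eq_mul, ← mul_assoc]

theorem natCast_mul_succ_mul_div_succ (n m : ℕ) (x : ℝ) :
    ((n * (m + 1) : ℕ) : ℝ) * (x / (m + 1)) = n * x := by
  push_cast
  field_simp

theorem tendsto_div_natCast_add_one (x : ℝ) :
    Tendsto (fun m : ℕ => x / ((m : ℝ) + 1)) atTop (𝓝 0) := by
  simpa only [mul_one_div, mul_zero] using
    (tendsto_one_div_add_atTop_nhds_zero_nat (𝕜 := ℝ)).const_mul x

theorem tendsto_mildRiemannSum (hc : 0 ≤ c) (hΔ : 0 ≤ Δ) (hV : Continuous V)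
    (hVB : ∀ t, 0 ≤ t → V t = V 0 - c * (∫ s in (0 : ℝ)..t, V s) + σ * B t) (n : ℕ) :
    Tendsto (fun m : ℕ => mildRiemannSum c σ (Δ / (m + 1)) (V 0) B (n * (m + 1))) atTop
      (𝓝 (V (n * Δ))) := by
  set t := (n : ℝ) * Δ
  have ht : 0 ≤ t := by positivity
  obtain ⟨S, hS⟩ := (isCompact_Icc (a := 0) (b := t)).exists_bound_of_continuousOn hV.continuousOn
  have huc := (isCompact_Icc (a := 0) (b := t)).uniformContinuousOn_of_continuous hV.continuousOn
  rw [Metric.uniformContinuousOn_iff_le] at huc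
  have hη := tendsto_div_natCast_add_one Δ
  rw [Metric.tendsto_nhds]
  intro ε hε
  set ω := ε / (2 * (t * c + 1))
  obtain ⟨d, hd, hdω⟩ := huc ω (by positivity)
  have hbound : Tendsto (fun m : ℕ => t * (c ^ 2 * (Δ / ((m : ℝ) + 1)) * S + c * ω)) atTop
      (𝓝 (t * (c ^ 2 * 0 * S + c * ω))) :=
    (((hη.const_mul (c ^ 2)).mul_const S).add_const (c * ω)).const_mul t
  have hlt : t * (c ^ 2 * 0 * S + c * ω) < ε := by
    have hω : (t * c + 1) * ω = ε / 2 := by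
      simp only [ω]
      field_simp
    nlinarith [show 0 < ω by positivity]
  have hcη := hη.const_mul c
  filter_upwards [hbound.eventually_lt_const hlt, hη.eventually_lt_const hd,
    hcη.eventually_lt_const (show c * 0 < 1 by simp)] with m hm hmd hmc
  have hKη := natCast_mul_succ_mul_div_succ n m Δ
  have herror := abs_ornsteinUhlenbeck_sub_mildRiemannSum_le (η := Δ / (m + 1)) (S := S) (ω := ω)
    (K := n * (m + 1)) hc (by positivity) hmc.le hV hVB (by rw [hKη]; exact hS)
    (by
      rw [hKη]
      exact fun s hs s' hs' hss' => hdω s hs s' hs' (hss'.trans hmd.le))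
  rw [hKη] at herror
  rw [dist_comm, Real.dist_eq]
  exact herror.trans_lt hm

theorem tendsto_mul_sum_exp (hc : c ≠ 0) (hΔ : 0 < Δ) (n : ℕ) :
    Tendsto (fun m : ℕ => Δ / (m + 1) * ∑ k ∈ Finset.range (n * (m + 1)),
      Real.exp (c * (k * (Δ / (m + 1))))) atTop (𝓝 ((Real.exp (c * (n * Δ)) - 1) / c)) := by
  have hη : Tendsto (fun m : ℕ => c * (Δ / ((m : ℝ) + 1))) atTop (𝓝[≠] 0) := by
    rw [tendsto_nhdsWithin_iff]
    refine ⟨?_, Eventually.of_forall fun m => mul_ne_zero hc (by positivity)⟩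
    simpa only [mul_zero] using (tendsto_div_natCast_add_one Δ).const_mul c
  have hslope := (hasDerivAt_iff_tendsto_slope.1 (Real.hasDerivAt_exp 0)).comp hη
  rw [Real.exp_zero] at hslope
  have hlimit := (hslope.inv₀ one_ne_zero).const_mul ((Real.exp (c * (n * Δ)) - 1) / c)
  rw [inv_one, mul_one] at hlimit
  refine hlimit.congr fun m => ?_
  have hm : 0 < Δ / (m + 1) := by positivity
  have hne : Real.exp (c * (Δ / (m + 1))) ≠ 1 := by
    rw [Ne, Real.exp_eq_one_iff]
    exact mul_ne_zero hc hm.ne'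
  have _ := sub_ne_zero.2 hne
  have hpow (k : ℕ) :
      Real.exp (c * (k * (Δ / (m + 1)))) = Real.exp (c * (Δ / (m + 1))) ^ k := by
    rw [← Real.exp_nat_mul]
    ring_nf
  rw [← natCast_mul_succ_mul_div_succ n m Δ]
  simp_rw [hpow]
  rw [geom_sum_eq hne]
  simp only [Function.comp, slope_def_field, Real.exp_zero, sub_zero, inv_div]
  field_simp

end OrnsteinUhlenbeck

section PathFunctional

variable {Ω : Type*} [MeasurableSpace Ω] {P : Measure Ω}

theorem charFun_map_one_eq_integral {Z : Ω → ℝ} (hZ : AEMeasurable Z P) :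
    charFun (P.map Z) 1 = ∫ ω, Complex.exp ((Z ω : ℂ) * Complex.I) ∂P := by
  rw [charFun_apply_real, integral_map hZ (by fun_prop)]
  simp only [Complex.ofReal_one, one_mul]

theorem charFun_map_const_mul_of_hasLaw_gaussianReal {Z : Ω → ℝ} {v : ℝ≥0}
    (hZ : HasLaw Z (gaussianReal 0 v) P) (a : ℝ) :
    charFun (P.map fun ω => a * Z ω) 1 = Complex.exp (-((a ^ 2 * v : ℝ) : ℂ) / 2) := by
  rw [charFun_map_mul_comp hZ.aemeasurable, hZ.map_eq, charFun_gaussianReal]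
  push_cast
  ring_nf

/-- A linear functional of the initial value `x.2` and of the increments of the path `x.1` over the
first `K` cells of the grid of mesh `η`. -/
noncomputable def pathFunctional (A : ℝ) (w : ℕ → ℝ) (K : ℕ) (η : ℝ) (x : (ℝ≥0 → ℝ) × ℝ) : ℝ :=
  A * x.2 + ∑ k ∈ Finset.range K,
    w k * (x.1 (Real.toNNReal ((k + 1 : ℕ) * η)) - x.1 (Real.toNNReal (k * η)))

theorem measurable_pathFunctional (A : ℝ) (w : ℕ → ℝ) (K : ℕ) (η : ℝ) :
    Measurable (pathFunctional A w K η) := by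
  unfold pathFunctional
  fun_prop

theorem pathFunctional_sub (A A' : ℝ) (w w' : ℕ → ℝ) (K : ℕ) (η : ℝ) (x : (ℝ≥0 → ℝ) × ℝ) :
    pathFunctional (A - A') (w - w') K η x
      = pathFunctional A w K η x - pathFunctional A' w' K η x := by
  simp only [pathFunctional, Pi.sub_apply, sub_mul, Finset.sum_sub_distrib]
  ring

theorem sum_mul_pathFunctional {ι : Type*} (s : Finset ι) (a A : ι → ℝ) (w : ι → ℕ → ℝ) (K : ℕ)
    (η : ℝ) (x : (ℝ≥0 → ℝ) × ℝ) :
    ∑ p ∈ s, a p * pathFunctional (A p) (w p) K η x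
      = pathFunctional (∑ p ∈ s, a p * A p) (fun k => ∑ p ∈ s, a p * w p k) K η x := by
  simp only [pathFunctional, mul_add, Finset.sum_add_distrib, Finset.sum_mul, Finset.mul_sum,
    mul_assoc]
  rw [Finset.sum_comm (s := s)]

theorem charFun_map_pathFunctional [IsProbabilityMeasure P] {B : ℝ≥0 → Ω → ℝ} {U : Ω → ℝ} {v : ℝ≥0}
    {η : ℝ} (hBm : ∀ t, Measurable (B t)) (hUm : Measurable U) (hB : IsPreBrownianReal B P)
    (hU : HasLaw U (gaussianReal 0 v) P) (hBU : IndepFun (fun ω t => B t ω) U P) (A : ℝ)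
    (w : ℕ → ℝ) (K : ℕ) (hη : 0 ≤ η) :
    charFun (P.map fun ω => pathFunctional A w K η (fun t => B t ω, U ω)) 1
      = Complex.exp (-((A ^ 2 * v + η * ∑ k ∈ Finset.range K, w k ^ 2 : ℝ) : ℂ) / 2) := by
  set t : ℕ → ℝ≥0 := fun k => Real.toNNReal (k * η)
  have ht : Monotone t := fun i j hij => Real.toNNReal_le_toNNReal (by gcongr)
  have hinitial : IndepFun (fun ω => A * U ω)
      (fun ω => ∑ k ∈ Finset.range K, w k * (B (t (k + 1)) ω - B (t k) ω)) P :=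
    (hBU.comp (φ := fun f : ℝ≥0 → ℝ => ∑ k ∈ Finset.range K, w k * (f (t (k + 1)) - f (t k)))
      (ψ := fun x => A * x) (by fun_prop) (by fun_prop)).symm
  have hincrements : iIndepFun (fun k ω => w k * (B (t (k + 1)) ω - B (t k) ω)) P :=
    (hB.hasIndepIncrements.nat ht).comp (fun k x => w k * x) fun k => by fun_prop
  have hcharFun (k : ℕ) : charFun (P.map fun ω => w k * (B (t (k + 1)) ω - B (t k) ω)) 1
      = Complex.exp (-((w k ^ 2 * η : ℝ) : ℂ) / 2) := by
    have hlaw := hB.hasLaw_sub (t (k + 1)) (t k)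
    have hdist : ((nndist (t (k + 1)).1 (t k).1 : ℝ≥0) : ℝ) = η := by
      simp only [t, NNReal.val_eq_coe]
      rw [coe_nndist, Real.coe_toNNReal _ (by positivity), Real.coe_toNNReal _ (by positivity),
        Real.dist_eq, ← sub_mul, Nat.cast_succ, add_sub_cancel_left, one_mul, abs_of_nonneg hη]
    rw [← hdist]
    exact charFun_map_const_mul_of_hasLaw_gaussianReal hlaw (w k)
  change charFun (P.map fun ω => A * U ω
    + ∑ k ∈ Finset.range K, w k * (B (t (k + 1)) ω - B (t k) ω)) 1 = _
  rw [hinitial.charFun_map_fun_add_eq_mul (by fun_prop) (by fun_prop), Pi.mul_apply,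
    charFun_map_const_mul_of_hasLaw_gaussianReal hU,
    iIndepFun.charFun_map_fun_finsetSum_eq_prod (fun k _ => by fun_prop)
      (hincrements.restrict _), Finset.prod_apply, Finset.prod_congr rfl fun k _ => hcharFun k,
    ← Complex.exp_sum, ← Complex.exp_add, ← Finset.sum_div, Finset.sum_neg_distrib, ← add_div,
    ← neg_add, ← Complex.ofReal_sum, ← Complex.ofReal_add, ← Finset.sum_mul, mul_comm η]

theorem integral_exp_sum_pathFunctional [IsProbabilityMeasure P] {B : ℕ → ℝ≥0 → Ω → ℝ}
    {U : ℕ → Ω → ℝ} {v : ℕ → ℝ≥0} {η : ℝ} (hBm : ∀ l t, Measurable (B l t))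
    (hUm : ∀ l, Measurable (U l)) (hB : ∀ l, IsPreBrownianReal (B l) P)
    (hU : ∀ l, HasLaw (U l) (gaussianReal 0 (v l)) P)
    (hmodes : iIndepFun (fun l ω => ((fun t => B l t ω : ℝ≥0 → ℝ), U l ω)) P)
    (hBU : ∀ l, IndepFun (fun ω t => B l t ω) (U l) P) (A : ℕ → ℝ) (w : ℕ → ℕ → ℝ) (K : ℕ)
    (hη : 0 ≤ η) (n : ℕ) :
    ∫ ω, Complex.exp (((∑ l ∈ Finset.range n,
        pathFunctional (A l) (w l) K η (fun t => B l t ω, U l ω) : ℝ) : ℂ) * Complex.I) ∂P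
      = Complex.exp (-((∑ l ∈ Finset.range n,
        (A l ^ 2 * v l + η * ∑ k ∈ Finset.range K, w l k ^ 2) : ℝ) : ℂ) / 2) := by
  have hmeas (l : ℕ) :
      Measurable fun ω => pathFunctional (A l) (w l) K η (fun t => B l t ω, U l ω) :=
    (measurable_pathFunctional _ _ _ _).comp
      ((measurable_pi_iff.2 fun t => hBm l t).prodMk (hUm l))
  have hindep : iIndepFun
      (fun l ω => pathFunctional (A l) (w l) K η (fun t => B l t ω, U l ω)) P :=
    hmodes.comp (fun l x => pathFunctional (A l) (w l) K η x)
      fun l => measurable_pathFunctional _ _ _ _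
  rw [← charFun_map_one_eq_integral (Finset.measurable_fun_sum _ fun l _ => hmeas l).aemeasurable,
    iIndepFun.charFun_map_fun_finsetSum_eq_prod (fun l _ => (hmeas l).aemeasurable)
      (hindep.restrict _), Finset.prod_apply,
    Finset.prod_congr rfl fun l _ => charFun_map_pathFunctional (hBm l) (hUm l) (hB l) (hU l)
      (hBU l) (A l) (w l) K hη,
    ← Complex.exp_sum, ← Finset.sum_div, Finset.sum_neg_distrib, ← Complex.ofReal_sum]

/-- The weight of the increment over the `k`-th cell in `mildRiemannSum c σ η v B K`. -/
noncomputable def mildWeight (c σ η : ℝ) (K k : ℕ) : ℝ :=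
  if k < K then σ * Real.exp (-c * (K * η - k * η)) else 0

variable {c σ η Δ : ℝ}

theorem sum_range_ite_lt {R : Type*} [AddCommMonoid R] (f : ℕ → R) {n K : ℕ} (h : n ≤ K) :
    ∑ k ∈ Finset.range K, (if k < n then f k else 0) = ∑ k ∈ Finset.range n, f k := by
  rw [← Finset.sum_filter]
  congr 1
  ext k
  simp only [Finset.mem_filter, Finset.mem_range]
  lia

theorem pathFunctional_mildWeight {K L : ℕ} (hKL : K ≤ L) (f : ℝ≥0 → ℝ) (v : ℝ) :
    pathFunctional (Real.exp (-c * (K * η))) (mildWeight c σ η K) L η (f, v)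
      = mildRiemannSum c σ η v (fun t => f (Real.toNNReal t)) K := by
  rw [pathFunctional, mildRiemannSum, ← sum_range_ite_lt _ hKL]
  simp only [mildWeight, ite_mul, zero_mul, Nat.cast_succ]

theorem sum_mildWeight_mul_mildWeight {K K' L : ℕ} (hKL : K ≤ L) :
    ∑ k ∈ Finset.range L, mildWeight c σ η K k * mildWeight c σ η K' k
      = σ ^ 2 * (Real.exp (-c * (K * η)) * Real.exp (-c * (K' * η)))
        * ∑ k ∈ Finset.range (min K K'), Real.exp (2 * c * (k * η)) := by
  rw [Finset.mul_sum, ← sum_range_ite_lt _ ((min_le_left K K').trans hKL)]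
  refine Finset.sum_congr rfl fun k _ => ?_
  simp only [mildWeight, lt_min_iff, ite_mul, mul_ite, zero_mul, mul_zero, ite_and]
  have hexp : Real.exp (-c * (K * η - k * η)) * Real.exp (-c * (K' * η - k * η))
      = Real.exp (-c * (K * η)) * Real.exp (-c * (K' * η)) * Real.exp (2 * c * (k * η)) := by
    rw [← Real.exp_add, ← Real.exp_add, ← Real.exp_add]
    ring_nf
  split_ifs
  · linear_combination σ ^ 2 * hexp
  all_goals rfl

theorem tendsto_covariance_mildWeight (hc : c ≠ 0) (hΔ : 0 < Δ) {n n' L : ℕ} (hnL : n ≤ L) :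
    Tendsto (fun m : ℕ => Real.exp (-c * (n * Δ)) * Real.exp (-c * (n' * Δ)) * (σ ^ 2 / (2 * c))
        + Δ / (m + 1) * ∑ k ∈ Finset.range (L * (m + 1)),
          mildWeight c σ (Δ / (m + 1)) (n * (m + 1)) k
            * mildWeight c σ (Δ / (m + 1)) (n' * (m + 1)) k) atTop
      (𝓝 (σ ^ 2 / (2 * c) * Real.exp (-c * (|(n : ℝ) - n'| * Δ)))) := by
  have hsum := ((tendsto_mul_sum_exp (mul_ne_zero two_ne_zero hc) hΔ (min n n')).const_mul
    (σ ^ 2 * (Real.exp (-c * (n * Δ)) * Real.exp (-c * (n' * Δ))))).const_add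
    (Real.exp (-c * (n * Δ)) * Real.exp (-c * (n' * Δ)) * (σ ^ 2 / (2 * c)))
  have hexp : Real.exp (-c * (|(n : ℝ) - n'| * Δ))
      = Real.exp (-c * (n * Δ)) * Real.exp (-c * (n' * Δ))
        * Real.exp (2 * c * ((min n n' : ℕ) * Δ)) := by
    have hmin : 2 * min (n : ℝ) n' = n + n' - |(n : ℝ) - n'| := by
      linarith [max_add_min (n : ℝ) n', max_sub_min_eq_abs' (n : ℝ) n']
    rw [← Real.exp_add, ← Real.exp_add, Nat.cast_min]
    congr 1
    linear_combination -c * Δ * hmin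
  rw [hexp]
  convert hsum using 2 with m
  · rw [sum_mildWeight_mul_mildWeight (Nat.mul_le_mul_right _ hnL),
      natCast_mul_succ_mul_div_succ, natCast_mul_succ_mul_div_succ, Nat.mul_min_mul_right]
    ring
  · ring

theorem integralSecondDiff_exp_neg_mul_natAbs (hc : c ≠ 0) (n n' : ℕ) :
    integralSecondDiff (fun s => Real.exp (-c * s)) Δ ((n : ℤ) - n').natAbs
      = (2 * Real.exp (-c * (|(n : ℝ) - n'| * Δ)) - Real.exp (-c * (|(n : ℝ) + 1 - n'| * Δ))
        - Real.exp (-c * (|(n : ℝ) - (n' + 1)| * Δ))) / c := by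
  have hcast : ((((n : ℤ) - n').natAbs : ℕ) : ℝ) = |(n : ℝ) - n'| := by
    rw [Nat.cast_natAbs]
    push_cast
    rfl
  rw [integralSecondDiff_exp_neg_mul hc, hcast]
  rcases le_or_gt (n : ℝ) n' with h | h
  · rw [abs_of_nonpos (sub_nonpos.2 h), abs_of_nonpos (by linarith : (n : ℝ) - (n' + 1) ≤ 0),
      show -((n : ℝ) - n') - 1 = -((n : ℝ) + 1 - n') by ring, abs_neg,
      show -((n : ℝ) - n') + 1 = -((n : ℝ) - (n' + 1)) by ring]
    ring
  · have _ : (n' : ℝ) + 1 ≤ n := by exact_mod_cast h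
    rw [abs_of_pos (sub_pos.2 h), abs_of_nonneg (by linarith : 0 ≤ (n : ℝ) + 1 - n'),
      show (n : ℝ) - n' - 1 = (n : ℝ) - (n' + 1) by ring,
      show (n : ℝ) - n' + 1 = (n : ℝ) + 1 - n' by ring]

theorem tendsto_covariance_mildWeight_sub (hc : c ≠ 0) (hΔ : 0 < Δ) {n n' L : ℕ} (hnL : n < L) :
    Tendsto (fun m : ℕ => (Real.exp (-c * ((n + 1 : ℕ) * Δ)) - Real.exp (-c * (n * Δ)))
          * (Real.exp (-c * ((n' + 1 : ℕ) * Δ)) - Real.exp (-c * (n' * Δ))) * (σ ^ 2 / (2 * c))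
        + Δ / (m + 1) * ∑ k ∈ Finset.range (L * (m + 1)),
          (mildWeight c σ (Δ / (m + 1)) ((n + 1) * (m + 1))
            - mildWeight c σ (Δ / (m + 1)) (n * (m + 1))) k
          * (mildWeight c σ (Δ / (m + 1)) ((n' + 1) * (m + 1))
            - mildWeight c σ (Δ / (m + 1)) (n' * (m + 1))) k) atTop
      (𝓝 (σ ^ 2 / 2
        * integralSecondDiff (fun s => Real.exp (-c * s)) Δ ((n : ℤ) - n').natAbs)) := by
  have hcov {j j' : ℕ} (hj : j ≤ L) :=
    tendsto_covariance_mildWeight (σ := σ) (n' := j') hc hΔ hj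
  convert (((hcov (j' := n' + 1) hnL).sub (hcov (j' := n') hnL)).sub
    (hcov (j' := n' + 1) hnL.le)).add (hcov (j' := n') hnL.le) using 2 with m
  · simp only [Pi.sub_apply, sub_mul, mul_sub, Finset.sum_sub_distrib]
    ring
  · rw [integralSecondDiff_exp_neg_mul_natAbs hc]
    push_cast
    rw [add_sub_add_right_eq_sub]
    field_simp
    ring

theorem sq_sum_mul_add_mul_sum_sq_sum {ι : Type*} (s : Finset ι) (t : Finset ℕ) (a A : ι → ℝ)
    (w : ι → ℕ → ℝ) (v η : ℝ) :
    (∑ p ∈ s, a p * A p) ^ 2 * v + η * ∑ k ∈ t, (∑ p ∈ s, a p * w p k) ^ 2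
      = ∑ p ∈ s, ∑ q ∈ s, a p * a q * (A p * A q * v + η * ∑ k ∈ t, w p k * w q k) := by
  simp only [sq, Finset.sum_mul_sum, mul_add, Finset.sum_add_distrib]
  congr 1
  · simp only [Finset.sum_mul]
    exact Finset.sum_congr rfl fun p _ => Finset.sum_congr rfl fun q _ => by ring
  · rw [Finset.sum_comm, Finset.mul_sum]
    refine Finset.sum_congr rfl fun p _ => ?_
    rw [Finset.sum_comm, Finset.mul_sum]
    refine Finset.sum_congr rfl fun q _ => ?_
    simp only [Finset.mul_sum]
    exact Finset.sum_congr rfl fun k _ => by ring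

theorem ae_tendsto_pathFunctional_mildWeight {Δ : ℝ≥0} {B U : ℝ≥0 → Ω → ℝ} (hc : 0 ≤ c)
    (hU : ∀ᵐ ω ∂P, Continuous fun t => U t ω)
    (hUB : ∀ᵐ ω ∂P, ∀ t : ℝ≥0, U t ω
      = U 0 ω - c * (∫ s in (0 : ℝ)..(t : ℝ), U (Real.toNNReal s) ω) + σ * B t ω) (L : ℕ) :
    ∀ᵐ ω ∂P, ∀ n ≤ L, Tendsto (fun m : ℕ => pathFunctional (Real.exp (-c * (n * Δ)))
        (mildWeight c σ (Δ / (m + 1)) (n * (m + 1))) (L * (m + 1)) (Δ / (m + 1))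
        (fun t => B t ω, U 0 ω)) atTop (𝓝 (U (n * Δ) ω)) := by
  filter_upwards [hU, hUB] with ω hUω hUBω n hnL
  have hmild := tendsto_mildRiemannSum (V := fun s => U (Real.toNNReal s) ω)
    (B := fun s => B (Real.toNNReal s) ω) hc Δ.coe_nonneg
    (hUω.comp continuous_real_toNNReal) (fun t ht => by
      simpa only [Real.coe_toNNReal t ht, Real.toNNReal_zero] using hUBω (Real.toNNReal t)) n
  have htime : Real.toNNReal ((n : ℝ) * Δ) = n * Δ := by
    rw [Real.toNNReal_mul n.cast_nonneg, Real.toNNReal_natCast, Real.toNNReal_coe]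
  rw [htime, Real.toNNReal_zero] at hmild
  refine hmild.congr fun m => ?_
  rw [← natCast_mul_succ_mul_div_succ n m, pathFunctional_mildWeight (Nat.mul_le_mul_right _ hnL)]

theorem integral_exp_mul_I_eq_of_ae_tendsto [IsFiniteMeasure P] {Z : ℕ → Ω → ℝ} {Zlim : Ω → ℝ}
    {v : ℕ → ℝ} {vlim : ℝ} (hZm : ∀ m, AEMeasurable (Z m) P)
    (hZ : ∀ᵐ ω ∂P, Tendsto (fun m => Z m ω) atTop (𝓝 (Zlim ω))) (hv : Tendsto v atTop (𝓝 vlim))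
    (hZv : ∀ m, ∫ ω, Complex.exp ((Z m ω : ℂ) * Complex.I) ∂P = Complex.exp (-(v m : ℂ) / 2)) :
    ∫ ω, Complex.exp ((Zlim ω : ℂ) * Complex.I) ∂P = Complex.exp (-(vlim : ℂ) / 2) := by
  have hexp : Continuous fun x : ℝ => Complex.exp ((x : ℂ) * Complex.I) := by fun_prop
  have hvar : Continuous fun x : ℝ => Complex.exp (-(x : ℂ) / 2) := by fun_prop
  refine tendsto_nhds_unique (tendsto_integral_of_dominated_convergence (fun _ => 1)
    (fun m => (hexp.measurable.comp_aemeasurable (hZm m)).aestronglyMeasurable)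
    (integrable_const _)
    (fun m => Eventually.of_forall fun ω => (Complex.norm_exp_ofReal_mul_I _).le) ?_) ?_
  · filter_upwards [hZ] with ω hω
    exact (hexp.tendsto _).comp hω
  · exact ((hvar.tendsto _).comp hv).congr fun m => (hZv m).symm

end PathFunctional

section Modes

variable {Ω : Type*} [MeasurableSpace Ω] {μ : Measure Ω} {σ ϑ₂ ϑ₁ ϑ₀ : ℝ}
  {β u : ℕ → ℝ≥0 → Ω → ℝ} {X : ℝ≥0 → ℝ → Ω → ℝ}

theorem integral_exp_sum_mode_increments [IsProbabilityMeasure μ]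
    (hX : IsStationarySPDESolution σ ϑ₂ ϑ₁ ϑ₀ β u X μ)
    (hpos : ∀ l : ℕ, 0 < spdeEigenvalue ϑ₂ ϑ₁ ϑ₀ (l + 1)) {Δ : ℝ≥0} (hΔ : 0 < Δ) {ι : Type*}
    [Fintype ι] (a : ℕ → ι → ℝ) {τ : ι → ℕ} {L : ℕ} (hτ : ∀ p, τ p < L) (n : ℕ) :
    ∫ ω, Complex.exp (((∑ l ∈ Finset.range n, ∑ p, a l p
        * (u l ((τ p + 1 : ℕ) * Δ) ω - u l (τ p * Δ) ω) : ℝ) : ℂ) * Complex.I) ∂μ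
      = Complex.exp (-((∑ l ∈ Finset.range n, ∑ p, ∑ q, a l p * a l q * (σ ^ 2 / 2
        * integralSecondDiff (fun s => Real.exp (-spdeEigenvalue ϑ₂ ϑ₁ ϑ₀ (l + 1) * s)) Δ
          ((τ p : ℤ) - τ q).natAbs) : ℝ) : ℂ) / 2) := by
  set c : ℕ → ℝ := fun l => spdeEigenvalue ϑ₂ ϑ₁ ϑ₀ (l + 1)
  set A : ℕ → ι → ℝ := fun l p =>
    Real.exp (-c l * ((τ p + 1 : ℕ) * Δ)) - Real.exp (-c l * (τ p * Δ))
  set w : ℕ → ℕ → ι → ℕ → ℝ := fun m l p =>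
    mildWeight (c l) σ (Δ / (m + 1)) ((τ p + 1) * (m + 1))
      - mildWeight (c l) σ (Δ / (m + 1)) (τ p * (m + 1))
  have hlim (l : ℕ) := ae_tendsto_pathFunctional_mildWeight (Δ := Δ) (hpos l).le
    (hX.continuous_mode l) (hX.ornstein_uhlenbeck l) L
  refine integral_exp_mul_I_eq_of_ae_tendsto
    (Z := fun m ω => ∑ l ∈ Finset.range n, ∑ p, a l p
      * pathFunctional (A l p) (w m l p) (L * (m + 1)) (Δ / (m + 1)) (fun t => β l t ω, u l 0 ω))
    (fun m => ?_) ?_ (tendsto_finsetSum _ fun l _ => tendsto_finsetSum _ fun p _ =>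
      tendsto_finsetSum _ fun q _ => (tendsto_covariance_mildWeight_sub (σ := σ) (n' := τ q)
        (hpos l).ne' (NNReal.coe_pos.2 hΔ) (hτ p)).const_mul (a l p * a l q)) fun m => ?_
  · have hβ := hX.measurable_noise
    have hu := hX.measurable_mode
    have hpath (l : ℕ) (p : ι) := (measurable_pathFunctional (A l p) (w m l p) (L * (m + 1))
      (Δ / (m + 1))).comp ((measurable_pi_iff.2 (hβ l)).prodMk (hu l 0))
    exact (Finset.measurable_fun_sum _ fun l _ => Finset.measurable_fun_sum _ fun p _ =>
      (hpath l p).const_mul _).aemeasurable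
  · filter_upwards [ae_all_iff.2 hlim] with ω hω
    refine tendsto_finsetSum _ fun l _ => tendsto_finsetSum _ fun p _ => Tendsto.const_mul _ ?_
    simp only [A, w, pathFunctional_sub]
    exact (hω l _ (hτ p)).sub (hω l _ (hτ p).le)
  · simp only [sum_mul_pathFunctional]
    rw [integral_exp_sum_pathFunctional hX.measurable_noise (fun l => hX.measurable_mode l 0)
      (fun l => (hX.isBrownian l).toIsPreBrownianReal) hX.initial_law hX.indep_modes
      hX.indep_initial _ _ _ (by positivity)]
    congr 4
    refine Finset.sum_congr rfl fun l _ => ?_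
    have := hpos l
    rw [Real.coe_toNNReal _ (by positivity), sq_sum_mul_add_mul_sum_sq_sum]

theorem exists_strictMono_ae_tendsto_of_tendstoInMeasure {J E : Type*} [PseudoEMetricSpace E]
    {f : J → ℕ → Ω → E} {g : J → Ω → E} (s : Finset J)
    (h : ∀ j ∈ s, TendstoInMeasure μ (f j) atTop (g j)) :
    ∃ ns : ℕ → ℕ, StrictMono ns ∧
      ∀ᵐ ω ∂μ, ∀ j ∈ s, Tendsto (fun n => f j (ns n) ω) atTop (𝓝 (g j ω)) := by
  classical
  induction s using Finset.induction_on with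
  | empty => exact ⟨id, strictMono_id, by simp⟩
  | insert j s hj ih =>
    obtain ⟨ns, hns, hs⟩ := ih fun i hi => h i (Finset.mem_insert_of_mem hi)
    obtain ⟨ms, hms, hjms⟩ := ((h j (Finset.mem_insert_self j s)).comp
      hns.tendsto_atTop).exists_seq_tendsto_ae
    refine ⟨ns ∘ ms, hns.comp hms, ?_⟩
    filter_upwards [hs, hjms] with ω hsω hjω i hi
    rcases Finset.mem_insert.1 hi with rfl | hi
    · exact hjω
    · exact (hsω i hi).comp hms.tendsto_atTop

end Modes

section Grid

variable {b : ℝ} {M k : ℕ}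

theorem spacePoint_succ (b : ℝ) (M k : ℕ) :
    spacePoint b M (k + 1) = spacePoint b M k + spaceStep b M := by
  simp only [spacePoint, Nat.cast_succ]
  ring

theorem spaceStep_nonneg (hb' : b < 1 / 2) (M : ℕ) : 0 ≤ spaceStep b M :=
  div_nonneg (by linarith) M.cast_nonneg

theorem spacePoint_mem_Icc (hb' : b < 1 / 2) (hk : k ≤ M) :
    spacePoint b M k ∈ Icc b (1 - b) := by
  have hwidth : 0 ≤ 1 - 2 * b := by linarith
  have hfraction : (k : ℝ) / M ≤ 1 := div_le_one_of_le₀ (Nat.cast_le.2 hk) M.cast_nonneg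
  refine ⟨le_add_of_nonneg_right (mul_nonneg k.cast_nonneg (spaceStep_nonneg hb' M)), ?_⟩
  calc spacePoint b M k = b + k / M * (1 - 2 * b) := by rw [spacePoint, spaceStep]; ring
    _ ≤ b + 1 * (1 - 2 * b) := by gcongr
    _ = 1 - b := by ring

theorem spacePoint_mem_Icc_zero_one (hb : 0 ≤ b) (hb' : b < 1 / 2) (hk : k ≤ M) :
    spacePoint b M k ∈ Icc (0 : ℝ) 1 :=
  Icc_subset_Icc hb (by linarith) (spacePoint_mem_Icc hb' hk)

theorem spacePoint_add_spaceStep_le (hb' : b < 1 / 2) (hk : k < M) :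
    spacePoint b M k + spaceStep b M ≤ 1 - b :=
  spacePoint_succ b M k ▸ (spacePoint_mem_Icc hb' hk).2

variable {T : ℝ≥0} {N : ℕ} {r : ℝ}

theorem steps_pos_of_spaceStep_div_eq (hr : r ≠ 0)
    (h : spaceStep b M / √(timeStep T N : ℝ) = r) :
    0 < M ∧ 0 < N ∧ 0 < timeStep T N ∧ spaceStep b M = r * √(timeStep T N : ℝ) := by
  have hne := div_ne_zero_iff.1 (h ▸ hr)
  have hΔ : timeStep T N ≠ 0 := fun h0 => hne.2 (by rw [h0, NNReal.coe_zero, Real.sqrt_zero])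
  have hM : M ≠ 0 := fun h0 => hne.1 (by rw [h0, spaceStep, Nat.cast_zero, div_zero])
  have hN : N ≠ 0 := fun h0 => hΔ (by rw [h0, timeStep, Nat.cast_zero, div_zero])
  exact ⟨Nat.pos_of_ne_zero hM, Nat.pos_of_ne_zero hN, pos_of_ne_zero hΔ, (div_eq_iff hne.2).1 h⟩

theorem natCast_mul_timeStep (T : ℝ≥0) (hN : 0 < N) : (N : ℝ) * timeStep T N = T := by
  rw [timeStep, NNReal.coe_div, NNReal.coe_natCast]
  exact mul_div_cancel₀ _ (Nat.cast_ne_zero.2 hN.ne')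

theorem timeStep_mul_sqrt_eq (hr : r ≠ 0) (h : spaceStep b M / √(timeStep T N : ℝ) = r) :
    (timeStep T N : ℝ) * √((M : ℝ) * N) = √(T : ℝ) * ((1 - 2 * b) / r) / √(M : ℝ) := by
  obtain ⟨hM, hN, -, hδ⟩ := steps_pos_of_spaceStep_div_eq hr h
  have hM' : (M : ℝ) ≠ 0 := Nat.cast_ne_zero.2 hM.ne'
  have hwidth : (1 - 2 * b) / r = √(timeStep T N : ℝ) * M := by
    rw [div_eq_iff hr, ← div_mul_cancel₀ (1 - 2 * b) hM', ← spaceStep, hδ]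
    ring
  rw [← natCast_mul_timeStep T hN, hwidth, Real.sqrt_mul M.cast_nonneg,
    Real.sqrt_mul N.cast_nonneg, eq_div_iff (Real.sqrt_ne_zero'.2 (by positivity))]
  linear_combination (norm := ring_nf) (√(N : ℝ)) * (timeStep T N : ℝ) *
    Real.mul_self_sqrt M.cast_nonneg - √(N : ℝ) * M * Real.mul_self_sqrt (timeStep T N).coe_nonneg

theorem tendsto_timeStep_mul_sqrt {M N : ℕ → ℕ} (hM : Tendsto M atTop atTop) (hr : r ≠ 0)
    (h : ∀ n, spaceStep b (M n) / √(timeStep T (N n) : ℝ) = r) :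
    Tendsto (fun n => (timeStep T (N n) : ℝ) * √((M n : ℝ) * N n)) atTop (𝓝 0) := by
  simp only [fun n => timeStep_mul_sqrt_eq hr (h n)]
  exact (Real.tendsto_sqrt_atTop.comp (tendsto_natCast_atTop_atTop.comp hM)).const_div_atTop _

end Grid

section Increments

variable {Ω : Type*} {σ ϑ₂ ϑ₁ ϑ₀ b r : ℝ} {T : ℝ≥0} {M N : ℕ}

/-- The increment over `[y_k, y_{k+1}]` of the eigenfunction with number `l + 1`, weighted by
`exp (κ (y_k + y_{k+1}) / 4)`. The weight turns the factors `exp (-κ y / 2)` of the two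
eigenfunction values into `exp (∓κ δ / 4)`, which no longer depend on `k`. -/
noncomputable def eigenIncrement (κ b : ℝ) (M l k : ℕ) : ℝ :=
  √2 * (Real.exp (-(κ * spaceStep b M / 4))
      * Real.sin (Real.pi * (l + 1) * (spacePoint b M k + spaceStep b M))
    - (Real.exp (-(κ * spaceStep b M / 4)))⁻¹ * Real.sin (Real.pi * (l + 1) * spacePoint b M k))

theorem exp_mul_spdeEigenfunction_sub_eq_eigenIncrement (ϑ₂ ϑ₁ b : ℝ) (M l k : ℕ) :
    Real.exp (spdeKappa ϑ₂ ϑ₁ / 4 * (spacePoint b M k + spacePoint b M (k + 1)))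
      * (spdeEigenfunction ϑ₂ ϑ₁ (l + 1) (spacePoint b M (k + 1))
        - spdeEigenfunction ϑ₂ ϑ₁ (l + 1) (spacePoint b M k))
      = eigenIncrement (spdeKappa ϑ₂ ϑ₁) b M l k := by
  rw [spacePoint_succ, spdeEigenfunction, spdeEigenfunction, eigenIncrement, ← Real.exp_neg]
  generalize spacePoint b M k = y, spaceStep b M = δ, spdeKappa ϑ₂ ϑ₁ = κ
  have hright : Real.exp (-(κ * δ / 4))
      = Real.exp (κ / 4 * (y + (y + δ))) * Real.exp (-(κ * (y + δ)) / 2) := by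
    rw [← Real.exp_add]
    ring_nf
  have hleft : Real.exp (- -(κ * δ / 4))
      = Real.exp (κ / 4 * (y + (y + δ))) * Real.exp (-(κ * y) / 2) := by
    rw [← Real.exp_add]
    ring_nf
  rw [hright, hleft]
  push_cast
  ring

/-- The weighted double increments `exp (κ (y_k + y_{k+1}) / 4) D_{ik}`, whose squares are summed
in the realized variation; `p = (i, k)`. -/
noncomputable def weightedIncrement (X : ℝ≥0 → ℝ → Ω → ℝ) (κ b : ℝ) (T : ℝ≥0) (M N : ℕ) (ω : Ω)
    (p : Fin N × Fin M) : ℝ :=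
  Real.exp (κ / 4 * (spacePoint b M p.2 + spacePoint b M (p.2 + 1)))
    * doubleIncrement X b T M N p.1 p.2 ω

/-- The partial sums of the spectral representation of the solution. -/
noncomputable def spectralSum (ϑ₂ ϑ₁ : ℝ) (u : ℕ → ℝ≥0 → Ω → ℝ) (n : ℕ) (t : ℝ≥0) (x : ℝ)
    (ω : Ω) : ℝ :=
  ∑ l ∈ Finset.range n, u l t ω * spdeEigenfunction ϑ₂ ϑ₁ (l + 1) x

theorem weightedIncrement_spectralSum (ϑ₂ ϑ₁ b : ℝ) (u : ℕ → ℝ≥0 → Ω → ℝ) (n : ℕ) (T : ℝ≥0)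
    (ω : Ω) (p : Fin N × Fin M) :
    weightedIncrement (spectralSum ϑ₂ ϑ₁ u n) (spdeKappa ϑ₂ ϑ₁) b T M N ω p
      = ∑ l ∈ Finset.range n, eigenIncrement (spdeKappa ϑ₂ ϑ₁) b M l p.2
        * (u l (timePoint T N (p.1 + 1)) ω - u l (timePoint T N p.1) ω) := by
  simp only [weightedIncrement, doubleIncrement, spectralSum, ← Finset.sum_sub_distrib,
    ← Finset.sum_add_distrib, Finset.mul_sum]
  refine Finset.sum_congr rfl fun l _ => ?_
  rw [← exp_mul_spdeEigenfunction_sub_eq_eigenIncrement]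
  ring

theorem sqrt_mul_realizedVariation (X : ℝ≥0 → ℝ → Ω → ℝ) (κ b : ℝ) (T : ℝ≥0) (M N : ℕ) (ω : Ω) :
    √((M : ℝ) * N) * realizedVariation X κ b T M N ω
      = ∑ p, ((√(√((M : ℝ) * N) * √(timeStep T N : ℝ)))⁻¹
        * weightedIncrement X κ b T M N ω p) ^ 2 := by
  have hweight : ∀ y y' : ℝ, Real.exp (κ / 4 * (y + y')) ^ 2 = Real.exp (κ / 2 * (y + y')) := by
    intro y y'
    rw [← Real.exp_nat_mul]
    ring_nf
  simp only [weightedIncrement, mul_pow, inv_pow, hweight, realizedVariation, Finset.sum_range,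
    Real.sq_sqrt (mul_nonneg (Real.sqrt_nonneg ((M : ℝ) * N)) (Real.sqrt_nonneg _)),
    Fintype.sum_prod_type_right, ← Finset.mul_sum]
  rw [← mul_assoc, mul_one_div, ← div_div, Real.sqrt_div_self', mul_inv, div_eq_mul_inv, one_div]

/-- The covariance matrix of the weighted double increments of the stationary solution. -/
noncomputable def weightedIncrementCov (σ ϑ₂ ϑ₁ ϑ₀ b : ℝ) (T : ℝ≥0) (M N : ℕ) :
    Matrix (Fin N × Fin M) (Fin N × Fin M) ℝ :=
  Matrix.of fun p q => σ ^ 2 / 2 * incrementCov ϑ₂ (ϑ₂ * spdeGamma ϑ₂ ϑ₁ ϑ₀)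
    (Real.exp (-(spdeKappa ϑ₂ ϑ₁ * spaceStep b M / 4))) (spaceStep b M) (timeStep T N)
    (spacePoint b M p.2) (spacePoint b M q.2) (gridSub p q).1.natAbs

theorem hasSum_weightedIncrementCov (hϑ : 0 < ϑ₂)
    (hΓ : 0 < spdeGamma ϑ₂ ϑ₁ ϑ₀ + Real.pi ^ 2) (hb : 0 < b) (hb' : b < 1 / 2) (σ : ℝ) (T : ℝ≥0)
    (p q : Fin N × Fin M) :
    HasSum (fun l => σ ^ 2 / 2
      * (integralSecondDiff (fun s => Real.exp (-spdeEigenvalue ϑ₂ ϑ₁ ϑ₀ (l + 1) * s))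
          (timeStep T N) (gridSub p q).1.natAbs
        * (eigenIncrement (spdeKappa ϑ₂ ϑ₁) b M l p.2
          * eigenIncrement (spdeKappa ϑ₂ ϑ₁) b M l q.2)))
      (weightedIncrementCov σ ϑ₂ ϑ₁ ϑ₀ b T M N p q) :=
  (hasSum_incrementCov hϑ hΓ hb hb' (Real.exp_pos _).ne' (spaceStep_nonneg hb' M)
    (spacePoint_mem_Icc hb' p.2.2.le).1 (spacePoint_add_spaceStep_le hb' p.2.2)
    (spacePoint_mem_Icc hb' q.2.2.le).1 (spacePoint_add_spaceStep_le hb' q.2.2)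
    (timeStep T N).coe_nonneg _).mul_left _

theorem isHermitian_weightedIncrementCov (hϑ : 0 < ϑ₂)
    (hΓ : 0 < spdeGamma ϑ₂ ϑ₁ ϑ₀ + Real.pi ^ 2) (hb : 0 < b) (hb' : b < 1 / 2) (σ : ℝ) (T : ℝ≥0)
    (M N : ℕ) : (weightedIncrementCov σ ϑ₂ ϑ₁ ϑ₀ b T M N).IsHermitian := by
  refine Matrix.IsHermitian.ext fun p q => ?_
  have hlag : (gridSub p q).1.natAbs = (gridSub q p).1.natAbs := by
    simp only [gridSub]
    omega
  refine (hasSum_weightedIncrementCov hϑ hΓ hb hb' σ T q p).unique ?_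
  simpa only [hlag, mul_comm (eigenIncrement _ b M _ p.2)] using
    hasSum_weightedIncrementCov hϑ hΓ hb hb' σ T p q

theorem exists_abs_sqrt_mul_weightedIncrementCov_sub_le (σ ϑ₁ ϑ₀ : ℝ) (hϑ : 0 < ϑ₂) (hb : 0 < b)
    (hb' : b < 1 / 2) (hT : 0 < T) (hr : 0 < r) :
    ∃ C : ℝ, ∀ M N : ℕ, spaceStep b M / √(timeStep T N : ℝ) = r → ∀ p q : Fin N × Fin M,
      |√((M : ℝ) * N) * ((√((M : ℝ) * N) * √(timeStep T N : ℝ))⁻¹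
          * weightedIncrementCov σ ϑ₂ ϑ₁ ϑ₀ b T M N p q)
        - -(σ ^ 2 / √ϑ₂) * LambdaFun (r / √ϑ₂) (gridSub p q).1 (gridSub p q).2|
        ≤ C * timeStep T N := by
  obtain ⟨C, hC⟩ := exists_abs_incrementCov_sub_LambdaFun_le (ϑ₂ * spdeGamma ϑ₂ ϑ₁ ϑ₀)
    (spdeKappa ϑ₂ ϑ₁) hϑ hb hb' (NNReal.coe_pos.2 hT) hr.le
  refine ⟨σ ^ 2 / 2 * C, fun M N h p q => ?_⟩
  obtain ⟨hM, hN, hΔ, hδ⟩ := steps_pos_of_spaceStep_div_eq hr.ne' h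
  have hlag : ((gridSub p q).1.natAbs : ℝ) + 1 ≤ N := by
    have hnat : (gridSub p q).1.natAbs + 1 ≤ N := by
      have := p.1.2
      have := q.1.2
      simp only [gridSub]
      omega
    exact_mod_cast hnat
  have hbound := hC (timeStep T N) (spaceStep b M) (spacePoint b M p.2) (spacePoint b M q.2)
    (gridSub p q).1 (gridSub p q).2 (NNReal.coe_pos.2 hΔ)
    ((mul_le_mul_of_nonneg_right hlag NNReal.zero_le_coe).trans_eq (natCast_mul_timeStep T hN)) hδ
    (spacePoint_mem_Icc hb' p.2.2.le).1 (spacePoint_add_spaceStep_le hb' p.2.2)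
    (spacePoint_mem_Icc hb' q.2.2.le).1 (spacePoint_add_spaceStep_le hb' q.2.2)
    (by simp only [gridSub, spacePoint]; push_cast; ring)
  rw [weightedIncrementCov, Matrix.of_apply]
  set V := incrementCov ϑ₂ (ϑ₂ * spdeGamma ϑ₂ ϑ₁ ϑ₀)
    (Real.exp (-(spdeKappa ϑ₂ ϑ₁ * spaceStep b M / 4))) (spaceStep b M) (timeStep T N)
    (spacePoint b M p.2) (spacePoint b M q.2) (gridSub p q).1.natAbs
  set L := LambdaFun (r / √ϑ₂) (gridSub p q).1 (gridSub p q).2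
  have _ : 0 < √(timeStep T N : ℝ) := Real.sqrt_pos.2 hΔ
  have hMN : √((M : ℝ) * N) ≠ 0 := (Real.sqrt_pos.2 (by positivity)).ne'
  calc _ = |σ ^ 2 / 2 / √(timeStep T N : ℝ) * (V - √(timeStep T N : ℝ) * (-(2 / √ϑ₂) * L))| := by
        congr 1
        field_simp
    _ = σ ^ 2 / 2 / √(timeStep T N : ℝ) * |V - √(timeStep T N : ℝ) * (-(2 / √ϑ₂) * L)| := by
        rw [abs_mul, abs_of_nonneg (by positivity)]
    _ ≤ σ ^ 2 / 2 / √(timeStep T N : ℝ) * (C * (timeStep T N * √(timeStep T N : ℝ))) := by gcongr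
    _ = σ ^ 2 / 2 * C * timeStep T N := by field_simp

variable [MeasurableSpace Ω] {μ : Measure Ω} {β u : ℕ → ℝ≥0 → Ω → ℝ} {X : ℝ≥0 → ℝ → Ω → ℝ}

theorem aemeasurable_weightedIncrement (hX : IsStationarySPDESolution σ ϑ₂ ϑ₁ ϑ₀ β u X μ)
    (hb : 0 ≤ b) (hb' : b < 1 / 2) (κ : ℝ) (T : ℝ≥0) (p : Fin N × Fin M) :
    AEMeasurable (fun ω => weightedIncrement X κ b T M N ω p) μ := by
  have hfield : ∀ t k, k ≤ M → AEMeasurable (X t (spacePoint b M k)) μ := fun t k hk =>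
    (hX.series t _ (spacePoint_mem_Icc_zero_one hb hb' hk)).aemeasurable fun n =>
      (Finset.measurable_fun_sum _ fun l _ => (hX.measurable_mode l t).mul_const _).aemeasurable
  simp only [weightedIncrement, doubleIncrement]
  exact ((((hfield _ _ p.2.2).sub (hfield _ _ p.2.2.le)).sub (hfield _ _ p.2.2)).add
    (hfield _ _ p.2.2.le)).const_mul _

theorem exists_strictMono_ae_tendsto_weightedIncrement
    (hX : IsStationarySPDESolution σ ϑ₂ ϑ₁ ϑ₀ β u X μ) (hb : 0 ≤ b) (hb' : b < 1 / 2) (κ : ℝ)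
    (T : ℝ≥0) (M N : ℕ) :
    ∃ ns : ℕ → ℕ, StrictMono ns ∧ ∀ᵐ ω ∂μ, ∀ p, Tendsto
      (fun n => weightedIncrement (spectralSum ϑ₂ ϑ₁ u (ns n)) κ b T M N ω p) atTop
      (𝓝 (weightedIncrement X κ b T M N ω p)) := by
  obtain ⟨ns, hns, hae⟩ := exists_strictMono_ae_tendsto_of_tendstoInMeasure (μ := μ)
    (f := fun (z : ℕ × ℕ) n => spectralSum ϑ₂ ϑ₁ u n (timePoint T N z.1) (spacePoint b M z.2))
    (g := fun z => X (timePoint T N z.1) (spacePoint b M z.2))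
    (Finset.range (N + 1) ×ˢ Finset.range (M + 1)) fun z hz => hX.series _ _
      (spacePoint_mem_Icc_zero_one hb hb' (Finset.mem_range_succ_iff.1 (Finset.mem_product.1 hz).2))
  refine ⟨ns, hns, ?_⟩
  filter_upwards [hae] with ω hω p
  have hgrid {i k : ℕ} (hi : i ≤ N) (hk : k ≤ M) := hω (i, k)
    (Finset.mem_product.2 ⟨Finset.mem_range_succ_iff.2 hi, Finset.mem_range_succ_iff.2 hk⟩)
  exact ((((hgrid p.1.2 p.2.2).sub (hgrid p.1.2 p.2.2.le)).sub (hgrid p.1.2.le p.2.2)).add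
    (hgrid p.1.2.le p.2.2.le)).const_mul _

theorem integral_exp_sum_weightedIncrement_spectralSum [IsProbabilityMeasure μ]
    (hX : IsStationarySPDESolution σ ϑ₂ ϑ₁ ϑ₀ β u X μ)
    (hpos : ∀ l : ℕ, 0 < spdeEigenvalue ϑ₂ ϑ₁ ϑ₀ (l + 1)) (hΔ : 0 < timeStep T N) (b : ℝ)
    (w : Fin N × Fin M → ℝ) (n : ℕ) :
    ∫ ω, Complex.exp (((∑ p, w p
        * weightedIncrement (spectralSum ϑ₂ ϑ₁ u n) (spdeKappa ϑ₂ ϑ₁) b T M N ω p : ℝ) : ℂ)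
        * Complex.I) ∂μ
      = Complex.exp (-((∑ l ∈ Finset.range n, ∑ p, ∑ q, w p * w q * (σ ^ 2 / 2
        * (integralSecondDiff (fun s => Real.exp (-spdeEigenvalue ϑ₂ ϑ₁ ϑ₀ (l + 1) * s))
            (timeStep T N) (gridSub p q).1.natAbs
          * (eigenIncrement (spdeKappa ϑ₂ ϑ₁) b M l p.2
            * eigenIncrement (spdeKappa ϑ₂ ϑ₁) b M l q.2))) : ℝ) : ℂ) / 2) := by
  convert integral_exp_sum_mode_increments hX hpos hΔ
    (fun l p => w p * eigenIncrement (spdeKappa ϑ₂ ϑ₁) b M l p.2) (τ := fun p => (p.1 : ℕ))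
    (fun p => p.1.2) n using 7 with ω
  · simp only [weightedIncrement_spectralSum, Finset.mul_sum, mul_assoc, timePoint]
    exact Finset.sum_comm
  · refine Finset.sum_congr rfl fun q _ => ?_
    simp only [gridSub]
    ring

theorem integral_exp_sum_weightedIncrement [IsProbabilityMeasure μ]
    (hX : IsStationarySPDESolution σ ϑ₂ ϑ₁ ϑ₀ β u X μ) (hϑ : 0 < ϑ₂)
    (hΓ : 0 < spdeGamma ϑ₂ ϑ₁ ϑ₀ + Real.pi ^ 2) (hb : 0 < b) (hb' : b < 1 / 2)
    (hΔ : 0 < timeStep T N) (w : Fin N × Fin M → ℝ) :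
    ∫ ω, Complex.exp (((∑ p, w p * weightedIncrement X (spdeKappa ϑ₂ ϑ₁) b T M N ω p : ℝ) : ℂ)
        * Complex.I) ∂μ
      = Complex.exp (-((∑ p, ∑ q, w p * w q * weightedIncrementCov σ ϑ₂ ϑ₁ ϑ₀ b T M N p q : ℝ)
        : ℂ) / 2) := by
  obtain ⟨ns, hns, hae⟩ :=
    exists_strictMono_ae_tendsto_weightedIncrement hX hb.le hb' (spdeKappa ϑ₂ ϑ₁) T M N
  have hcov := (hasSum_sum (s := Finset.univ) fun p _ => hasSum_sum (s := Finset.univ) fun q _ =>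
    (hasSum_weightedIncrementCov hϑ hΓ hb hb' σ T p q).mul_left (w p * w q)).tendsto_sum_nat
  refine integral_exp_mul_I_eq_of_ae_tendsto (fun n => ?_) ?_ (hcov.comp hns.tendsto_atTop)
    fun n => integral_exp_sum_weightedIncrement_spectralSum hX (spdeEigenvalue_succ_pos hϑ hΓ) hΔ b
      w (ns n)
  · have := hX.measurable_mode
    simp only [weightedIncrement_spectralSum]
    exact Measurable.aemeasurable (by fun_prop)
  · filter_upwards [hae] with ω hω
    exact tendsto_finsetSum _ fun p _ => (hω p).const_mul (w p)

theorem integral_exp_sum_mul_weightedIncrement [IsProbabilityMeasure μ]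
    (hX : IsStationarySPDESolution σ ϑ₂ ϑ₁ ϑ₀ β u X μ) (hϑ : 0 < ϑ₂)
    (hΓ : 0 < spdeGamma ϑ₂ ϑ₁ ϑ₀ + Real.pi ^ 2) (hb : 0 < b) (hb' : b < 1 / 2)
    (hΔ : 0 < timeStep T N) {c : ℝ} (hc : 0 ≤ c) (w : Fin N × Fin M → ℝ) :
    ∫ ω, Complex.exp (((∑ p, w p * ((√c)⁻¹
        * weightedIncrement X (spdeKappa ϑ₂ ϑ₁) b T M N ω p) : ℝ) : ℂ) * Complex.I) ∂μ
      = Complex.exp (-((∑ p, ∑ q, w p * w q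
        * (c⁻¹ • weightedIncrementCov σ ϑ₂ ϑ₁ ϑ₀ b T M N) p q : ℝ) : ℂ) / 2) := by
  have hsq : (√c)⁻¹ * (√c)⁻¹ = c⁻¹ := by rw [← mul_inv, Real.mul_self_sqrt hc]
  convert integral_exp_sum_weightedIncrement hX hϑ hΓ hb hb' hΔ fun p => w p * (√c)⁻¹ using 7
  · simp only [mul_assoc]
  · rw [Matrix.smul_apply, smul_eq_mul, ← hsq]
    ring

end Increments

theorem psiFun_pos {ϑ₂ r : ℝ} (hϑ : 0 < ϑ₂) (hr : 0 < r) : 0 < psiFun ϑ₂ r := by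
  have hexp : Real.exp (-(r ^ 2 / (4 * ϑ₂))) < 1 :=
    Real.exp_lt_one_iff.2 (neg_lt_zero.2 (by positivity))
  have _ : 0 ≤ ∫ z in Ioi (r / (2 * √ϑ₂)), Real.exp (-z ^ 2) :=
    integral_nonneg fun z => (Real.exp_pos _).le
  exact mul_pos (by positivity) (add_pos_of_pos_of_nonneg (sub_pos.2 hexp) (by positivity))

theorem two_mul_tsum_sq_LambdaFun {ϑ₂ r : ℝ} (σ : ℝ) (hϑ : 0 < ϑ₂) (hr : 0 < r) :
    2 * ∑' z : ℤ × ℤ, (-(σ ^ 2 / √ϑ₂) * LambdaFun (r / √ϑ₂) z.1 z.2) ^ 2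
      = CFun (r / √ϑ₂) * psiFun ϑ₂ r ^ 2 * σ ^ 4 := by
  have hψ := psiFun_eq (r := r) hϑ
  have hΛ : LambdaFun (r / √ϑ₂) 0 0 ≠ 0 := fun h =>
    (psiFun_pos hϑ hr).ne' (by rw [hψ, h, zero_div, neg_zero])
  have hϑ' : √ϑ₂ ≠ 0 := (Real.sqrt_pos.2 hϑ).ne'
  simp only [mul_pow, tsum_mul_left, hψ, CFun]
  field_simp

theorem mainTheorem6 {Ω : Type*} [MeasurableSpace Ω] (μ : Measure Ω) [IsProbabilityMeasure μ]
    (σ ϑ₂ ϑ₁ ϑ₀ : ℝ) (hσ : 0 < σ ^ 2) (hϑ₂ : 0 < ϑ₂)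
    (hΓ : 0 < ϑ₁ ^ 2 / (4 * ϑ₂ ^ 2) - ϑ₀ / ϑ₂ + Real.pi ^ 2)
    (β u : ℕ → ℝ≥0 → Ω → ℝ) (X : ℝ≥0 → ℝ → Ω → ℝ)
    (hX : IsStationarySPDESolution σ ϑ₂ ϑ₁ ϑ₀ β u X μ)
    (T : ℝ≥0) (hT : 0 < T) (b : ℝ) (hb : 0 < b) (hb' : b < 1 / 2)
    (M N : ℕ → ℕ) (hM : Tendsto M atTop atTop) (hN : Tendsto N atTop atTop)
    (r : ℝ) (hr : 0 < r) (hδΔ : ∀ n, spaceStep b (M n) / √(timeStep T (N n) : ℝ) = r) :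
    (Summable fun p : ℤ × ℤ => LambdaFun (r / √ϑ₂) p.1 p.2 ^ 2) ∧
    TendstoInDistribution
      (fun n ω => √((M n : ℝ) * (N n : ℝ)) *
        (realizedVariation X (spdeKappa ϑ₂ ϑ₁) b T (M n) (N n) ω - psiFun ϑ₂ r * σ ^ 2))
      atTop (id : ℝ → ℝ) (fun _ => μ)
      (gaussianReal 0
        (Real.toNNReal (CFun (r / √ϑ₂) * psiFun ϑ₂ r ^ 2 * σ ^ 4))) := by
  have hΛ := summable_sq_LambdaFun (div_pos hr (Real.sqrt_pos.2 hϑ₂))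
  refine ⟨hΛ, ?_⟩
  obtain ⟨C, hC⟩ := exists_abs_sqrt_mul_weightedIncrementCov_sub_le σ ϑ₁ ϑ₀ hϑ₂ hb hb' hT hr
  set c : ℕ → ℝ := fun n => √((M n : ℝ) * N n) * √(timeStep T (N n) : ℝ)
  have hclt := tendstoInDistribution_sum_sq_of_toeplitz (P := μ) hM hN
    (Y := fun n ω p => (√(c n))⁻¹ * weightedIncrement X (spdeKappa ϑ₂ ϑ₁) b T (M n) (N n) ω p)
    (S := fun n => (c n)⁻¹ • weightedIncrementCov σ ϑ₂ ϑ₁ ϑ₀ b T (M n) (N n))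
    (v := fun z => -(σ ^ 2 / √ϑ₂) * LambdaFun (r / √ϑ₂) z.1 z.2)
    (ε := fun n => C * timeStep T (N n))
    (by simpa only [mul_pow] using hΛ.mul_left _)
    (fun n => aemeasurable_pi_iff.2 fun p =>
      (aemeasurable_weightedIncrement hX hb.le hb' _ T p).const_mul _)
    (fun n => (isHermitian_weightedIncrementCov hϑ₂ hΓ hb hb' σ T _ _).smul (.all _))
    (fun n => integral_exp_sum_mul_weightedIncrement hX hϑ₂ hΓ hb hb'
      (steps_pos_of_spaceStep_div_eq hr.ne' (hδΔ n)).2.2.1 (by positivity))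
    (by simpa only [mul_assoc, mul_zero] using
      (tendsto_timeStep_mul_sqrt hM hr.ne' hδΔ).const_mul C)
    (fun n => hC _ _ (hδΔ n))
  rw [two_mul_tsum_sq_LambdaFun σ hϑ₂ hr] at hclt
  convert hclt using 3 with n ω
  rw [mul_sub, sqrt_mul_realizedVariation, psiFun_eq hϑ₂, Prod.fst_zero, Prod.snd_zero]
  ring
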